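/- **Setting.** Let $x=(x_1,x_2,\dots)$, $y=(y_1,y_2,\dots)$, and let $\mathcal B=\mathbb C[[x,y;p,p^{-1}]]$ be the completed bosonic Fock space, i.e. the space of all formal sums $\sum_{m\in\mathbb Z}g_m p^m$ with $g_m\in\mathbb C[[x,y]]$. Define the operators $\varphi_i,\varphi^*_i$ ($i\in\mathbb Z$) on $\mathcal B$ by $\varphi(z)=\sum_{i}\varphi_i z^{-i-1}$, $\varphi^*(z)=\sum_i\varphi^*_i z^{-i}$ and $$\varphi(z)=p^{-1}\exp\Big(-\sum_{n>0}(x_n+y_n)z^n\Big)\exp\Big(\sum_{n>0}(\partial_{x_n}-\partial_{y_n})\frac{z^{-n}}n\Big),$$ $$\varphi^*(z)=p\exp\Big(\sum_{n>0}(x_n+y_n)z^n\Big)\Big(\sum_{n>0}n x_n z^{n-1}+\sum_{n>0}\partial_{x_n}z^{-n-1}+p\,\partial_p z^{-1}\Big)\exp\Big(-\sum_{n>0}(\partial_{x_n}-\partial_{y_n})\frac{z^{-n}}n\Big).$$ Define $S_n(x+y)$ and $S_n(-x-y)$, $n\ge0$, by $\sum_n S_n(\pm(x+y))z^n=\exp\big(\pm\sum_{n\ge1}(x_n+y_n)z^n\big)$,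 and for $s\ge1$, $t\ge0$ put $A_{s,t}=\sum_{m=0}^tS_m(x+y)S_{s+t-m}(-x-y)$. All infinite sums are coefficientwise finite. **Corollary 3.8 (two-exponential tau functions).** Let $k,l\ge0$ be integers and $w_1,w_2$ indeterminates. Put $$G(z)=\Big(\sum_{m=0}^lS_m(x+y)z^{-l-1+m}\Big)w_1+\Big(\sum_{m=0}^kS_m(x+y)z^{-k-1+m}\Big)w_2 .$$ For $n\ge1$ write $G(z)^n=\sum_{r=0}^{n(l+k+1)}f_r(w_1,w_2)z^{-n(l+k+2)+r}$ (the $f_r$ depend on $n$), and let $p_n=\sum_{r=0}^{n(l+k+1)}f_r(w_1,w_2)\,(n(l+k+2)-r)\,x_{n(l+k+2)-r}$ and $f(w_1,w_2)=\exp\big(-\sum_{n\ge1}p_n/n\big)\in\mathbb C[[x,y]][[w_1,w_2]]$. Then $$\exp\Big(\sum_{n\ge1}\frac{\partial_{x_n}-\partial_{y_n}}nz^{-n}\Big)f(w_1,w_2)=(1-G(z))\,f(w_1,w_2).$$ Suppose moreover that $k\ge l\ge0$. Then for all $a,b\in\mathbb C$, in $\mathcal B$, $$\exp(b\varphi^*_{-k})\exp(a\varphi^*_{-l})\cdot1=f(-ap,-bp),$$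 and for all $c,d\in\mathbb C$ and all integers $i,j\ge1$, in $\mathcal B$, $$\exp(d\varphi_{-j}\varphi^*_{-k})\exp(c\varphi_{-i}\varphi^*_{-l})\cdot1=\frac1\Delta\,f\Big(\frac{N_1}\Delta,\frac{N_2}\Delta\Big),$$ where $$\Delta=1-cA_{i,l}-dA_{j,k}+cA_{i,l}\,dA_{j,k}-cA_{i,k}\,dA_{j,l},$$ $$N_1=-cS_{i-1}(-x-y)+cS_{i-1}(-x-y)\,dA_{j,k}-dS_{j-1}(-x-y)\,cA_{i,k},$$ $$N_2=-dS_{j-1}(-x-y)+dS_{j-1}(-x-y)\,cA_{i,l}-cS_{i-1}(-x-y)\,dA_{j,l}.$$ Here $\Delta$ has constant term $1$, hence is invertible in $\mathbb C[[x,y]]$, and all the series involved (the exponentials applied to vectors and the substitutions into $f$) are coefficientwise finite. -/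

import Mathlib

noncomputable section

namespace FMS

open Finset

/-! ### Formal sums and formal exponentials -/

/-- `HasFormalSum u s`: the family `u` of formal power series is coefficientwise finite (every
coefficient is nonzero for finitely many indices only) and its sum is `s`. -/
def HasFormalSum {ι σ R : Type*} [Semiring R] (u : ι → MvPowerSeries σ R)
    (s : MvPowerSeries σ R) : Prop :=
  ∀ d : σ →₀ ℕ, {n | MvPowerSeries.coeff d (u n) ≠ 0}.Finite ∧
    ∑ᶠ n, MvPowerSeries.coeff d (u n) = MvPowerSeries.coeff d s

/-- The sum of a coefficientwise finite family of formal power series. -/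
def formalSum {ι σ R : Type*} [Semiring R] (u : ι → MvPowerSeries σ R) : MvPowerSeries σ R :=
  fun d => ∑ᶠ n, MvPowerSeries.coeff d (u n)

/-- The exponential `∑ gʲ / j!` of a formal power series `g` without constant term, over a
`ℂ`-algebra which need not be commutative. As `g` has no constant term, `gʲ` does not contribute
to the coefficient at `d` when `j` exceeds the total degree of `d`. -/
def formalExp {σ R : Type*} [Ring R] [Algebra ℂ R] (g : MvPowerSeries σ R) : MvPowerSeries σ R :=
  fun d => ∑ j ∈ range (d.degree + 1), ((j.factorial : ℂ)⁻¹) • MvPowerSeries.coeff d (g ^ j)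

/-- The elementary Schur polynomial `S_k(t)` in `t₁, t₂, …`: the coefficient of `z ^ k` in
`exp (∑_{n ≥ 1} t_n z ^ n)`. The value `t 0` is not used. -/
def schur {R : Type*} [Ring R] [Algebra ℂ R] (t : ℕ → R) (k : ℕ) : R :=
  PowerSeries.coeff k (formalExp (PowerSeries.mk fun n => if n = 0 then 0 else t n))

/-! ### The completed bosonic Fock space -/

/-- Index set of the variables: `Sum.inl n` is for `x_{n+1}` and `Sum.inr n` is for `y_{n+1}`. -/
abbrev Var : Type := ℕ ⊕ ℕ

/-- The ring `ℂ[[x, y]]` with `x = (x₁, x₂, …)` and `y = (y₁, y₂, …)`. -/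
abbrev V : Type := MvPowerSeries Var ℂ

/-- The completed bosonic Fock space `ℂ[[x, y; p, p⁻¹]]`: the value at `m : ℤ` is the coefficient
of `p ^ m`. -/
abbrev B : Type := ℤ → V

/-- The vacuum vector `1` of the bosonic Fock space. -/
def vac : B := Pi.single 0 1

/-- The variable `x_n`, `n ≥ 1` (with `x_0 = 0`). -/
def x : ℕ → V
  | 0 => 0
  | n + 1 => MvPowerSeries.X (Sum.inl n)

/-- The variable `y_n`, `n ≥ 1` (with `y_0 = 0`). -/
def y : ℕ → V
  | 0 => 0
  | n + 1 => MvPowerSeries.X (Sum.inr n)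

/-- The operator `∂/∂x_n`, `n ≥ 1`, on `ℂ[[x, y]]`. -/
def dx : ℕ → Module.End ℂ V
  | 0 => 0
  | n + 1 => (MvPowerSeries.pderiv ℂ (Sum.inl n : Var)).toLinearMap

/-- The operator `∂/∂y_n`, `n ≥ 1`, on `ℂ[[x, y]]`. -/
def dy : ℕ → Module.End ℂ V
  | 0 => 0
  | n + 1 => (MvPowerSeries.pderiv ℂ (Sum.inr n : Var)).toLinearMap

/-- `Sp k = S_k(x + y)`. -/
def Sp (k : ℕ) : V := schur (fun n => x n + y n) k

/-- `Sm k = S_k(-x - y)`. -/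
def Sm (k : ℕ) : V := schur (fun n => - x n - y n) k

/-- The coefficient of `z ^ (-r)` in `exp (∑_{n ≥ 1} (∂x_n - ∂y_n) z⁻ⁿ / n)`. -/
def Dp (r : ℕ) : Module.End ℂ V := schur (fun n => (n : ℂ)⁻¹ • (dx n - dy n)) r

/-- The coefficient of `z ^ (-r)` in `exp (-∑_{n ≥ 1} (∂x_n - ∂y_n) z⁻ⁿ / n)`. -/
def Dm (r : ℕ) : Module.End ℂ V := schur (fun n => -((n : ℂ)⁻¹ • (dx n - dy n))) r

/-- The Heisenberg mode `α_n` on the component of `p ^ m`: `α_n = ∂/∂x_n` and `α_{-n} = n x_n` for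
`n > 0`, and `α_0 = p ∂/∂p`. -/
def alphaMode (m n : ℤ) : Module.End ℂ V :=
  if 0 < n then dx n.toNat
  else if n < 0 then LinearMap.mulLeft ℂ ((-n).toNat • x (-n).toNat)
  else (m : ℂ) • LinearMap.id

/-- The mode `φ_i`, that is the coefficient of `z ^ (-i-1)`, of the field
`φ(z) = p⁻¹ exp (-∑ (x_n + y_n) zⁿ) exp (∑ (∂x_n - ∂y_n) z⁻ⁿ / n)`. -/
def phi (i : ℤ) (v : B) : B := fun m =>
  formalSum fun ab : ℕ × ℕ =>
    if (ab.1 : ℤ) - ab.2 = -i - 1 then Sm ab.1 * Dp ab.2 (v (m + 1)) else 0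

/-- The mode `φ*_i`, that is the coefficient of `z ^ (-i)`, of the field
`φ*(z) = p exp (∑ (x_n + y_n) zⁿ) α(z) exp (-∑ (∂x_n - ∂y_n) z⁻ⁿ / n)`, where
`α(z) = ∑_n α_n z ^ (-n-1)`. The sum is over all `a, b ≥ 0` and `n` with `a - n - 1 - b = -i`. -/
def phiStar (i : ℤ) (v : B) : B := fun m =>
  formalSum fun ab : ℕ × ℕ =>
    Sp ab.1 * alphaMode (m - 1) ((ab.1 : ℤ) - ab.2 - 1 + i) (Dm ab.2 (v (m - 1)))

/-- `IsExpApply T v w`: the series `∑_n Tⁿ v / n!` is coefficientwise finite with sum `w`, that is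
`exp(T) v = w`. -/
def IsExpApply (T : B → B) (v w : B) : Prop :=
  ∀ m : ℤ, HasFormalSum (fun n : ℕ => ((n.factorial : ℂ)⁻¹ • (T^[n] v)) m) (w m)

/-! ### The series `f(w₁, w₂)` -/

/-- The ring `ℂ[[x, y]][[w₁, w₂]]`. -/
abbrev W : Type := MvPowerSeries (Fin 2) V

/-- The Laurent polynomial in `z`
`(∑_{m ≤ l} S_m(x+y) z^{-l-1+m}) w₁ + (∑_{m ≤ k} S_m(x+y) z^{-k-1+m}) w₂`. -/
def gen (l k : ℕ) : LaurentPolynomial W :=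
  (∑ m ∈ range (l + 1), LaurentPolynomial.C (MvPowerSeries.C (Sp m)) *
      LaurentPolynomial.T (-(l : ℤ) - 1 + m)) * LaurentPolynomial.C (MvPowerSeries.X 0) +
  (∑ m ∈ range (k + 1), LaurentPolynomial.C (MvPowerSeries.C (Sp m)) *
      LaurentPolynomial.T (-(k : ℤ) - 1 + m)) * LaurentPolynomial.C (MvPowerSeries.X 1)

/-- `f_i(w₁, w₂)`: the coefficient of `z ^ (-n(l+k+2)+i)` in the `n`-th power of `gen l k`. -/
def fcoeff (l k n i : ℕ) : W := (gen l k ^ n).coeff (-(n * (l + k + 2) : ℤ) + i)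

/-- `p_n = ∑_{i=0}^{n(l+k+1)} f_i(w₁, w₂) (n(l+k+2)-i) x_{n(l+k+2)-i}`. -/
def pn (l k n : ℕ) : W :=
  ∑ i ∈ range (n * (l + k + 1) + 1),
    fcoeff l k n i * MvPowerSeries.C ((n * (l + k + 2) - i) • x (n * (l + k + 2) - i))

/-- `f(w₁, w₂) = exp (-∑_{n ≥ 1} p_n / n)`. As `p_n` is homogeneous of degree `n` in `w₁, w₂`, the
sum is coefficientwise finite and has no constant term. -/
def f (l k : ℕ) : W :=
  formalExp (-formalSum fun n : ℕ => ((n + 1 : ℕ) : ℂ)⁻¹ • pn l k (n + 1))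

/-- `IsEval F w₁ w₂ u`: for Laurent polynomials `w₁, w₂` in `p` over `ℂ[[x, y]]`, the series
`F(w₁, w₂) = ∑ F_{r,s} w₁^r w₂^s` is coefficientwise finite, with sum `u` in `ℂ[[x, y; p, p⁻¹]]`. -/
def IsEval (F : W) (w₁ w₂ : LaurentPolynomial V) (u : B) : Prop :=
  ∀ m : ℤ, HasFormalSum (fun e : Fin 2 →₀ ℕ =>
    (LaurentPolynomial.C (MvPowerSeries.coeff e F) * w₁ ^ e 0 * w₂ ^ e 1).coeff m) (u m)

/-- `A_{s,t} = ∑_{m=0}^t S_m(x+y) S_{s+t-m}(-x-y)`. -/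
def A (s t : ℕ) : V := ∑ m ∈ range (t + 1), Sp m * Sm (s + t - m)

/-- The common denominator
`1 - c A_{i,l} - d A_{j,k} + c A_{i,l} d A_{j,k} - c A_{i,k} d A_{j,l}`. -/
def den (c d : ℂ) (i j k l : ℕ) : V :=
  1 - c • A i l - d • A j k + (c • A i l) * (d • A j k) - (c • A i k) * (d • A j l)

end FMS

end

noncomputable section

namespace FMS

open Finset

/-! ### Filtered rings, formal exponentials and logarithms -/

/-! Expand in powers of z⁻¹. With κ = (l, k), let G be `genSeries κ`, Q = 1/(1 - G) be `geomSeries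
κ` and L = -log(1 - G) be `logSeries κ`. Since p_n = ∑ r x_r [z⁻ʳ] Gⁿ, the series f is τ = exp(-∑ r
x_r L_r), and everything follows from the action of the vertex operators on τ.

The coefficients of G involve x and y only through the sums x_n + y_n, so D_n = ∂/∂x_n - ∂/∂y_n
kills them. Hence D_n τ = -n L_n τ, and Newton's recurrence integrates this: exp(∑ D_n z⁻ⁿ/n)
multiplies τ by 1 - G, and its inverse multiplies τ by Q (`cw_Dp_tauTrunc`, `cw_Dm_tauTrunc`). The
former is the first assertion. It also shows that φ_{-i} multiplies τ by the coefficient of z^{i-1}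
in exp(-∑ (x_n + y_n) zⁿ)(1 - G), which is the affine function α_i = S_{i-1}(-x-y) - A_{i,l} w₁ -
A_{i,k} w₂ (`phi_coeff`).

For φ*, the charge is the degree in w₁, w₂ minus the number of factors α, so p ∂_p becomes a shifted
Euler operator. The coefficients of z^{-M-1}, M ≥ 0, in α(z) Q(z) τ vanish (`heisenberg_one`). In
the remaining ones only multiplications by r x_r occur, and they add up to -∂τ/∂w_s. An extra factor
α_i produces a correction A_{i,κ_s}, which is the term required by the product rule. Thus φ*_{-κ_s}
acts as -∂/∂w_s on every α_i^m α_j^n τ (`phiStarTrunc_eq`, `phiStar_coeff`).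

Iteration gives the second assertion directly, and turns the left side of the third into ∑ (-c)^m
(-d)^n [w₁^m w₂^n] α_i^m α_j^n f. Expanding f in monomials w₁^r w₂^s leaves a two-variable Lagrange
inversion for affine functions: each monomial contributes N₁^r N₂^s / Δ^{r+s+1} (`lagrangeSum_eq`),
where (N₁/Δ, N₂/Δ) solves w₁ = -c α_i, w₂ = -d α_j.

Two devices deal with infinite sums. The exponent of τ is cut off at r ≤ N (`tauTrunc`), which does
not change coefficients of low degree in w (`coeff_f`). Giving x_n and y_n weight n, the coefficient
of f at w^e has weight at least |e| (`f_weighted`), which makes the multiple sums coefficientwise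
finite. -/

/-- A separated multiplicative filtration of a `ℂ`-algebra. -/
structure MulFiltration (U : Type*) [Ring U] [Algebra ℂ U] where
  I : ℕ → Submodule ℂ U
  anti : ∀ {m n : ℕ}, m ≤ n → I n ≤ I m
  mem_zero : ∀ a, a ∈ I 0
  mul_mem : ∀ {m n : ℕ} {a b : U}, a ∈ I m → b ∈ I n → a * b ∈ I (m + n)
  sep : ∀ a, (∀ n, a ∈ I n) → a = 0

namespace MulFiltration

variable {U : Type*} [Ring U] [Algebra ℂ U]

lemma pow_mem (F : MulFiltration U) {g : U} (hg : g ∈ F.I 1) (n : ℕ) : g ^ n ∈ F.I n := by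
  induction n with
  | zero => exact F.mem_zero _
  | succ n ih => rw [pow_succ]; exact F.mul_mem ih hg

lemma eq_of_sub_mem (F : MulFiltration U) {a b : U} (h : ∀ n, a - b ∈ F.I n) : a = b :=
  sub_eq_zero.1 (F.sep _ h)

lemma leibniz_one (δ : U →ₗ[ℂ] U) (hδ : ∀ a b, δ (a * b) = δ a * b + a * δ b) : δ 1 = 0 := by
  have := hδ 1 1
  simpa using this

/-- Noncommutative rings are admitted because the exponentials of differential operators live in
`Module.End ℂ V`. -/
lemma leibniz_pow (δ : U →ₗ[ℂ] U) (hδ : ∀ a b, δ (a * b) = δ a * b + a * δ b) (g : U)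
    (hc : Commute g (δ g)) (n : ℕ) : δ (g ^ (n + 1)) = ((n : ℂ) + 1) • (δ g * g ^ n) := by
  induction n with
  | zero => simp
  | succ n ih =>
    rw [pow_succ, hδ, ih, smul_mul_assoc, mul_assoc, ← pow_succ,
      (hc.pow_left (n + 1)).eq]
    push_cast
    module

/-- The exponential satisfies `δ (exp g) = δ g * exp g`. -/
lemma exp_leibniz (F : MulFiltration U) (δ : U →ₗ[ℂ] U)
    (hδ : ∀ a b, δ (a * b) = δ a * b + a * δ b)
    (hδI : ∀ n a, a ∈ F.I (n + 1) → δ a ∈ F.I n) (g : U) (hg : g ∈ F.I 1)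
    (hc : Commute g (δ g)) (E : U)
    (hE : ∀ D : ℕ, E - ∑ j ∈ range (D + 1), ((j.factorial : ℂ)⁻¹) • g ^ j ∈ F.I (D + 1)) :
    δ E = δ g * E := by
  have key : ∀ D : ℕ, δ (∑ j ∈ range (D + 1), ((j.factorial : ℂ)⁻¹) • g ^ j)
      = δ g * ∑ j ∈ range D, ((j.factorial : ℂ)⁻¹) • g ^ j := by
    intro D
    rw [sum_range_succ', map_add, map_sum, mul_sum]
    simp only [pow_zero, map_smul, leibniz_one δ hδ, smul_zero, add_zero]
    refine sum_congr rfl fun j _ => ?_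
    rw [leibniz_pow δ hδ g hc, smul_smul, mul_smul_comm]
    congr 1
    rw [Nat.factorial_succ]
    push_cast
    have : (j : ℂ) + 1 ≠ 0 := by exact_mod_cast Nat.succ_ne_zero j
    field_simp
  -- Differentiation turns the partial sum up to D into δ g times the partial sum up to D - 1. So
  -- the two sides differ by remainders and the top term g^D / D!, all in I_D.
  refine F.eq_of_sub_mem fun D => ?_
  have h1 := hδI D _ (hE D)
  have h2 := F.anti (by omega : D ≤ 0 + (D + 1)) (F.mul_mem (F.mem_zero (δ g)) (hE D))
  have h3 : δ g * (((D.factorial : ℂ)⁻¹) • g ^ D) ∈ F.I D := by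
    have := F.mul_mem (F.mem_zero (δ g)) ((F.I D).smul_mem ((D.factorial : ℂ)⁻¹) (F.pow_mem hg D))
    rwa [zero_add] at this
  have : δ E - δ g * E = δ (E - ∑ j ∈ range (D + 1), ((j.factorial : ℂ)⁻¹) • g ^ j)
      - δ g * (E - ∑ j ∈ range (D + 1), ((j.factorial : ℂ)⁻¹) • g ^ j)
      - δ g * (((D.factorial : ℂ)⁻¹) • g ^ D) := by
    rw [map_sub, key, sum_range_succ, mul_sub, mul_add]
    abel
  rw [this]
  exact sub_mem (sub_mem h1 h2) h3

/-- The logarithm `L = - log (1 - G)` satisfies `δ L = (1 - G)⁻¹ * δ G`. -/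
lemma log_leibniz {U : Type*} [CommRing U] [Algebra ℂ U] (F : MulFiltration U) (δ : U →ₗ[ℂ] U)
    (hδ : ∀ a b, δ (a * b) = δ a * b + a * δ b)
    (hδI : ∀ n a, a ∈ F.I (n + 1) → δ a ∈ F.I n) (G : U) (hG : G ∈ F.I 1) (q : U)
    (hq : q * (1 - G) = 1) (L : U)
    (hL : ∀ D : ℕ, L - ∑ j ∈ range D, (((j : ℂ) + 1)⁻¹) • G ^ (j + 1) ∈ F.I (D + 1)) :
    δ L = q * δ G := by
  have key : ∀ D : ℕ, (1 - G) * δ (∑ j ∈ range D, (((j : ℂ) + 1)⁻¹) • G ^ (j + 1))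
      = δ G - G ^ D * δ G := by
    intro D
    have : δ (∑ j ∈ range D, (((j : ℂ) + 1)⁻¹) • G ^ (j + 1)) = (∑ j ∈ range D, G ^ j) * δ G := by
      rw [map_sum, sum_mul]
      refine sum_congr rfl fun j _ => ?_
      have : (j : ℂ) + 1 ≠ 0 := by exact_mod_cast Nat.succ_ne_zero j
      rw [map_smul, leibniz_pow δ hδ G (Commute.all _ _), smul_smul, inv_mul_cancel₀ this,
        one_smul, mul_comm]
    rw [this, ← mul_assoc, mul_neg_geom_sum]
    ring
  have h : (1 - G) * δ L = δ G := by
    refine F.eq_of_sub_mem fun D => ?_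
    have h1 := F.anti (by omega : D ≤ 0 + D)
      (F.mul_mem (F.mem_zero (1 - G)) (hδI D _ (hL D)))
    have h2 := F.mul_mem (F.pow_mem hG D) (F.mem_zero (δ G))
    have : (1 - G) * δ L - δ G = (1 - G) * δ (L - ∑ j ∈ range D, (((j : ℂ) + 1)⁻¹) • G ^ (j + 1))
        - G ^ D * δ G := by
      rw [map_sub, mul_sub, key]
      ring
    rw [this]
    exact sub_mem h1 h2
  rw [← h, ← mul_assoc, hq, one_mul]

end MulFiltration

/-- The filtration of a ring of formal power series by total degree. -/
def degFiltration (σ R : Type*) [Ring R] [Algebra ℂ R] : MulFiltration (MvPowerSeries σ R) where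
  I n :=
    { carrier := {F | ∀ e : σ →₀ ℕ, e.degree < n → MvPowerSeries.coeff e F = 0}
      add_mem' := fun ha hb e he => by rw [map_add, ha e he, hb e he, add_zero]
      zero_mem' := fun e _ => map_zero _
      smul_mem' := fun c a ha e he => by
        change c • MvPowerSeries.coeff e a = 0
        rw [ha e he, smul_zero] }
  anti h _ ha e he := ha e (by omega)
  mem_zero a e he := by omega
  mul_mem := by
    intro m n a b ha hb e he
    classical
    rw [MvPowerSeries.coeff_mul]
    refine sum_eq_zero fun p hp => ?_
    have hp' := HasAntidiagonal.mem_antidiagonal.1 hp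
    have : p.1.degree + p.2.degree = e.degree := by rw [← hp', map_add]
    by_cases h : p.1.degree < m
    · rw [ha _ h, zero_mul]
    · rw [hb p.2 (by omega), mul_zero]
  sep a ha := by
    ext e
    exact ha (e.degree + 1) e (by omega)

lemma formalExp_sub_sum_mem {σ R : Type*} [Ring R] [Algebra ℂ R] {g : MvPowerSeries σ R}
    (hg : g ∈ (degFiltration σ R).I 1) (D : ℕ) :
    formalExp g - ∑ j ∈ range (D + 1), ((j.factorial : ℂ)⁻¹) • g ^ j
      ∈ (degFiltration σ R).I (D + 1) := by
  intro e he
  rw [map_sub, map_sum, sub_eq_zero]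
  change ∑ j ∈ range (e.degree + 1), ((j.factorial : ℂ)⁻¹) • MvPowerSeries.coeff e (g ^ j)
    = ∑ j ∈ range (D + 1), ((j.factorial : ℂ)⁻¹) • MvPowerSeries.coeff e (g ^ j)
  refine sum_subset (fun j hj => ?_) fun j _ hj => ?_
  · simp only [mem_range] at *; omega
  · rw [(degFiltration σ R).pow_mem hg j e (by simp only [mem_range] at hj; omega), smul_zero]

/-- Formal exponentials satisfy `δ (exp g) = δ g * exp g`. -/
lemma formalExp_leibniz {σ R : Type*} [Ring R] [Algebra ℂ R]
    (δ : MvPowerSeries σ R →ₗ[ℂ] MvPowerSeries σ R)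
    (hδ : ∀ a b, δ (a * b) = δ a * b + a * δ b)
    (hδI : ∀ n a, a ∈ (degFiltration σ R).I (n + 1) → δ a ∈ (degFiltration σ R).I n)
    {g : MvPowerSeries σ R} (hg : g ∈ (degFiltration σ R).I 1) (hc : Commute g (δ g)) :
    δ (formalExp g) = δ g * formalExp g :=
  (degFiltration σ R).exp_leibniz δ hδ hδI g hg hc _ (formalExp_sub_sum_mem hg)

/-- The coefficients of `exp g` up to degree `n` depend on those of `g` up to degree `n` only. -/
lemma formalExp_congr {σ R : Type*} [Ring R] [Algebra ℂ R] {g g' : MvPowerSeries σ R} {n : ℕ}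
    (h : g - g' ∈ (degFiltration σ R).I n) :
    formalExp g - formalExp g' ∈ (degFiltration σ R).I n := by
  have hp : ∀ j : ℕ, g ^ j - g' ^ j ∈ (degFiltration σ R).I n := by
    intro j
    induction j with
    | zero => simp
    | succ j ih =>
      have h1 := (degFiltration σ R).mul_mem ih ((degFiltration σ R).mem_zero g)
      have h2 := (degFiltration σ R).mul_mem ((degFiltration σ R).mem_zero (g' ^ j)) h
      rw [zero_add] at h2
      have : g ^ (j + 1) - g' ^ (j + 1) = (g ^ j - g' ^ j) * g + g' ^ j * (g - g') := by
        rw [pow_succ, pow_succ]; noncomm_ring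
      rw [this]
      exact add_mem h1 h2
  intro e he
  rw [map_sub, sub_eq_zero]
  change ∑ j ∈ range (e.degree + 1), ((j.factorial : ℂ)⁻¹) • MvPowerSeries.coeff e (g ^ j)
    = ∑ j ∈ range (e.degree + 1), ((j.factorial : ℂ)⁻¹) • MvPowerSeries.coeff e (g' ^ j)
  refine sum_congr rfl fun j _ => ?_
  have := hp j e he
  rw [map_sub, sub_eq_zero] at this
  rw [this]

/-! ### Coefficientwise finite sums -/

section HasFormalSum

variable {ι κ σ R : Type*} [Ring R]

lemma HasFormalSum.unique {u : ι → MvPowerSeries σ R} {s t : MvPowerSeries σ R}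
    (hs : HasFormalSum u s) (ht : HasFormalSum u t) : s = t := by
  ext d
  rw [← (hs d).2, (ht d).2]

lemma hasFormalSum_formalSum {u : ι → MvPowerSeries σ R}
    (h : ∀ d : σ →₀ ℕ, {n | MvPowerSeries.coeff d (u n) ≠ 0}.Finite) :
    HasFormalSum u (formalSum u) := fun d => ⟨h d, rfl⟩

lemma HasFormalSum.formalSum_eq {u : ι → MvPowerSeries σ R} {s : MvPowerSeries σ R}
    (h : HasFormalSum u s) : formalSum u = s :=
  (hasFormalSum_formalSum fun d => (h d).1).unique h

lemma hasFormalSum_of_finset {u : ι → MvPowerSeries σ R} (s : Finset ι)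
    (h : ∀ i, i ∉ s → u i = 0) : HasFormalSum u (∑ i ∈ s, u i) := by
  intro d
  have hs : {n | MvPowerSeries.coeff d (u n) ≠ 0} ⊆ s := by
    intro n hn
    by_contra hns
    exact hn (by rw [h n hns, map_zero])
  refine ⟨s.finite_toSet.subset hs, ?_⟩
  rw [map_sum]
  exact finsum_eq_sum_of_support_subset _ hs

lemma HasFormalSum.coeff_eq {u : ι → MvPowerSeries σ R} {s : MvPowerSeries σ R}
    (h : HasFormalSum u s) (d : σ →₀ ℕ) (t : Finset ι)
    (ht : ∀ i, i ∉ t → MvPowerSeries.coeff d (u i) = 0) :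
    MvPowerSeries.coeff d s = ∑ i ∈ t, MvPowerSeries.coeff d (u i) := by
  rw [← (h d).2]
  refine finsum_eq_sum_of_support_subset _ fun n hn => ?_
  by_contra hns
  exact hn (ht n hns)

lemma HasFormalSum.equiv {u : ι → MvPowerSeries σ R} {s : MvPowerSeries σ R}
    (h : HasFormalSum u s) (e : κ ≃ ι) : HasFormalSum (fun k => u (e k)) s := by
  intro d
  refine ⟨(h d).1.preimage e.injective.injOn, ?_⟩
  rw [← (h d).2]
  exact finsum_comp_equiv e (f := fun i => MvPowerSeries.coeff d (u i))

lemma HasFormalSum.add {u v : ι → MvPowerSeries σ R} {s t : MvPowerSeries σ R}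
    (hs : HasFormalSum u s) (ht : HasFormalSum v t) :
    HasFormalSum (fun i => u i + v i) (s + t) := by
  intro d
  refine ⟨((hs d).1.union (ht d).1).subset fun n hn => ?_, ?_⟩
  · by_contra h
    simp only [Set.mem_union, Set.mem_ofPred_eq, not_or, not_not] at h
    exact hn (by rw [map_add, h.1, h.2, add_zero])
  · simp only [map_add]
    rw [finsum_add_distrib (hs d).1 (ht d).1, (hs d).2, (ht d).2]

/-- A coefficientwise finite double sum can be computed by rows. -/
lemma HasFormalSum.curry {u : ι × κ → MvPowerSeries σ R} {s : MvPowerSeries σ R}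
    {r : ι → MvPowerSeries σ R} (h : HasFormalSum u s)
    (hr : ∀ i, HasFormalSum (fun k => u (i, k)) (r i)) : HasFormalSum r s := by
  intro d
  refine ⟨((h d).1.image Prod.fst).subset fun i hi => ?_, ?_⟩
  · by_contra hni
    refine hi ?_
    rw [← (hr i d).2]
    refine finsum_eq_zero_of_forall_eq_zero fun k => ?_
    by_contra hk
    exact hni ⟨(i, k), hk, rfl⟩
  · rw [← (h d).2, finsum_curry _ (h d).1]
    exact finsum_congr fun i => (hr i d).2.symm

/-- `T` is continuous: each coefficient of `T g` depends on finitely many coefficients of `g`. -/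
def CoeffContinuous {σ R : Type*} [Ring R] (T : MvPowerSeries σ R →+ MvPowerSeries σ R) : Prop :=
  ∀ d : σ →₀ ℕ, ∃ S : Finset (σ →₀ ℕ), ∀ g, (∀ e ∈ S, MvPowerSeries.coeff e g = 0) →
    MvPowerSeries.coeff d (T g) = 0

lemma HasFormalSum.map {u : ι → MvPowerSeries σ R} {s : MvPowerSeries σ R}
    {T : MvPowerSeries σ R →+ MvPowerSeries σ R} (hT : CoeffContinuous T)
    (h : HasFormalSum u s) : HasFormalSum (fun i => T (u i)) (T s) := by
  classical
  intro d
  obtain ⟨S, hS⟩ := hT d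
  have hfin : (⋃ e ∈ S, {n | MvPowerSeries.coeff e (u n) ≠ 0}).Finite :=
    S.finite_toSet.biUnion fun e _ => (h e).1
  have hz : ∀ i, i ∉ hfin.toFinset → ∀ e ∈ S, MvPowerSeries.coeff e (u i) = 0 := by
    intro i hi e he
    by_contra hne
    refine hi (hfin.mem_toFinset.2 ?_)
    simp only [Set.mem_iUnion]
    exact ⟨e, he, hne⟩
  have hsub : {n | MvPowerSeries.coeff d (T (u n)) ≠ 0} ⊆ hfin.toFinset := by
    intro n hn
    by_contra hns
    exact hn (hS _ (hz n hns))
  refine ⟨hfin.toFinset.finite_toSet.subset hsub, ?_⟩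
  rw [finsum_eq_sum_of_support_subset _ hsub]
  have := hS (s - ∑ i ∈ hfin.toFinset, u i) fun e he => by
    rw [map_sub, map_sum, h.coeff_eq e hfin.toFinset fun i hi => hz i hi e he, sub_self]
  rw [map_sub, map_sub, map_sum, map_sum, sub_eq_zero] at this
  exact this.symm

lemma coeffContinuous_mulLeft (g : MvPowerSeries σ R) :
    CoeffContinuous (AddMonoidHom.mulLeft g) := by
  classical
  intro d
  refine ⟨(antidiagonal d).image Prod.snd, fun h hh => ?_⟩
  change MvPowerSeries.coeff d (g * h) = 0
  rw [MvPowerSeries.coeff_mul]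
  refine sum_eq_zero fun p hp => ?_
  rw [hh _ (mem_image_of_mem _ hp), mul_zero]

lemma HasFormalSum.mul_left {u : ι → MvPowerSeries σ R} {s : MvPowerSeries σ R}
    (g : MvPowerSeries σ R) (h : HasFormalSum u s) :
    HasFormalSum (fun i => g * u i) (g * s) :=
  h.map (coeffContinuous_mulLeft g)

lemma HasFormalSum.neg {u : ι → MvPowerSeries σ R} {s : MvPowerSeries σ R}
    (h : HasFormalSum u s) : HasFormalSum (fun i => -u i) (-s) := by
  simpa using h.mul_left (-1)

lemma HasFormalSum.sub {u v : ι → MvPowerSeries σ R} {s t : MvPowerSeries σ R}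
    (hs : HasFormalSum u s) (ht : HasFormalSum v t) :
    HasFormalSum (fun i => u i - v i) (s - t) := by
  simpa [sub_eq_add_neg] using hs.add ht.neg

lemma CoeffContinuous.comp {T T' : MvPowerSeries σ R →+ MvPowerSeries σ R}
    (hT : CoeffContinuous T) (hT' : CoeffContinuous T') : CoeffContinuous (T.comp T') := by
  classical
  intro d
  obtain ⟨S, hS⟩ := hT d
  choose S' hS' using hT'
  exact ⟨S.biUnion S', fun g hg => hS _ fun e he => hS' e g fun e' he' =>
    hg e' (mem_biUnion.2 ⟨e, he, he'⟩)⟩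

/-- A family is coefficientwise finite over a sum along an injection with zeros elsewhere. -/
lemma HasFormalSum.of_injective {u : ι → MvPowerSeries σ R} {s : MvPowerSeries σ R} {f : κ → ι}
    (hf : Function.Injective f) (h0 : ∀ i, i ∉ Set.range f → u i = 0)
    (h : HasFormalSum (fun k => u (f k)) s) : HasFormalSum u s := by
  intro d
  have hsub : Function.support (fun i => MvPowerSeries.coeff d (u i)) ⊆ Set.range f := by
    intro i hi
    by_contra hni
    exact hi (by simp [h0 i hni])
  constructor
  · refine ((h d).1.image f).subset fun i hi => ?_
    obtain ⟨k, rfl⟩ := hsub hi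
    exact ⟨k, hi, rfl⟩
  · rw [← (h d).2, ← finsum_mem_range (f := fun i => MvPowerSeries.coeff d (u i)) hf]
    rw [← finsum_mem_univ (fun i => MvPowerSeries.coeff d (u i))]
    exact finsum_mem_inter_support_eq' _ _ _ fun i hi => ⟨fun _ => hsub hi, fun _ => trivial⟩

end HasFormalSum

/-! ### Coefficientwise operators and the Euler operator -/

/-- The additive operator on formal power series which applies `T` to every coefficient. -/
def cw {τ R : Type*} [Ring R] [Algebra ℂ R] (T : R →ₗ[ℂ] R) :
    MvPowerSeries τ R →ₗ[ℂ] MvPowerSeries τ R where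
  toFun F := fun e => T (MvPowerSeries.coeff e F)
  map_add' a b := by
    ext e
    exact map_add T _ _
  map_smul' c a := by
    ext e
    exact map_smul T c _

lemma coeff_cw {τ R : Type*} [Ring R] [Algebra ℂ R] (T : R →ₗ[ℂ] R) (F : MvPowerSeries τ R)
    (e : τ →₀ ℕ) : MvPowerSeries.coeff e (cw T F) = T (MvPowerSeries.coeff e F) := rfl

lemma coeff_smul' {τ R : Type*} [Ring R] [Algebra ℂ R] (c : ℂ) (F : MvPowerSeries τ R)
    (e : τ →₀ ℕ) : MvPowerSeries.coeff e (c • F) = c • MvPowerSeries.coeff e F := rfl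

lemma cw_mul {τ R : Type*} [Ring R] [Algebra ℂ R] (T : R →ₗ[ℂ] R)
    (hT : ∀ a b, T (a * b) = T a * b + a * T b) (F H : MvPowerSeries τ R) :
    cw T (F * H) = cw T F * H + F * cw T H := by
  classical
  ext e
  rw [coeff_cw, map_add, MvPowerSeries.coeff_mul, MvPowerSeries.coeff_mul, MvPowerSeries.coeff_mul,
    map_sum, ← sum_add_distrib]
  exact sum_congr rfl fun p _ => by rw [hT, coeff_cw, coeff_cw]

lemma cw_mem {τ R : Type*} [Ring R] [Algebra ℂ R] (T : R →ₗ[ℂ] R) (n : ℕ) (a : MvPowerSeries τ R)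
    (ha : a ∈ (degFiltration τ R).I (n + 1)) : cw T a ∈ (degFiltration τ R).I n := by
  intro e he
  rw [coeff_cw, ha e (by omega), map_zero]

lemma cw_C {τ R : Type*} [Ring R] [Algebra ℂ R] (T : R →ₗ[ℂ] R) (a : R) :
    cw T (MvPowerSeries.C a : MvPowerSeries τ R) = MvPowerSeries.C (T a) := by
  classical
  ext e
  rw [coeff_cw, MvPowerSeries.coeff_C, MvPowerSeries.coeff_C]
  split_ifs <;> simp

/-- Meant for `Dp` and `Dm`, which are not derivations but are linear over series in the x_n + y_n.
-/
lemma cw_mul_of_commute {τ R : Type*} [Ring R] [Algebra ℂ R] (T : R →ₗ[ℂ] R)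
    (F H : MvPowerSeries τ R)
    (hT : ∀ e b, T (MvPowerSeries.coeff e F * b) = MvPowerSeries.coeff e F * T b) :
    cw T (F * H) = F * cw T H := by
  classical
  ext e
  rw [coeff_cw, MvPowerSeries.coeff_mul, MvPowerSeries.coeff_mul, map_sum]
  exact sum_congr rfl fun p _ => by rw [hT, coeff_cw]

/-- The Euler operator, which multiplies the coefficient at `e` by the total degree of `e`. -/
def euler {τ R : Type*} [Ring R] [Algebra ℂ R] : MvPowerSeries τ R →ₗ[ℂ] MvPowerSeries τ R where
  toFun F := fun e => (e.degree : ℂ) • MvPowerSeries.coeff e F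
  map_add' a b := by
    ext e
    exact smul_add _ _ _
  map_smul' c a := by
    ext e
    exact smul_comm _ _ _

lemma coeff_euler {τ R : Type*} [Ring R] [Algebra ℂ R] (F : MvPowerSeries τ R) (e : τ →₀ ℕ) :
    MvPowerSeries.coeff e (euler F) = (e.degree : ℂ) • MvPowerSeries.coeff e F := rfl

lemma euler_mul {τ R : Type*} [Ring R] [Algebra ℂ R] (F H : MvPowerSeries τ R) :
    euler (F * H) = euler F * H + F * euler H := by
  classical
  ext e
  rw [coeff_euler, map_add, MvPowerSeries.coeff_mul, MvPowerSeries.coeff_mul,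
    MvPowerSeries.coeff_mul, smul_sum, ← sum_add_distrib]
  refine sum_congr rfl fun p hp => ?_
  rw [coeff_euler, coeff_euler, ← HasAntidiagonal.mem_antidiagonal.1 hp, map_add]
  push_cast
  rw [smul_mul_assoc, mul_smul_comm, add_smul]

lemma euler_mem {τ R : Type*} [Ring R] [Algebra ℂ R] (n : ℕ) (a : MvPowerSeries τ R)
    (ha : a ∈ (degFiltration τ R).I (n + 1)) : euler a ∈ (degFiltration τ R).I n := by
  intro e he
  rw [coeff_euler, ha e (by omega), smul_zero]

lemma euler_C {τ R : Type*} [Ring R] [Algebra ℂ R] (a : R) :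
    euler (MvPowerSeries.C a : MvPowerSeries τ R) = 0 := by
  classical
  ext e
  rw [coeff_euler, MvPowerSeries.coeff_C]
  split_ifs with h
  · simp [h]
  · simp

lemma powerSeries_coeff_euler {R : Type*} [Ring R] [Algebra ℂ R] (F : PowerSeries R) (n : ℕ) :
    PowerSeries.coeff n (euler F : PowerSeries R) = (n : ℂ) • PowerSeries.coeff n F := by
  rw [PowerSeries.coeff, coeff_euler]
  simp

lemma powerSeries_coeff_cw {R : Type*} [Ring R] [Algebra ℂ R] (T : R →ₗ[ℂ] R)
    (F : PowerSeries R) (n : ℕ) :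
    PowerSeries.coeff n (cw T F : PowerSeries R) = T (PowerSeries.coeff n F) := rfl

/-! ### Elementary Schur polynomials -/

section Schur

variable {R : Type*} [Ring R] [Algebra ℂ R]

/-- The power series `∑_{n ≥ 1} t_n z ^ n`. -/
def timeSeries (t : ℕ → R) : PowerSeries R := PowerSeries.mk fun n => if n = 0 then 0 else t n

lemma coeff_timeSeries (t : ℕ → R) (n : ℕ) :
    PowerSeries.coeff n (timeSeries t) = if n = 0 then 0 else t n := PowerSeries.coeff_mk _ _

lemma timeSeries_mem (t : ℕ → R) : timeSeries t ∈ (degFiltration Unit R).I 1 := by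
  intro e he
  have h0 : e = Finsupp.single () 0 := by
    ext
    have : e.degree = 0 := by omega
    rw [Finsupp.degree_eq_zero_iff] at this
    simp [this]
  rw [h0]
  exact coeff_timeSeries t 0

lemma schur_eq (t : ℕ → R) (n : ℕ) :
    schur t n = PowerSeries.coeff n (formalExp (timeSeries t)) := rfl

lemma schur_zero (t : ℕ → R) : schur t 0 = 1 := by
  have : ∀ e : Unit →₀ ℕ, e = 0 → MvPowerSeries.coeff e (formalExp (timeSeries t)) = 1 := by
    rintro e rfl
    change ∑ j ∈ range ((0 : Unit →₀ ℕ).degree + 1), _ = _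
    simp
  exact this _ (by simp)

lemma powerSeries_commute {F H : PowerSeries R}
    (h : ∀ m n, Commute (PowerSeries.coeff m F) (PowerSeries.coeff n H)) : Commute F H := by
  ext n
  rw [PowerSeries.coeff_mul, PowerSeries.coeff_mul, ← Finset.Nat.sum_antidiagonal_swap]
  exact sum_congr rfl fun p _ => h _ _

/-- Newton's recurrence for the elementary Schur polynomials. -/
lemma schur_newton (t : ℕ → R) (ht : ∀ m n, Commute (t m) (t n)) (r : ℕ) :
    (r : ℂ) • schur t r = ∑ p ∈ antidiagonal r, ((p.1 : ℂ) • t p.1) * schur t p.2 := by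
  have hc : Commute (timeSeries t) (euler (timeSeries t) : PowerSeries R) := by
    refine powerSeries_commute fun m n => ?_
    rw [powerSeries_coeff_euler, coeff_timeSeries, coeff_timeSeries]
    split_ifs
    · exact Commute.zero_left _
    · exact Commute.zero_left _
    · rw [smul_zero]; exact Commute.zero_right _
    · exact (ht m n).smul_right _
  -- The Euler operator is z d/dz; comparing coefficients in its Leibniz rule for the exponential
  -- gives the recurrence.
  have := formalExp_leibniz (R := R) euler euler_mul euler_mem (timeSeries_mem t) hc
  have := congrArg (PowerSeries.coeff r) this
  rw [powerSeries_coeff_euler, PowerSeries.coeff_mul] at this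
  rw [schur_eq, this]
  refine sum_congr rfl fun p _ => ?_
  rw [powerSeries_coeff_euler, coeff_timeSeries, schur_eq]
  split_ifs with h
  · simp [h]
  · rfl

/-- Derivatives of elementary Schur polynomials. -/
lemma schur_leibniz (t : ℕ → R) (T : R →ₗ[ℂ] R) (hT : ∀ a b, T (a * b) = T a * b + a * T b)
    (hc : ∀ m n, Commute (t m) (T (t n))) (r : ℕ) :
    T (schur t r) = ∑ p ∈ antidiagonal r, (if p.1 = 0 then 0 else T (t p.1)) * schur t p.2 := by
  have hc : Commute (timeSeries t) (cw T (timeSeries t) : PowerSeries R) := by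
    refine powerSeries_commute fun m n => ?_
    rw [powerSeries_coeff_cw, coeff_timeSeries, coeff_timeSeries]
    split_ifs
    · exact Commute.zero_left _
    · exact Commute.zero_left _
    · rw [map_zero]; exact Commute.zero_right _
    · exact hc m n
  have := formalExp_leibniz (R := R) (cw T) (cw_mul T hT) (cw_mem T) (timeSeries_mem t) hc
  have := congrArg (PowerSeries.coeff r) this
  rw [powerSeries_coeff_cw, PowerSeries.coeff_mul] at this
  rw [schur_eq, this]
  refine sum_congr rfl fun p _ => ?_
  rw [powerSeries_coeff_cw, coeff_timeSeries, schur_eq]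
  split_ifs with h
  · simp
  · rfl

/-- `S_n(t)` and `S_n(-t)` are the coefficients of inverse power series. -/
lemma sum_schur_mul_schur_neg {R : Type*} [CommRing R] [Algebra ℂ R] (t t' : ℕ → R)
    (htt : ∀ n, n ≠ 0 → t' n = - t n) (r : ℕ) :
    ∑ p ∈ antidiagonal r, schur t p.1 * schur t' p.2 = if r = 0 then 1 else 0 := by
  split_ifs with h
  · subst h; simp [schur_zero]
  have hneg : timeSeries t' = - timeSeries t := by
    ext n
    rw [map_neg, coeff_timeSeries, coeff_timeSeries]
    split_ifs with h
    · simp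
    · exact htt n h
  have h1 := formalExp_leibniz (R := R) euler euler_mul euler_mem (timeSeries_mem t)
    (Commute.all _ _)
  have h2 := formalExp_leibniz (R := R) euler euler_mul euler_mem (timeSeries_mem t')
    (Commute.all _ _)
  -- A series killed by z d/dz has only a constant term.
  have h3 : euler (formalExp (timeSeries t) * formalExp (timeSeries t')) = 0 := by
    rw [euler_mul, h1, h2, hneg, map_neg]
    ring
  have h4 := congrArg (PowerSeries.coeff r) h3
  rw [powerSeries_coeff_euler, map_zero, PowerSeries.coeff_mul] at h4
  have hr : (r : ℂ) ≠ 0 := by exact_mod_cast h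
  exact (smul_eq_zero_iff_right hr).1 h4

end Schur

/-! ### Derivations of `ℂ[[x, y]]` -/

lemma dx_mul (n : ℕ) (a b : V) : dx n (a * b) = dx n a * b + a * dx n b := by
  cases n with
  | zero => simp [dx]
  | succ n =>
    change MvPowerSeries.pderiv ℂ _ (a * b) = MvPowerSeries.pderiv ℂ _ a * b
      + a * MvPowerSeries.pderiv ℂ _ b
    rw [Derivation.leibniz, smul_eq_mul, smul_eq_mul]
    ring

lemma dy_mul (n : ℕ) (a b : V) : dy n (a * b) = dy n a * b + a * dy n b := by
  cases n with
  | zero => simp [dy]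
  | succ n =>
    change MvPowerSeries.pderiv ℂ _ (a * b) = MvPowerSeries.pderiv ℂ _ a * b
      + a * MvPowerSeries.pderiv ℂ _ b
    rw [Derivation.leibniz, smul_eq_mul, smul_eq_mul]
    ring

lemma dx_x (n m : ℕ) (hn : n ≠ 0) : dx n (x m) = if n = m then 1 else 0 := by
  classical
  obtain ⟨n, rfl⟩ := Nat.exists_eq_succ_of_ne_zero hn
  cases m with
  | zero => simp [x]
  | succ m =>
    change MvPowerSeries.pderiv ℂ (Sum.inl n : Var) (MvPowerSeries.X (Sum.inl m : Var)) = _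
    rw [MvPowerSeries.pderiv_X]
    by_cases h : n = m
    · subst h; simp
    · have h1 : n + 1 ≠ m + 1 := by omega
      have h2 : m ≠ n := fun h' => h h'.symm
      simp [h, h2]

lemma dx_y (n m : ℕ) : dx n (y m) = 0 := by
  classical
  cases n with
  | zero => simp [dx]
  | succ n =>
    cases m with
    | zero => simp [y]
    | succ m =>
      change MvPowerSeries.pderiv ℂ (Sum.inl n : Var) (MvPowerSeries.X (Sum.inr m : Var)) = _
      rw [MvPowerSeries.pderiv_X]
      simp

lemma dy_x (n m : ℕ) : dy n (x m) = 0 := by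
  classical
  cases n with
  | zero => simp [dy]
  | succ n =>
    cases m with
    | zero => simp [x]
    | succ m =>
      change MvPowerSeries.pderiv ℂ (Sum.inr n : Var) (MvPowerSeries.X (Sum.inl m : Var)) = _
      rw [MvPowerSeries.pderiv_X]
      simp

lemma dy_y (n m : ℕ) (hn : n ≠ 0) : dy n (y m) = if n = m then 1 else 0 := by
  classical
  obtain ⟨n, rfl⟩ := Nat.exists_eq_succ_of_ne_zero hn
  cases m with
  | zero => simp [y]
  | succ m =>
    change MvPowerSeries.pderiv ℂ (Sum.inr n : Var) (MvPowerSeries.X (Sum.inr m : Var)) = _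
    rw [MvPowerSeries.pderiv_X]
    by_cases h : n = m
    · subst h; simp
    · have h2 : m ≠ n := fun h' => h h'.symm
      simp [h, h2]

lemma pderiv_comm' (i j : Var) (a : V) :
    MvPowerSeries.pderiv ℂ i (MvPowerSeries.pderiv ℂ j a)
      = MvPowerSeries.pderiv ℂ j (MvPowerSeries.pderiv ℂ i a) := by
  classical
  ext d
  simp only [MvPowerSeries.coeff_pderiv]
  by_cases h : i = j
  · subst h; rfl
  · have h1 : (d + Finsupp.single i 1 : Var →₀ ℕ) j = d j := by simp [h]
    have h2 : (d + Finsupp.single j 1 : Var →₀ ℕ) i = d i := by simp [Ne.symm h]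
    rw [h1, h2, add_right_comm]
    ring

/-- The derivation `∂/∂x_n - ∂/∂y_n`. -/
def dd (n : ℕ) : Module.End ℂ V := dx n - dy n

lemma dd_apply (n : ℕ) (a : V) : dd n a = dx n a - dy n a := rfl

lemma dd_mul (n : ℕ) (a b : V) : dd n (a * b) = dd n a * b + a * dd n b := by
  rw [dd_apply, dd_apply, dd_apply, dx_mul, dy_mul]; ring

lemma dd_comm (m n : ℕ) : Commute (dd m) (dd n) := by
  cases m with
  | zero => simp [dd, dx, dy]
  | succ m =>
    cases n with
    | zero => simp [dd, dx, dy]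
    | succ n =>
      refine LinearMap.ext fun a => ?_
      simp only [Module.End.mul_apply, dd_apply, map_sub]
      simp only [dx, dy]
      simp only [Derivation.coeFn_coe]
      rw [pderiv_comm' (Sum.inl m) (Sum.inl n), pderiv_comm' (Sum.inl m) (Sum.inr n),
        pderiv_comm' (Sum.inr m) (Sum.inl n), pderiv_comm' (Sum.inr m) (Sum.inr n)]
      abel

lemma Dp_zero : Dp 0 = 1 := schur_zero _

lemma Dm_zero : Dm 0 = 1 := schur_zero _

lemma smul_nat_dd (n : ℕ) : (n : ℂ) • ((n : ℂ)⁻¹ • dd n) = dd n := by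
  by_cases h : n = 0
  · subst h; simp [dd, dx, dy]
  · rw [smul_smul, mul_inv_cancel₀ (by exact_mod_cast h), one_smul]

lemma Dp_newton (r : ℕ) : (r : ℂ) • Dp r = ∑ p ∈ antidiagonal r, dd p.1 * Dp p.2 := by
  have := schur_newton (fun n => (n : ℂ)⁻¹ • dd n)
    (fun m n => ((dd_comm m n).smul_left _).smul_right _) r
  simp only [smul_nat_dd] at this
  exact this

lemma Dm_newton (r : ℕ) : (r : ℂ) • Dm r = -∑ p ∈ antidiagonal r, dd p.1 * Dm p.2 := by
  have := schur_newton (fun n => -((n : ℂ)⁻¹ • dd n))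
    (fun m n => (((dd_comm m n).smul_left _).smul_right _).neg_left.neg_right) r
  simp only [smul_neg, smul_nat_dd] at this
  rw [← sum_neg_distrib]
  exact this.trans (sum_congr rfl fun p _ => LinearMap.ext fun a => rfl)

/-! ### The series `S_n(x + y)` and `S_n(-x-y)` -/

/-- `S_n(x + y)`, extended by zero to negative `n`. -/
def Spz (n : ℤ) : V := if 0 ≤ n then Sp n.toNat else 0

/-- `S_n(-x-y)`, extended by zero to negative `n`. -/
def Smz (n : ℤ) : V := if 0 ≤ n then Sm n.toNat else 0

lemma Spz_natCast (n : ℕ) : Spz n = Sp n := by simp [Spz]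

lemma Smz_natCast (n : ℕ) : Smz n = Sm n := by simp [Smz]

lemma Spz_of_neg {n : ℤ} (h : n < 0) : Spz n = 0 := if_neg (by omega)

lemma Smz_of_neg {n : ℤ} (h : n < 0) : Smz n = 0 := if_neg (by omega)

lemma sum_Sp_mul_Sm (r : ℕ) :
    ∑ p ∈ antidiagonal r, Sp p.1 * Sm p.2 = if r = 0 then 1 else 0 :=
  sum_schur_mul_schur_neg _ _ (fun n _ => by ring) r

lemma sum_antidiagonal_ite {R : Type*} [AddCommMonoid R] (r n : ℕ) (a : ℕ → R) :
    ∑ p ∈ antidiagonal r, (if n = p.1 then a p.2 else 0) = if n ≤ r then a (r - n) else 0 := by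
  split_ifs with h
  · rw [sum_eq_single (n, r - n)]
    · simp
    · rintro ⟨b, c⟩ hb hne
      rw [if_neg]
      rintro rfl
      rw [HasAntidiagonal.mem_antidiagonal] at hb
      exact hne (by ext <;> simp; omega)
    · intro hn
      exact absurd (HasAntidiagonal.mem_antidiagonal.2 (by simp; omega)) hn
  · refine sum_eq_zero fun p hp => if_neg ?_
    have := HasAntidiagonal.mem_antidiagonal.1 hp
    omega

lemma dx_Spz {n : ℕ} (hn : n ≠ 0) (t : ℤ) : dx n (Spz t) = Spz (t - n) := by
  by_cases ht : 0 ≤ t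
  · lift t to ℕ using ht
    rw [Spz_natCast, Sp, schur_leibniz _ _ (dx_mul n) (fun _ _ => Commute.all _ _)]
    have : ∀ p : ℕ × ℕ, (if p.1 = 0 then (0 : V) else dx n (x p.1 + y p.1))
        * schur (fun n => x n + y n) p.2 = if n = p.1 then Sp p.2 else 0 := by
      intro p
      rw [map_add, dx_x n _ hn, dx_y, add_zero]
      by_cases h : n = p.1
      · rw [if_pos h, if_pos h, if_neg (by omega), one_mul, Sp]
      · simp [h]
    rw [sum_congr rfl fun p _ => this p, sum_antidiagonal_ite]
    split_ifs with h
    · rw [← Nat.cast_sub h, Spz_natCast]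
    · rw [Spz_of_neg (by omega)]
  · rw [Spz_of_neg (by omega), Spz_of_neg (by omega), map_zero]

lemma dx_Smz {n : ℕ} (hn : n ≠ 0) (t : ℤ) : dx n (Smz t) = -Smz (t - n) := by
  by_cases ht : 0 ≤ t
  · lift t to ℕ using ht
    rw [Smz_natCast, Sm, schur_leibniz _ _ (dx_mul n) (fun _ _ => Commute.all _ _)]
    have : ∀ p : ℕ × ℕ, (if p.1 = 0 then (0 : V) else dx n (- x p.1 - y p.1))
        * schur (fun n => - x n - y n) p.2 = if n = p.1 then - Sm p.2 else 0 := by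
      intro p
      rw [map_sub, map_neg, dx_x n _ hn, dx_y, sub_zero]
      by_cases h : n = p.1
      · rw [if_pos h, if_pos h, if_neg (by omega), neg_mul, one_mul, Sm]
      · simp [h]
    rw [sum_congr rfl fun p _ => this p,
      sum_antidiagonal_ite t n fun k => -Sm k]
    split_ifs with h
    · rw [← Nat.cast_sub h, Smz_natCast]
    · rw [Smz_of_neg (by omega), neg_zero]
  · rw [Smz_of_neg (by omega), Smz_of_neg (by omega), map_zero, neg_zero]

lemma dd_xy (n m : ℕ) : dd n (x m + y m) = 0 := by
  by_cases hn : n = 0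
  · subst hn; simp [dd, dx, dy]
  · rw [dd_apply, map_add, map_add, dx_x n m hn, dx_y, dy_x, dy_y n m hn]; simp

/-- The subalgebra of `ℂ[[x, y]]` on which all `∂/∂x_n - ∂/∂y_n` vanish; it contains every series
in the sums `x_n + y_n`. -/
def invariants : Subalgebra ℂ V where
  carrier := {a | ∀ n, dd n a = 0}
  mul_mem' ha hb n := by rw [dd_mul, ha n, hb n]; simp
  add_mem' ha hb n := by rw [map_add, ha n, hb n, add_zero]
  algebraMap_mem' c n := by
    rw [Algebra.algebraMap_eq_smul_one, map_smul,
      MulFiltration.leibniz_one (dd n) (dd_mul n), smul_zero]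

lemma mem_invariants {a : V} : a ∈ invariants ↔ ∀ n, dd n a = 0 := Iff.rfl

lemma Sp_mem_invariants (m : ℕ) : Sp m ∈ invariants := by
  intro n
  rw [Sp, schur_leibniz _ _ (dd_mul n) (fun _ _ => Commute.all _ _)]
  exact sum_eq_zero fun p _ => by rw [dd_xy]; simp

lemma Sm_mem_invariants (m : ℕ) : Sm m ∈ invariants := by
  intro n
  rw [Sm, schur_leibniz _ _ (dd_mul n) (fun _ _ => Commute.all _ _)]
  refine sum_eq_zero fun p _ => ?_
  have : dd n (- x p.1 - y p.1) = 0 := by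
    rw [← neg_add', map_neg, dd_xy, neg_zero]
  rw [this]; simp

lemma Spz_mem_invariants (t : ℤ) : Spz t ∈ invariants := by
  unfold Spz
  split_ifs
  exacts [Sp_mem_invariants _, zero_mem _]

lemma Smz_mem_invariants (t : ℤ) : Smz t ∈ invariants := by
  unfold Smz
  split_ifs
  exacts [Sm_mem_invariants _, zero_mem _]

lemma A_mem_invariants (s t : ℕ) : A s t ∈ invariants :=
  sum_mem fun _ _ => mul_mem (Sp_mem_invariants _) (Sm_mem_invariants _)

lemma dd_invariant_mul {a : V} (ha : a ∈ invariants) (n : ℕ) (b : V) :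
    dd n (a * b) = a * dd n b := by
  rw [dd_mul, mem_invariants.1 ha n, zero_mul, zero_add]

/-- Newton's recurrence builds `Dp r` from the derivations `dd n`, which are linear over the
invariants. -/
lemma Dp_invariant_mul {a : V} (ha : a ∈ invariants) (r : ℕ) (b : V) :
    Dp r (a * b) = a * Dp r b := by
  induction r using Nat.strong_induction_on generalizing b with
  | _ r ih =>
    by_cases hr : r = 0
    · subst hr; simp [Dp_zero]
    have h1 := LinearMap.congr_fun (Dp_newton r) (a * b)
    have h2 := LinearMap.congr_fun (Dp_newton r) b
    have hr' : (r : ℂ) ≠ 0 := by exact_mod_cast hr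
    refine smul_right_injective V hr' ?_
    simp only [LinearMap.smul_apply, LinearMap.sum_apply, Module.End.mul_apply] at h1 h2 ⊢
    rw [h1, ← mul_smul_comm, h2, mul_sum]
    refine sum_congr rfl fun p hp => ?_
    have := HasAntidiagonal.mem_antidiagonal.1 hp
    by_cases h0 : p.1 = 0
    · rw [h0]; simp [dd, dx, dy]
    · rw [ih _ (by omega), dd_invariant_mul ha]

lemma Dm_invariant_mul {a : V} (ha : a ∈ invariants) (r : ℕ) (b : V) :
    Dm r (a * b) = a * Dm r b := by
  induction r using Nat.strong_induction_on generalizing b with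
  | _ r ih =>
    by_cases hr : r = 0
    · subst hr; simp [Dm_zero]
    have h1 := LinearMap.congr_fun (Dm_newton r) (a * b)
    have h2 := LinearMap.congr_fun (Dm_newton r) b
    have hr' : (r : ℂ) ≠ 0 := by exact_mod_cast hr
    refine smul_right_injective V hr' ?_
    simp only [LinearMap.smul_apply, LinearMap.neg_apply, LinearMap.sum_apply,
      Module.End.mul_apply] at h1 h2 ⊢
    rw [h1, ← mul_smul_comm, h2, mul_neg, mul_sum]
    refine congrArg _ (sum_congr rfl fun p hp => ?_)
    have := HasAntidiagonal.mem_antidiagonal.1 hp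
    by_cases h0 : p.1 = 0
    · rw [h0]; simp [dd, dx, dy]
    · rw [ih _ (by omega), dd_invariant_mul ha]

/-- Exchanges the first two parts in decompositions of N into three parts, so that a factor
depending on one part only can be pulled out of the inner sum. -/
lemma sum_antidiagonal_rotate {M : Type*} [AddCommMonoid M] (N : ℕ) (a : ℕ → ℕ → ℕ → M) :
    ∑ p ∈ antidiagonal N, ∑ p' ∈ antidiagonal p.2, a p.1 p'.1 p'.2
      = ∑ p ∈ antidiagonal N, ∑ p' ∈ antidiagonal p.2, a p'.1 p.1 p'.2 := by
  rw [sum_sigma', sum_sigma']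
  refine sum_nbij' (fun s => ⟨(s.2.1, s.1.1 + s.2.2), (s.1.1, s.2.2)⟩)
    (fun s => ⟨(s.2.1, s.1.1 + s.2.2), (s.1.1, s.2.2)⟩) ?_ ?_ ?_ ?_ ?_
  · rintro ⟨⟨a, b⟩, c, d⟩ h
    simp only [mem_sigma, HasAntidiagonal.mem_antidiagonal] at h ⊢
    obtain ⟨h1, h2⟩ := h
    exact ⟨by rw [← h1, ← h2]; ring, trivial⟩
  · rintro ⟨⟨a, b⟩, c, d⟩ h
    simp only [mem_sigma, HasAntidiagonal.mem_antidiagonal] at h ⊢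
    obtain ⟨h1, h2⟩ := h
    exact ⟨by rw [← h1, ← h2]; ring, trivial⟩
  · rintro ⟨⟨a, b⟩, c, d⟩ h
    simp only [mem_sigma, HasAntidiagonal.mem_antidiagonal] at h
    obtain ⟨h1, h2⟩ := h
    subst h2
    rfl
  · rintro ⟨⟨a, b⟩, c, d⟩ h
    simp only [mem_sigma, HasAntidiagonal.mem_antidiagonal] at h
    obtain ⟨h1, h2⟩ := h
    subst h2
    rfl
  · rintro ⟨⟨a, b⟩, c, d⟩ h
    rfl

/-- The filtration of `U[[z]]` induced coefficientwise by a filtration of `U`. -/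
def MulFiltration.powerSeries {U : Type*} [Ring U] [Algebra ℂ U] (F : MulFiltration U) :
    MulFiltration (PowerSeries U) where
  I n :=
    { carrier := {a | ∀ r, PowerSeries.coeff r a ∈ F.I n}
      add_mem' := fun ha hb r => by rw [map_add]; exact add_mem (ha r) (hb r)
      zero_mem' := fun r => by rw [map_zero]; exact zero_mem _
      smul_mem' := fun c a ha r => (F.I n).smul_mem c (ha r) }
  anti h _ ha r := F.anti h (ha r)
  mem_zero a r := F.mem_zero _
  mul_mem := by
    intro m n a b ha hb r
    rw [PowerSeries.coeff_mul]
    exact sum_mem fun p _ => F.mul_mem (ha _) (hb _)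
  sep a ha := by
    ext r : 1
    exact F.sep _ fun n => ha n r

/-! ### The generating polynomial, its geometric series and its logarithm -/

section Gen

variable (κ : Fin 2 → ℕ)

/-- The coefficient of `z ^ (-r)` in `∑_s (∑_{m ≤ κ s} S_m(x+y) z^{-κ s-1+m}) w_s`. -/
def genCoeff (r : ℕ) : W :=
  if r = 0 then 0 else ∑ s, MvPowerSeries.C (Spz (κ s + 1 - r)) * MvPowerSeries.X s

/-- `∑_s (∑_{m ≤ κ s} S_m(x+y) z^{-κ s-1+m}) w_s` as a power series in `z⁻¹`. -/
def genSeries : PowerSeries W := PowerSeries.mk (genCoeff κ)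

/-- The geometric series `1 / (1 - genSeries κ)`. -/
def geomSeries : PowerSeries W := PowerSeries.invOfUnit (1 - genSeries κ) 1

/-- The coefficients of `- log (1 - genSeries κ)`. -/
def logCoeff (r : ℕ) : W := fun e =>
  if e.degree = 0 then 0
  else (e.degree : ℂ)⁻¹ • MvPowerSeries.coeff e (PowerSeries.coeff r (genSeries κ ^ e.degree))

/-- The logarithm `- log (1 - genSeries κ)`. -/
def logSeries : PowerSeries W := PowerSeries.mk (logCoeff κ)

lemma coeff_genSeries (r : ℕ) : PowerSeries.coeff r (genSeries κ) = genCoeff κ r :=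
  PowerSeries.coeff_mk _ _

lemma genCoeff_zero : genCoeff κ 0 = 0 := if_pos rfl

lemma genCoeff_of_ne {r : ℕ} (hr : r ≠ 0) :
    genCoeff κ r = ∑ s, MvPowerSeries.C (Spz (κ s + 1 - r)) * MvPowerSeries.X s := if_neg hr

lemma geomSeries_mul : geomSeries κ * (1 - genSeries κ) = 1 := by
  rw [mul_comm]
  refine PowerSeries.mul_invOfUnit _ _ ?_
  rw [map_sub, map_one, ← PowerSeries.coeff_zero_eq_constantCoeff_apply, coeff_genSeries,
    genCoeff_zero, sub_zero, Units.val_one]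

lemma geomSeries_eq : geomSeries κ = 1 + geomSeries κ * genSeries κ := by
  have := geomSeries_mul κ
  rw [mul_sub, mul_one, sub_eq_iff_eq_add] at this
  exact this

/-- An upper bound for the degree in `z⁻¹` of `genSeries κ`. -/
def genDeg : ℕ := κ 0 + κ 1 + 2

lemma coeff_genCoeff_eq_zero {r : ℕ} {e : Fin 2 →₀ ℕ}
    (h : e.degree ≠ 1 ∨ r = 0 ∨ genDeg κ < r) :
    MvPowerSeries.coeff e (genCoeff κ r) = 0 := by
  classical
  by_cases hr : r = 0
  · rw [hr, genCoeff_zero, map_zero]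
  rw [genCoeff_of_ne κ hr, map_sum]
  refine sum_eq_zero fun s _ => ?_
  rw [MvPowerSeries.coeff_C_mul, MvPowerSeries.coeff_X]
  by_cases he : e = Finsupp.single s 1
  · have h1 : e.degree = 1 := by rw [he, Finsupp.degree_single]
    have : κ s ≤ κ 0 + κ 1 := by fin_cases s <;> simp
    rw [Spz_of_neg, zero_mul]
    unfold genDeg at h
    omega
  · rw [if_neg he, mul_zero]

/-- G is linear in w₁, w₂ and a polynomial in z⁻¹ without constant term, so its m-th power is
homogeneous of degree m in w with exponents of z⁻¹ between m and m times `genDeg κ`. These bounds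
make the later sums finite. -/
lemma coeff_genSeries_pow_eq_zero {m r : ℕ} {e : Fin 2 →₀ ℕ}
    (h : e.degree ≠ m ∨ r < m ∨ m * genDeg κ < r) :
    MvPowerSeries.coeff e (PowerSeries.coeff r (genSeries κ ^ m)) = 0 := by
  classical
  induction m generalizing r e with
  | zero =>
    rw [pow_zero, PowerSeries.coeff_one]
    split_ifs with hr
    · rw [MvPowerSeries.coeff_one, if_neg]
      rintro rfl
      simp [hr] at h
    · exact map_zero _
  | succ m ih =>
    rw [pow_succ, PowerSeries.coeff_mul, map_sum]
    refine sum_eq_zero fun p hp => ?_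
    rw [MvPowerSeries.coeff_mul]
    refine sum_eq_zero fun p' hp' => ?_
    rw [HasAntidiagonal.mem_antidiagonal] at hp hp'
    have hd : p'.1.degree + p'.2.degree = e.degree := by rw [← hp', map_add]
    by_cases h1 : p'.1.degree ≠ m ∨ p.1 < m ∨ m * genDeg κ < p.1
    · rw [ih h1, zero_mul]
    · rw [coeff_genSeries, coeff_genCoeff_eq_zero, mul_zero]
      rw [add_mul, one_mul] at h
      omega

lemma genSeries_mem : genSeries κ ∈ (degFiltration (Fin 2) V).powerSeries.I 1 := by
  intro r e he
  rw [coeff_genSeries]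
  exact coeff_genCoeff_eq_zero κ (by omega)

lemma coeff_geomSeries_eq_zero {r : ℕ} {e : Fin 2 →₀ ℕ} (h : e.degree * genDeg κ < r) :
    MvPowerSeries.coeff e (PowerSeries.coeff r (geomSeries κ)) = 0 := by
  classical
  induction r using Nat.strong_induction_on generalizing e with
  | _ r ih =>
    rw [geomSeries_eq, map_add, PowerSeries.coeff_one, if_neg (by omega), zero_add,
      PowerSeries.coeff_mul, map_sum]
    refine sum_eq_zero fun p hp => ?_
    rw [MvPowerSeries.coeff_mul]
    refine sum_eq_zero fun p' hp' => ?_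
    rw [HasAntidiagonal.mem_antidiagonal] at hp hp'
    have hd : p'.1.degree + p'.2.degree = e.degree := by rw [← hp', map_add]
    by_cases h1 : p'.2.degree ≠ 1 ∨ p.2 = 0 ∨ genDeg κ < p.2
    · rw [coeff_genSeries, coeff_genCoeff_eq_zero κ h1, mul_zero]
    · rw [ih p.1 (by omega), zero_mul]
      have : e.degree = p'.1.degree + 1 := by omega
      rw [this, add_mul, one_mul] at h
      omega

lemma coeff_coeff_logSeries (r : ℕ) (e : Fin 2 →₀ ℕ) :
    MvPowerSeries.coeff e (PowerSeries.coeff r (logSeries κ)) = if e.degree = 0 then 0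
      else (e.degree : ℂ)⁻¹ • MvPowerSeries.coeff e (PowerSeries.coeff r
        (genSeries κ ^ e.degree)) := by
  rw [logSeries, PowerSeries.coeff_mk]
  rfl

lemma coeff_logSeries_eq_zero {r : ℕ} {e : Fin 2 →₀ ℕ}
    (h : r < e.degree ∨ e.degree * genDeg κ < r) :
    MvPowerSeries.coeff e (PowerSeries.coeff r (logSeries κ)) = 0 := by
  rw [coeff_coeff_logSeries]
  split_ifs
  · rfl
  · rw [coeff_genSeries_pow_eq_zero κ (by omega), smul_zero]

/-- Gᵐ is homogeneous of degree m in w, so the degree-by-degree definition of `logCoeff` picks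
exactly the summand Gᵐ/m of the logarithm. -/
lemma logSeries_sub_mem (D : ℕ) :
    logSeries κ - ∑ j ∈ range D, (((j : ℂ) + 1)⁻¹) • genSeries κ ^ (j + 1)
      ∈ (degFiltration (Fin 2) V).powerSeries.I (D + 1) := by
  intro r e he
  rw [map_sub, map_sub, coeff_coeff_logSeries, map_sum, map_sum]
  have hsm : ∀ j : ℕ, MvPowerSeries.coeff e (PowerSeries.coeff r
      ((((j : ℂ) + 1)⁻¹) • genSeries κ ^ (j + 1))) = (((j : ℂ) + 1)⁻¹) •
      MvPowerSeries.coeff e (PowerSeries.coeff r (genSeries κ ^ (j + 1))) := fun _ => rfl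
  simp only [hsm]
  rw [sub_eq_zero]
  split_ifs with h0
  · refine (sum_eq_zero fun j _ => ?_).symm
    rw [coeff_genSeries_pow_eq_zero κ (by omega), smul_zero]
  · obtain ⟨m, hm⟩ := Nat.exists_eq_succ_of_ne_zero h0
    rw [sum_eq_single m]
    · rw [hm]; push_cast; rfl
    · intro j _ hj
      rw [coeff_genSeries_pow_eq_zero κ (by omega), smul_zero]
    · intro hm'
      exact absurd (mem_range.2 (by omega)) hm'

lemma logSeries_leibniz (T : W →ₗ[ℂ] W) (hT : ∀ a b, T (a * b) = T a * b + a * T b)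
    (hTI : ∀ n a, a ∈ (degFiltration (Fin 2) V).I (n + 1) → T a ∈ (degFiltration (Fin 2) V).I n) :
    (cw T (logSeries κ) : PowerSeries W) = geomSeries κ * cw T (genSeries κ) :=
  (degFiltration (Fin 2) V).powerSeries.log_leibniz (cw T) (cw_mul T hT)
    (fun n _ ha r => hTI n _ (ha r)) _ (genSeries_mem κ) _ (geomSeries_mul κ) _
    (logSeries_sub_mem κ)

lemma euler_logSeries : (euler (logSeries κ) : PowerSeries W)
    = geomSeries κ * euler (genSeries κ) :=
  (degFiltration (Fin 2) V).powerSeries.log_leibniz euler euler_mul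
    (fun n a ha r => by
      rw [powerSeries_coeff_euler]
      exact Submodule.smul_mem _ _ ((degFiltration (Fin 2) V).anti (Nat.le_succ n) (ha r)))
    _ (genSeries_mem κ) _ (geomSeries_mul κ) _ (logSeries_sub_mem κ)

lemma geomSeries_leibniz (δ : PowerSeries W →ₗ[ℂ] PowerSeries W)
    (hδ : ∀ a b, δ (a * b) = δ a * b + a * δ b) :
    δ (geomSeries κ) = geomSeries κ * geomSeries κ * δ (genSeries κ) := by
  have h := congrArg δ (geomSeries_mul κ)
  have h1 := MulFiltration.leibniz_one δ hδ
  rw [h1, hδ, map_sub, h1, zero_sub] at h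
  linear_combination geomSeries κ * h - δ (geomSeries κ) * geomSeries_mul κ

lemma coeff_logSeries_leibniz (T : W →ₗ[ℂ] W) (hT : ∀ a b, T (a * b) = T a * b + a * T b)
    (hTI : ∀ n a, a ∈ (degFiltration (Fin 2) V).I (n + 1) → T a ∈ (degFiltration (Fin 2) V).I n)
    (r : ℕ) :
    T (PowerSeries.coeff r (logSeries κ))
      = ∑ p ∈ antidiagonal r, PowerSeries.coeff p.1 (geomSeries κ) * T (genCoeff κ p.2) := by
  rw [← powerSeries_coeff_cw, logSeries_leibniz κ T hT hTI, PowerSeries.coeff_mul]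
  exact sum_congr rfl fun p _ => by rw [powerSeries_coeff_cw, coeff_genSeries]

/-! ### Derivations of `ℂ[[x, y]][[w₁, w₂]]` -/

/-- `∂/∂x_n` for `n ≥ 1`, and the Euler operator in `w₁, w₂` for `n = 0`. -/
def DD (n : ℕ) : W →ₗ[ℂ] W := if n = 0 then euler else cw (dx n)

lemma DD_zero : DD 0 = euler := if_pos rfl

lemma DD_of_ne {n : ℕ} (hn : n ≠ 0) : DD n = cw (dx n) := if_neg hn

lemma DD_mul (n : ℕ) (a b : W) : DD n (a * b) = DD n a * b + a * DD n b := by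
  unfold DD
  split_ifs
  · exact euler_mul _ _
  · exact cw_mul _ (dx_mul n) _ _

lemma DD_mem (n m : ℕ) (a : W) (ha : a ∈ (degFiltration (Fin 2) V).I (m + 1)) :
    DD n a ∈ (degFiltration (Fin 2) V).I m := by
  unfold DD
  split_ifs
  · exact euler_mem _ _ ha
  · exact cw_mem _ _ _ ha

/-- The derivation `∂/∂w_s`. -/
def pw (s : Fin 2) : W →ₗ[ℂ] W :=
  (MvPowerSeries.pderiv V s).toLinearMap.restrictScalars ℂ

lemma pw_apply (s : Fin 2) (a : W) : pw s a = MvPowerSeries.pderiv V s a := rfl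

lemma pw_mul (s : Fin 2) (a b : W) : pw s (a * b) = pw s a * b + a * pw s b := by
  rw [pw_apply, pw_apply, pw_apply, Derivation.leibniz, smul_eq_mul, smul_eq_mul]
  ring

lemma pw_mem (s : Fin 2) (m : ℕ) (a : W) (ha : a ∈ (degFiltration (Fin 2) V).I (m + 1)) :
    pw s a ∈ (degFiltration (Fin 2) V).I m := by
  intro e he
  rw [pw_apply, MvPowerSeries.coeff_pderiv, ha _ (by rw [map_add, Finsupp.degree_single]; omega),
    zero_mul]

lemma pw_C (s : Fin 2) (a : V) : pw s (MvPowerSeries.C a) = 0 := by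
  rw [pw_apply, MvPowerSeries.pderiv_C]

lemma pw_X (s t : Fin 2) : pw s (MvPowerSeries.X t) = if t = s then 1 else 0 := by
  rw [pw_apply, MvPowerSeries.pderiv_X, Pi.single_apply]

lemma euler_X (s : Fin 2) : euler (MvPowerSeries.X s : W) = MvPowerSeries.X s := by
  classical
  ext e : 1
  rw [coeff_euler, MvPowerSeries.coeff_X]
  split_ifs with h
  · rw [h, Finsupp.degree_single]; simp
  · simp

lemma cw_X {T : V →ₗ[ℂ] V} (hT : T 1 = 0) (s : Fin 2) : cw T (MvPowerSeries.X s : W) = 0 := by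
  classical
  ext e : 1
  rw [coeff_cw, MvPowerSeries.coeff_X, map_zero]
  split_ifs with h
  · exact hT
  · simp

/-- ∂/∂x_n lowers the index of S by n, which is a shift of the exponent of z⁻¹; the Euler operator
fixes G because G is linear in w. Counting it as n = 0 lets all nonnegative Heisenberg modes be
treated alike. -/
lemma DD_genCoeff (n r : ℕ) :
    DD n (genCoeff κ r) = if r = 0 then 0 else genCoeff κ (n + r) := by
  split_ifs with hr
  · rw [hr, genCoeff_zero, map_zero]
  rw [genCoeff_of_ne κ hr, genCoeff_of_ne κ (by omega), map_sum]
  refine sum_congr rfl fun s _ => ?_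
  rw [DD_mul]
  by_cases hn : n = 0
  · subst hn
    rw [DD_zero, euler_C, euler_X, zero_mul, zero_add, zero_add]
  · rw [DD_of_ne hn, cw_C, cw_X (MulFiltration.leibniz_one _ (dx_mul n)), dx_Spz hn]
    simp only [mul_zero, add_zero]
    congr 3
    push_cast
    ring

/-! ### Convolution identities for the geometric series and the logarithm -/

/-- The coefficient of `z ^ (-n)` in `-z ∂_z` of `- log (1 - genSeries κ)`. -/
def lam (n : ℕ) : W := PowerSeries.coeff n (geomSeries κ * euler (genSeries κ))

lemma smul_coeff_logSeries (n : ℕ) : (n : ℂ) • PowerSeries.coeff n (logSeries κ) = lam κ n := by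
  rw [← powerSeries_coeff_euler, euler_logSeries, lam]

lemma lam_zero : lam κ 0 = 0 := by rw [← smul_coeff_logSeries]; simp

/-- DD_n Q = Q² DD_n G. Since DD_n G_r = G_{n+r} for r > 0, the sum of DD_n G_r over n + r = m is m
G_m. Both sides are therefore coefficients of Q² E(G), where E is the Euler operator in z⁻¹. -/
lemma sum_DD_geomSeries (M : ℕ) :
    ∑ p ∈ antidiagonal M, DD p.1 (PowerSeries.coeff p.2 (geomSeries κ))
      = ∑ p ∈ antidiagonal M, lam κ p.1 * PowerSeries.coeff p.2 (geomSeries κ) := by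
  have h1 : ∀ n b : ℕ, DD n (PowerSeries.coeff b (geomSeries κ)) = ∑ p ∈ antidiagonal b,
      PowerSeries.coeff p.1 (geomSeries κ * geomSeries κ) *
        (if p.2 = 0 then 0 else genCoeff κ (n + p.2)) := by
    intro n b
    rw [← powerSeries_coeff_cw, geomSeries_leibniz κ (cw (DD n)) (cw_mul _ (DD_mul n)), PowerSeries.coeff_mul]
    exact sum_congr rfl fun p _ => by rw [powerSeries_coeff_cw, coeff_genSeries, DD_genCoeff]
  simp only [h1]
  rw [sum_antidiagonal_rotate M fun n c t => PowerSeries.coeff c (geomSeries κ * geomSeries κ) *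
        (if t = 0 then 0 else genCoeff κ (n + t))]
  have h2 : ∀ m : ℕ, ∑ p ∈ antidiagonal m, (if p.2 = 0 then 0 else genCoeff κ (p.1 + p.2))
      = (m : ℂ) • genCoeff κ m := by
    intro m
    cases m with
    | zero => simp
    | succ m =>
      rw [Finset.Nat.sum_antidiagonal_succ', if_pos rfl, zero_add]
      have : ∀ p ∈ antidiagonal m, (if (p.1, p.2 + 1).2 = 0 then 0
          else genCoeff κ ((p.1, p.2 + 1).1 + (p.1, p.2 + 1).2)) = genCoeff κ (m + 1) := by
        intro p hp
        rw [HasAntidiagonal.mem_antidiagonal] at hp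
        rw [if_neg (by simp)]
        congr 1
        simp only
        omega
      rw [sum_congr rfl this, sum_const, Finset.Nat.card_antidiagonal]
      rw [Nat.cast_smul_eq_nsmul]
  have h3 : geomSeries κ * geomSeries κ * euler (genSeries κ)
      = geomSeries κ * euler (genSeries κ) * geomSeries κ := by ring
  have h4 := congrArg (PowerSeries.coeff M) h3
  rw [PowerSeries.coeff_mul, PowerSeries.coeff_mul M (geomSeries κ * euler (genSeries κ))] at h4
  refine Eq.trans (sum_congr rfl fun p _ => ?_) h4
  rw [← mul_sum, h2, powerSeries_coeff_euler, coeff_genSeries]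

lemma coeff_geomSeries_succ (M : ℕ) : PowerSeries.coeff (M + 1) (geomSeries κ)
    = ∑ i ∈ range (M + 1), PowerSeries.coeff i (geomSeries κ) * genCoeff κ (M + 1 - i) := by
  conv_lhs => rw [geomSeries_eq]
  rw [map_add, PowerSeries.coeff_one, if_neg (by omega), zero_add, PowerSeries.coeff_mul,
    Finset.Nat.sum_antidiagonal_eq_sum_range_succ
      (fun i j => PowerSeries.coeff i (geomSeries κ) * PowerSeries.coeff j (genSeries κ)),
    sum_range_succ, Nat.sub_self, coeff_genSeries, genCoeff_zero, mul_zero, add_zero]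
  simp only [coeff_genSeries]

/-- In two variables, Q(u) - Q(v) = Q(u) Q(v) (G(u) - G(v)). Dividing by u - v and taking the
coefficient of u^M v^r gives the identity. -/
lemma sum_geomSeries_kernel (r M : ℕ) :
    ∑ i ∈ range (M + 1), ∑ j ∈ range (r + 1), PowerSeries.coeff i (geomSeries κ) *
      (PowerSeries.coeff j (geomSeries κ) * genCoeff κ (M + r + 1 - i - j))
      = PowerSeries.coeff (M + r + 1) (geomSeries κ) := by
  have h0 : PowerSeries.coeff 0 (geomSeries κ) = 1 := by
    rw [geomSeries_eq, map_add, PowerSeries.coeff_mul]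
    simp [coeff_genSeries, genCoeff_zero]
  induction r generalizing M with
  | zero =>
    rw [add_zero, coeff_geomSeries_succ]
    refine sum_congr rfl fun i _ => ?_
    simp [h0]
  | succ r ih =>
    -- The index rectangles for (M, r + 1) and (M + 1, r) differ by one row and one column. By the
    -- recursion for Q both of these sum to Q_{M+1} Q_{r+1}.
    have h1 := ih (M + 1)
    rw [sum_range_succ] at h1
    simp only [sum_range_succ _ (r + 1), sum_add_distrib] at h1 ⊢
    have e1 : M + 1 + r + 1 = M + (r + 1) + 1 := by ring
    rw [e1] at h1
    rw [← h1]
    congr 1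
    have h2 : ∑ i ∈ range (M + 1), PowerSeries.coeff i (geomSeries κ) *
        (PowerSeries.coeff (r + 1) (geomSeries κ) * genCoeff κ (M + (r + 1) + 1 - i - (r + 1)))
        = PowerSeries.coeff (r + 1) (geomSeries κ) * PowerSeries.coeff (M + 1) (geomSeries κ) := by
      rw [coeff_geomSeries_succ κ M, mul_sum]
      refine sum_congr rfl fun i _ => ?_
      rw [show M + (r + 1) + 1 - i - (r + 1) = M + 1 - i by omega]
      ring
    have h3 : ∑ j ∈ range (r + 1), PowerSeries.coeff (M + 1) (geomSeries κ) *
        (PowerSeries.coeff j (geomSeries κ) * genCoeff κ (M + (r + 1) + 1 - (M + 1) - j))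
        = PowerSeries.coeff (M + 1) (geomSeries κ) * PowerSeries.coeff (r + 1) (geomSeries κ) := by
      rw [coeff_geomSeries_succ κ r, mul_sum]
      refine sum_congr rfl fun j _ => ?_
      rw [show M + (r + 1) + 1 - (M + 1) - j = r + 1 - j by omega]
    rw [h2, h3, mul_comm]

lemma DD_logSeries (n r : ℕ) : DD n (PowerSeries.coeff (r + 1) (logSeries κ))
    = ∑ j ∈ range (r + 1), PowerSeries.coeff j (geomSeries κ) * genCoeff κ (n + (r + 1) - j) := by
  rw [coeff_logSeries_leibniz κ _ (DD_mul n) (DD_mem n),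
    Finset.Nat.sum_antidiagonal_eq_sum_range_succ
      (fun i j => PowerSeries.coeff i (geomSeries κ) * DD n (genCoeff κ j)), sum_range_succ,
    Nat.sub_self, genCoeff_zero, map_zero, mul_zero, add_zero]
  refine sum_congr rfl fun j hj => ?_
  have := mem_range.1 hj
  rw [DD_genCoeff, if_neg (by omega), Nat.add_sub_assoc (by omega : j ≤ r + 1)]

/-- Matches the terms in which a derivation hits the coefficient L_{r+1} in the exponent of τ with
the term x_{r+1} Q_{M+r+1} of the Heisenberg field. -/
lemma sum_geomSeries_mul_DD_logSeries (M r : ℕ) :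
    ∑ p ∈ antidiagonal M, PowerSeries.coeff p.2 (geomSeries κ) *
        DD p.1 (PowerSeries.coeff (r + 1) (logSeries κ))
      = PowerSeries.coeff (M + (r + 1)) (geomSeries κ) := by
  rw [← add_assoc, ← sum_geomSeries_kernel, ← Finset.Nat.sum_antidiagonal_swap,
    Finset.Nat.sum_antidiagonal_eq_sum_range_succ_mk]
  refine sum_congr rfl fun i hi => ?_
  have := mem_range.1 hi
  rw [Prod.snd_swap, Prod.fst_swap, DD_logSeries, mul_sum]
  refine sum_congr rfl fun j hj => ?_
  have := mem_range.1 hj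
  rw [show M - i + (r + 1) - j = M + r + 1 - i - j by omega]

/-! ### The tau function and its truncations -/

/-- `∑_{r ≤ N} r x_r H_r`. -/
def xSum (N : ℕ) (H : ℕ → W) : W := ∑ r ∈ range (N + 1), MvPowerSeries.C (r • x r) * H r

/-- The truncation `exp (-∑_{r ≤ N} r x_r L_r)` of the tau function, where `L_r` are the
coefficients of `logSeries κ`. -/
def tauTrunc (N : ℕ) : W := formalExp (-xSum N fun r => PowerSeries.coeff r (logSeries κ))

lemma xSum_mem (N : ℕ) :
    -(xSum N fun r => PowerSeries.coeff r (logSeries κ)) ∈ (degFiltration (Fin 2) V).I 1 := by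
  refine neg_mem (sum_mem fun r _ => ?_)
  have := (degFiltration (Fin 2) V).mul_mem
    ((degFiltration (Fin 2) V).mem_zero (MvPowerSeries.C (r • x r)))
    (b := PowerSeries.coeff r (logSeries κ)) (n := 1) (fun e he => by
      rw [coeff_coeff_logSeries, if_pos (by omega)])
  rwa [zero_add] at this

lemma tauTrunc_leibniz (T : W →ₗ[ℂ] W) (hT : ∀ a b, T (a * b) = T a * b + a * T b)
    (hTI : ∀ n a, a ∈ (degFiltration (Fin 2) V).I (n + 1) → T a ∈ (degFiltration (Fin 2) V).I n)
    (N : ℕ) :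
    T (tauTrunc κ N) = -T (xSum N fun r => PowerSeries.coeff r (logSeries κ)) * tauTrunc κ N := by
  rw [tauTrunc, formalExp_leibniz T hT hTI (xSum_mem κ N) (Commute.all _ _), map_neg]

lemma leibniz_xSum (T : W →ₗ[ℂ] W) (hT : ∀ a b, T (a * b) = T a * b + a * T b) (N : ℕ)
    (H : ℕ → W) : T (xSum N H) = (∑ r ∈ range (N + 1), T (MvPowerSeries.C (r • x r)) * H r)
      + xSum N fun r => T (H r) := by
  rw [xSum, map_sum, xSum, ← sum_add_distrib]
  exact sum_congr rfl fun r _ => hT _ _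

lemma mul_xSum (N : ℕ) (a : W) (H : ℕ → W) : a * xSum N H = xSum N fun r => a * H r := by
  rw [xSum, xSum, mul_sum]
  exact sum_congr rfl fun r _ => by ring

/-- The derivation acts on the explicit variable x_n, giving n L_n, and on the coefficients L_r. For
n = 0 only the second contribution exists, in accordance with `lam_zero`. -/
lemma DD_tauTrunc {n N : ℕ} (h : n ≤ N) : DD n (tauTrunc κ N)
    = -(lam κ n + xSum N fun r => DD n (PowerSeries.coeff r (logSeries κ))) * tauTrunc κ N := by
  rw [tauTrunc_leibniz κ _ (DD_mul n) (DD_mem n), leibniz_xSum _ (DD_mul n)]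
  congr 3
  by_cases hn : n = 0
  · subst hn
    rw [lam_zero]
    exact sum_eq_zero fun r _ => by rw [DD_zero, euler_C, zero_mul]
  · rw [sum_eq_single n]
    · rw [DD_of_ne hn, cw_C, map_nsmul, dx_x n n hn, if_pos rfl, ← smul_coeff_logSeries,
        Nat.cast_smul_eq_nsmul, nsmul_one, map_natCast, nsmul_eq_mul]
    · intro r _ hr
      rw [DD_of_ne hn, cw_C, map_nsmul, dx_x n r hn, if_neg hr.symm]
      simp
    · intro hn'
      exact absurd (mem_range.2 (by omega)) hn'

lemma cw_dd_genCoeff (n r : ℕ) : cw (dd n) (genCoeff κ r) = 0 := by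
  by_cases hr : r = 0
  · rw [hr, genCoeff_zero, map_zero]
  rw [genCoeff_of_ne κ hr, map_sum]
  refine sum_eq_zero fun s _ => ?_
  rw [cw_mul _ (dd_mul n), cw_C, cw_X (MulFiltration.leibniz_one _ (dd_mul n)),
    mem_invariants.1 (Spz_mem_invariants _)]
  simp

lemma dd_x_smul {n : ℕ} (hn : n ≠ 0) (r : ℕ) : dd n (r • x r) = if n = r then (n : V) else 0 := by
  rw [map_nsmul, dd_apply, dx_x n r hn, dy_x, sub_zero]
  split_ifs with h
  · rw [h]; simp
  · simp

/-- The L_r are series in w and the x_n + y_n, hence killed; only the explicit x_n is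
differentiated, so τ is an eigenvector up to the multiplier -n L_n. -/
lemma dd_tauTrunc {n N : ℕ} (h : n ≤ N) :
    cw (dd n) (tauTrunc κ N) = -lam κ n * tauTrunc κ N := by
  by_cases hn : n = 0
  · subst hn
    rw [lam_zero, neg_zero, zero_mul]
    ext e : 1
    simp [coeff_cw, dd, dx, dy]
  rw [tauTrunc_leibniz κ _ (cw_mul _ (dd_mul n)) (cw_mem _), leibniz_xSum _ (cw_mul _ (dd_mul n))]
  congr 2
  have h2 : (xSum N fun r => cw (dd n) (PowerSeries.coeff r (logSeries κ))) = 0 := by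
    refine sum_eq_zero fun r _ => ?_
    simp only [coeff_logSeries_leibniz κ _ (cw_mul _ (dd_mul n)) (cw_mem _), cw_dd_genCoeff,
      mul_zero, sum_const_zero]
  rw [h2, add_zero, sum_eq_single n]
  · rw [cw_C, dd_x_smul hn, if_pos rfl, ← smul_coeff_logSeries, map_natCast,
      Nat.cast_smul_eq_nsmul, nsmul_eq_mul]
  · intro r _ hr
    rw [cw_C, dd_x_smul hn, if_neg hr.symm]
    simp
  · intro hn'
    exact absurd (mem_range.2 (by omega)) hn'

lemma pw_tauTrunc (s : Fin 2) (N : ℕ) : pw s (tauTrunc κ N)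
    = -(xSum N fun r => pw s (PowerSeries.coeff r (logSeries κ))) * tauTrunc κ N := by
  rw [tauTrunc_leibniz κ _ (pw_mul s) (pw_mem s), leibniz_xSum _ (pw_mul s)]
  congr 2
  rw [sum_eq_zero fun r _ => by rw [pw_C, zero_mul], zero_add]

end Gen

/-! ### Invariant multipliers and the shift operators on the truncated tau function -/

/-- The series in `w₁, w₂` whose coefficients are invariant. -/
def invariantsW : Subalgebra ℂ W where
  carrier := {h | ∀ e, MvPowerSeries.coeff e h ∈ invariants}
  mul_mem' {a b} ha hb e := by
    classical
    rw [MvPowerSeries.coeff_mul]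
    exact sum_mem fun p _ => mul_mem (ha _) (hb _)
  add_mem' ha hb e := by rw [map_add]; exact add_mem (ha e) (hb e)
  algebraMap_mem' c e := by
    classical
    rw [Algebra.algebraMap_eq_smul_one, coeff_smul', MvPowerSeries.coeff_one]
    split_ifs
    · exact invariants.smul_mem (one_mem _) c
    · exact invariants.smul_mem (zero_mem _) c

lemma C_mem_invariantsW {a : V} (ha : a ∈ invariants) :
    (MvPowerSeries.C a : W) ∈ invariantsW := by
  classical
  intro e
  rw [MvPowerSeries.coeff_C]
  split_ifs
  exacts [ha, zero_mem _]

lemma X_mem_invariantsW (s : Fin 2) : (MvPowerSeries.X s : W) ∈ invariantsW := by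
  classical
  intro e
  rw [MvPowerSeries.coeff_X]
  split_ifs
  exacts [one_mem _, zero_mem _]

lemma cw_dd_invariant_mul {h : W} (hh : h ∈ invariantsW) (n : ℕ) (F : W) :
    cw (dd n) (h * F) = h * cw (dd n) F :=
  cw_mul_of_commute _ _ _ fun e => dd_invariant_mul (hh e) n

lemma cw_Dp_invariant_mul {h : W} (hh : h ∈ invariantsW) (r : ℕ) (F : W) :
    cw (Dp r) (h * F) = h * cw (Dp r) F :=
  cw_mul_of_commute _ _ _ fun e => Dp_invariant_mul (hh e) r

lemma cw_Dm_invariant_mul {h : W} (hh : h ∈ invariantsW) (r : ℕ) (F : W) :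
    cw (Dm r) (h * F) = h * cw (Dm r) F :=
  cw_mul_of_commute _ _ _ fun e => Dm_invariant_mul (hh e) r

lemma cw_Dp_newton (r : ℕ) (F : W) :
    (r : ℂ) • cw (Dp r) F = ∑ p ∈ antidiagonal r, cw (dd p.1) (cw (Dp p.2) F) := by
  ext e : 1
  rw [coeff_smul', coeff_cw, map_sum]
  have := LinearMap.congr_fun (Dp_newton r) (MvPowerSeries.coeff e F)
  rw [LinearMap.smul_apply, LinearMap.sum_apply] at this
  exact this

lemma cw_Dm_newton (r : ℕ) (F : W) :
    (r : ℂ) • cw (Dm r) F = -∑ p ∈ antidiagonal r, cw (dd p.1) (cw (Dm p.2) F) := by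
  ext e : 1
  rw [coeff_smul', coeff_cw, map_neg, map_sum]
  have := LinearMap.congr_fun (Dm_newton r) (MvPowerSeries.coeff e F)
  rw [LinearMap.smul_apply, LinearMap.neg_apply, LinearMap.sum_apply] at this
  exact this

lemma cw_dd_zero (F : W) : cw (dd 0) F = 0 := by
  ext e : 1
  simp [coeff_cw, dd, dx, dy]

section Gen

variable (κ : Fin 2 → ℕ)

lemma genCoeff_mem (r : ℕ) : genCoeff κ r ∈ invariantsW := by
  unfold genCoeff
  split_ifs
  · exact zero_mem _
  · exact sum_mem fun s _ => mul_mem (C_mem_invariantsW (Spz_mem_invariants _))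
      (X_mem_invariantsW s)

lemma coeff_geomSeries_zero : PowerSeries.coeff 0 (geomSeries κ) = 1 := by
  rw [geomSeries_eq, map_add, PowerSeries.coeff_mul]
  simp [coeff_genSeries, genCoeff_zero]

lemma coeff_geomSeries_mem (r : ℕ) : PowerSeries.coeff r (geomSeries κ) ∈ invariantsW := by
  induction r using Nat.strong_induction_on with
  | _ r ih =>
    cases r with
    | zero => rw [coeff_geomSeries_zero]; exact one_mem _
    | succ r =>
      rw [coeff_geomSeries_succ]
      exact sum_mem fun i hi => mul_mem (ih i (mem_range.1 hi)) (genCoeff_mem κ _)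

lemma coeff_one_sub_genSeries (r : ℕ) :
    PowerSeries.coeff r (1 - genSeries κ) = (if r = 0 then 1 else 0) - genCoeff κ r := by
  rw [map_sub, PowerSeries.coeff_one, coeff_genSeries]

lemma coeff_one_sub_genSeries_mem (r : ℕ) :
    PowerSeries.coeff r (1 - genSeries κ) ∈ invariantsW := by
  rw [coeff_one_sub_genSeries]
  refine sub_mem ?_ (genCoeff_mem κ r)
  split_ifs
  exacts [one_mem _, zero_mem _]

/-- The operator `exp (∑ (∂x_n - ∂y_n) z⁻ⁿ / n)` multiplies the tau function by
`1 - genSeries κ`. -/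
lemma cw_Dp_tauTrunc {r N : ℕ} (h : r ≤ N) :
    cw (Dp r) (tauTrunc κ N) = PowerSeries.coeff r (1 - genSeries κ) * tauTrunc κ N := by
  induction r using Nat.strong_induction_on with
  | _ r ih =>
    by_cases hr : r = 0
    · subst hr
      rw [Dp_zero, coeff_one_sub_genSeries, genCoeff_zero, if_pos rfl, sub_zero, one_mul]
      rfl
    have hr' : (r : ℂ) ≠ 0 := by exact_mod_cast hr
    refine smul_right_injective W hr' ?_
    change (r : ℂ) • _ = (r : ℂ) • _
    rw [cw_Dp_newton]
    have h1 : ∀ p ∈ antidiagonal r, cw (dd p.1) (cw (Dp p.2) (tauTrunc κ N))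
        = -(lam κ p.1 * PowerSeries.coeff p.2 (1 - genSeries κ)) * tauTrunc κ N := by
      intro p hp
      have := HasAntidiagonal.mem_antidiagonal.1 hp
      by_cases h0 : p.1 = 0
      · rw [h0, cw_dd_zero, lam_zero]; ring
      · rw [ih _ (by omega) (by omega), cw_dd_invariant_mul (coeff_one_sub_genSeries_mem κ _),
          dd_tauTrunc κ (by omega)]
        ring
    rw [sum_congr rfl h1, ← sum_mul, sum_neg_distrib]
    -- With E the Euler operator in z⁻¹, the series of the `lam κ n` is -E(1 - G)/(1 - G), so
    -- Newton's recurrence is the differential equation satisfied by 1 - G.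
    have h2 : geomSeries κ * euler (genSeries κ) * (1 - genSeries κ) = euler (genSeries κ) := by
      linear_combination euler (genSeries κ) * geomSeries_mul κ
    have h3 := congrArg (PowerSeries.coeff r) h2
    rw [PowerSeries.coeff_mul, powerSeries_coeff_euler, coeff_genSeries] at h3
    change (-∑ p ∈ antidiagonal r, PowerSeries.coeff p.1 (geomSeries κ * euler (genSeries κ))
      * PowerSeries.coeff p.2 (1 - genSeries κ)) * _ = _
    rw [h3, coeff_one_sub_genSeries, if_neg hr, zero_sub, neg_mul, neg_mul, smul_neg,
      smul_mul_assoc]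

/-- The opposite sign in Newton's recurrence leads to the differential equation of Q, namely E(Q) =
Q² E(G) for the Euler operator E in z⁻¹. -/
lemma cw_Dm_tauTrunc {r N : ℕ} (h : r ≤ N) :
    cw (Dm r) (tauTrunc κ N) = PowerSeries.coeff r (geomSeries κ) * tauTrunc κ N := by
  induction r using Nat.strong_induction_on with
  | _ r ih =>
    by_cases hr : r = 0
    · subst hr
      rw [Dm_zero, coeff_geomSeries_zero, one_mul]
      rfl
    have hr' : (r : ℂ) ≠ 0 := by exact_mod_cast hr
    refine smul_right_injective W hr' ?_
    change (r : ℂ) • _ = (r : ℂ) • _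
    rw [cw_Dm_newton]
    have h1 : ∀ p ∈ antidiagonal r, cw (dd p.1) (cw (Dm p.2) (tauTrunc κ N))
        = -(lam κ p.1 * PowerSeries.coeff p.2 (geomSeries κ)) * tauTrunc κ N := by
      intro p hp
      have := HasAntidiagonal.mem_antidiagonal.1 hp
      by_cases h0 : p.1 = 0
      · rw [h0, cw_dd_zero, lam_zero]; ring
      · rw [ih _ (by omega) (by omega), cw_dd_invariant_mul (coeff_geomSeries_mem κ _),
          dd_tauTrunc κ (by omega)]
        ring
    rw [sum_congr rfl h1, ← sum_mul, sum_neg_distrib]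
    have h2 : geomSeries κ * euler (genSeries κ) * geomSeries κ = euler (geomSeries κ) := by
      rw [geomSeries_leibniz κ euler euler_mul]; ring
    have h3 := congrArg (PowerSeries.coeff r) h2
    rw [PowerSeries.coeff_mul, powerSeries_coeff_euler] at h3
    change -((-∑ p ∈ antidiagonal r, PowerSeries.coeff p.1 (geomSeries κ * euler (genSeries κ))
      * PowerSeries.coeff p.2 (geomSeries κ)) * _) = _
    rw [h3, neg_mul, neg_neg, smul_mul_assoc]

end Gen

/-! ### Comparison with the tau function of the statement -/

lemma laurent_coeff_sum {R ι : Type*} [Semiring R] (s : Finset ι) (p : ι → LaurentPolynomial R)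
    (n : ℤ) : (∑ i ∈ s, p i).coeff n = ∑ i ∈ s, (p i).coeff n := by
  classical
  induction s using Finset.induction_on with
  | empty => simp
  | insert a s ha ih => rw [sum_insert ha, sum_insert ha, ← ih]; rfl

lemma laurent_coeff_C_mul_T {R : Type*} [Semiring R] (a : R) (n m : ℤ) :
    (LaurentPolynomial.C a * LaurentPolynomial.T n).coeff m = if n = m then a else 0 := by
  classical
  rw [← LaurentPolynomial.single_eq_C_mul_T, AddMonoidAlgebra.coeff_single, Finsupp.single_apply]

/-- `genSeries κ` as a polynomial in `z⁻¹`. -/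
def genPoly (κ : Fin 2 → ℕ) : Polynomial W :=
  ∑ r ∈ range (genDeg κ + 1), Polynomial.monomial r (genCoeff κ r)

lemma coeff_genPoly (κ : Fin 2 → ℕ) (r : ℕ) : (genPoly κ).coeff r = genCoeff κ r := by
  rw [genPoly, Polynomial.finsetSum_coeff]
  simp only [Polynomial.coeff_monomial]
  rw [sum_ite_eq' (range (genDeg κ + 1)) r]
  split_ifs with h
  · rfl
  · ext e : 1
    rw [coeff_genCoeff_eq_zero κ (by simp at h; omega), map_zero]

lemma coe_genPoly (κ : Fin 2 → ℕ) : (genPoly κ : PowerSeries W) = genSeries κ := by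
  ext r : 1
  rw [Polynomial.coeff_coe, coeff_genPoly, coeff_genSeries]

lemma invert_toLaurent_coeff {R : Type*} [CommSemiring R] (p : Polynomial R) (s : ℤ) :
    (LaurentPolynomial.invert (Polynomial.toLaurent p)).coeff s
      = if s ≤ 0 then p.coeff (-s).toNat else 0 := by
  rw [LaurentPolynomial.invert_apply]
  induction p using Polynomial.induction_on' with
  | add p q hp hq =>
    rw [map_add, AddMonoidAlgebra.coeff_add, Finsupp.add_apply, hp, hq, Polynomial.coeff_add]
    split_ifs <;> simp
  | monomial n a =>
    rw [← Polynomial.C_mul_X_pow_eq_monomial, Polynomial.toLaurent_C_mul_X_pow,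
      laurent_coeff_C_mul_T, Polynomial.coeff_C_mul_X_pow]
    by_cases h : (n : ℤ) = -s
    · rw [if_pos h, if_pos (by omega), if_pos (by omega)]
    · rw [if_neg h]
      split_ifs with h1 h2
      · omega
      · rfl
      · rfl

lemma sum_Spz_aux (l : ℕ) (b : W) (s : ℤ) :
    (((∑ m ∈ range (l + 1), LaurentPolynomial.C (MvPowerSeries.C (Sp m)) *
      LaurentPolynomial.T (-(l : ℤ) - 1 + m)) * LaurentPolynomial.C b :
        LaurentPolynomial W)).coeff s
      = if s < 0 then MvPowerSeries.C (Spz (l + 1 + s)) * b else 0 := by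
  rw [sum_mul, laurent_coeff_sum]
  have h1 : ∀ m : ℕ, (LaurentPolynomial.C (MvPowerSeries.C (Sp m)) *
      LaurentPolynomial.T (-(l : ℤ) - 1 + m) * LaurentPolynomial.C b :
        LaurentPolynomial W).coeff s
      = if -(l : ℤ) - 1 + m = s then MvPowerSeries.C (Sp m) * b else 0 := by
    intro m
    rw [mul_right_comm, ← map_mul, laurent_coeff_C_mul_T]
  simp only [h1]
  by_cases h : s < 0 ∧ 0 ≤ l + 1 + s
  · rw [if_pos h.1, sum_eq_single (l + 1 + s).toNat]
    · rw [if_pos (by omega), Spz, if_pos h.2]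
    · intro m _ hm
      rw [if_neg (by omega)]
    · intro hm
      exact absurd (mem_range.2 (by omega)) hm
  · rw [sum_eq_zero]
    · split_ifs with h2
      · rw [Spz_of_neg (by omega), map_zero, zero_mul]
      · rfl
    · intro m hm
      have := mem_range.1 hm
      rw [if_neg (by omega)]

lemma gen_eq (l k : ℕ) :
    gen l k = LaurentPolynomial.invert (Polynomial.toLaurent (genPoly ![l, k])) := by
  refine LaurentPolynomial.ext fun s => ?_
  rw [gen, AddMonoidAlgebra.coeff_add, Finsupp.add_apply, sum_Spz_aux, sum_Spz_aux,
    invert_toLaurent_coeff, coeff_genPoly]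
  by_cases hs : s < 0
  · rw [if_pos hs, if_pos hs, if_pos hs.le, genCoeff_of_ne _ (by omega), Fin.sum_univ_two]
    have : ((-s).toNat : ℤ) = -s := by omega
    simp [this]
  · rw [if_neg hs, if_neg hs]
    split_ifs with h
    · have : s = 0 := by omega
      subst this
      simp [genCoeff_zero]
    · simp

lemma gen_pow_coeff (l k n : ℕ) (s : ℤ) : (gen l k ^ n).coeff s
    = if s ≤ 0 then PowerSeries.coeff (-s).toNat (genSeries ![l, k] ^ n) else 0 := by
  rw [gen_eq, ← map_pow, ← map_pow, invert_toLaurent_coeff, ← coe_genPoly, ← Polynomial.coe_pow,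
    Polynomial.coeff_coe]

lemma genDeg_pair (l k : ℕ) : genDeg ![l, k] = l + k + 2 := by
  simp [genDeg]

lemma fcoeff_eq (l k n i : ℕ) (h : i ≤ n * (l + k + 2)) : fcoeff l k n i
    = PowerSeries.coeff (n * (l + k + 2) - i) (genSeries ![l, k] ^ n) := by
  have h1 : ((n * (l + k + 2) - i : ℕ) : ℤ) = n * (l + k + 2) - i := by
    rw [Nat.cast_sub h]; push_cast; ring
  rw [fcoeff, gen_pow_coeff, if_pos (by omega)]
  congr 2
  omega

/-- Substitute r = n(l+k+2) - i. The bound N is free because Gⁿ has no further coefficients, which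
allows a comparison with a single truncation for all n that matter. -/
lemma coeff_pn (l k n N : ℕ) (hN : n * (l + k + 2) ≤ N) (e : Fin 2 →₀ ℕ) :
    MvPowerSeries.coeff e (pn l k n) = ∑ r ∈ range (N + 1), MvPowerSeries.coeff e
      (PowerSeries.coeff r (genSeries ![l, k] ^ n)) * (r • x r) := by
  have hmul : n * (l + k + 2) = n * (l + k + 1) + n := by ring
  rw [pn, map_sum]
  have h1 : ∑ i ∈ range (n * (l + k + 1) + 1), MvPowerSeries.coeff e (fcoeff l k n i *
      MvPowerSeries.C ((n * (l + k + 2) - i) • x (n * (l + k + 2) - i)))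
      = ∑ r ∈ Icc n (n * (l + k + 2)), MvPowerSeries.coeff e
      (PowerSeries.coeff r (genSeries ![l, k] ^ n)) * (r • x r) := by
    refine sum_nbij' (fun i => n * (l + k + 2) - i) (fun r => n * (l + k + 2) - r) ?_ ?_ ?_ ?_ ?_
    · intro i hi
      simp only [mem_range, mem_Icc] at hi ⊢
      omega
    · intro i hi
      simp only [mem_range, mem_Icc] at hi ⊢
      omega
    · intro i hi
      simp only [mem_range] at hi
      omega
    · intro i hi
      simp only [mem_Icc] at hi
      omega
    · intro i hi
      simp only [mem_range] at hi
      rw [fcoeff_eq l k n i (by omega), MvPowerSeries.coeff_mul_C]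
  rw [h1]
  refine sum_subset (fun r hr => ?_) fun r _ hr => ?_
  · simp only [mem_range, mem_Icc] at hr ⊢
    omega
  · simp only [mem_Icc] at hr
    rw [coeff_genSeries_pow_eq_zero, zero_mul]
    rw [genDeg_pair]
    omega

/-- The tau function and its truncations agree in low degrees. -/
lemma coeff_f (l k N : ℕ) (e : Fin 2 →₀ ℕ) (he : e.degree * genDeg ![l, k] ≤ N) :
    MvPowerSeries.coeff e (f l k) = MvPowerSeries.coeff e (tauTrunc ![l, k] N) := by
  -- At exponents of degree at most |e| the two logarithms coincide, since only the power of G equal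
  -- to that degree contributes and N covers all its powers of z⁻¹. Exponentiation preserves this
  -- congruence.
  have key : -formalSum (fun n : ℕ => ((n + 1 : ℕ) : ℂ)⁻¹ • pn l k (n + 1))
      - -(xSum N fun r => PowerSeries.coeff r (logSeries ![l, k]))
      ∈ (degFiltration (Fin 2) V).I (e.degree + 1) := by
    intro e' he'
    rw [neg_sub_neg, map_sub, sub_eq_zero]
    change _ = ∑ᶠ n : ℕ, ((n + 1 : ℕ) : ℂ)⁻¹ • MvPowerSeries.coeff e' (pn l k (n + 1))
    have hx : MvPowerSeries.coeff e' (xSum N fun r => PowerSeries.coeff r (logSeries ![l, k]))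
        = ∑ r ∈ range (N + 1), (r • x r) * MvPowerSeries.coeff e'
          (PowerSeries.coeff r (logSeries ![l, k])) := by
      rw [xSum, map_sum]
      exact sum_congr rfl fun r _ => MvPowerSeries.coeff_C_mul _ _ _
    have h0 : ∀ n : ℕ, e'.degree ≠ n + 1 → MvPowerSeries.coeff e' (pn l k (n + 1)) = 0 := by
      intro n hn
      rw [coeff_pn l k (n + 1) _ le_rfl]
      exact sum_eq_zero fun r _ => by rw [coeff_genSeries_pow_eq_zero _ (Or.inl hn), zero_mul]
    rw [hx]
    by_cases hz : e'.degree = 0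
    · rw [finsum_eq_zero_of_forall_eq_zero fun n => by rw [h0 n (by omega), smul_zero]]
      exact sum_eq_zero fun r _ => by rw [coeff_coeff_logSeries, if_pos hz, mul_zero]
    · obtain ⟨m, hm⟩ := Nat.exists_eq_succ_of_ne_zero hz
      rw [finsum_eq_single _ m fun n hn => by rw [h0 n (by omega), smul_zero]]
      have hN : (m + 1) * (l + k + 2) ≤ N := by
        rw [genDeg_pair] at he
        exact le_trans (Nat.mul_le_mul_right _ (by omega)) he
      rw [coeff_pn l k (m + 1) N hN, smul_sum]
      refine sum_congr rfl fun r _ => ?_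
      rw [coeff_coeff_logSeries, if_neg hz, hm, mul_smul_comm, mul_comm]
  have := formalExp_congr key e (Nat.lt_succ_self _)
  rw [map_sub, sub_eq_zero] at this
  exact this

/-! ### The weight filtration of `ℂ[[x, y]]` -/

/-- The weight of a monomial, where `x_n` and `y_n` have weight `n`. -/
def wt : (Var →₀ ℕ) →+ ℕ := Finsupp.weight (Sum.elim (fun n => n + 1) (fun n => n + 1))

/-- The filtration of `ℂ[[x, y]]` by weight. -/
def wtFiltration : MulFiltration V where
  I n :=
    { carrier := {g | ∀ d, wt d < n → MvPowerSeries.coeff d g = 0}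
      add_mem' := fun ha hb d hd => by rw [map_add, ha d hd, hb d hd, add_zero]
      zero_mem' := fun d _ => map_zero _
      smul_mem' := fun c a ha d hd => by rw [coeff_smul', ha d hd, smul_zero] }
  anti h _ ha d hd := ha d (by omega)
  mem_zero a d hd := by omega
  mul_mem := by
    intro m n a b ha hb d hd
    classical
    rw [MvPowerSeries.coeff_mul]
    refine sum_eq_zero fun p hp => ?_
    have hp' := HasAntidiagonal.mem_antidiagonal.1 hp
    have : wt p.1 + wt p.2 = wt d := by rw [← hp', map_add]
    by_cases h : wt p.1 < m
    · rw [ha _ h, zero_mul]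
    · rw [hb p.2 (by omega), mul_zero]
  sep a ha := by
    ext d
    exact ha (wt d + 1) d (by omega)

lemma x_mem (n : ℕ) : x n ∈ wtFiltration.I n := by
  classical
  cases n with
  | zero => exact wtFiltration.mem_zero _
  | succ n =>
    intro d hd
    change MvPowerSeries.coeff d (MvPowerSeries.X (Sum.inl n : Var)) = 0
    rw [MvPowerSeries.coeff_X, if_neg]
    rintro rfl
    simp [wt, Finsupp.weight_single] at hd

lemma y_mem (n : ℕ) : y n ∈ wtFiltration.I n := by
  classical
  cases n with
  | zero => exact wtFiltration.mem_zero _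
  | succ n =>
    intro d hd
    change MvPowerSeries.coeff d (MvPowerSeries.X (Sum.inr n : Var)) = 0
    rw [MvPowerSeries.coeff_X, if_neg]
    rintro rfl
    simp [wt, Finsupp.weight_single] at hd

lemma schur_mem (t : ℕ → V) (ht : ∀ n, t n ∈ wtFiltration.I n) (r : ℕ) :
    schur t r ∈ wtFiltration.I r := by
  induction r using Nat.strong_induction_on with
  | _ r ih =>
    by_cases hr : r = 0
    · subst hr; exact wtFiltration.mem_zero _
    have hr' : (r : ℂ) ≠ 0 := by exact_mod_cast hr
    have h : schur t r = (r : ℂ)⁻¹ • ((r : ℂ) • schur t r) := by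
      rw [smul_smul, inv_mul_cancel₀ hr', one_smul]
    rw [h, schur_newton t (fun _ _ => Commute.all _ _)]
    refine Submodule.smul_mem _ _ (sum_mem fun p hp => ?_)
    have hp' := HasAntidiagonal.mem_antidiagonal.1 hp
    by_cases h0 : p.1 = 0
    · rw [h0]; simp
    · have := wtFiltration.mul_mem (Submodule.smul_mem _ (p.1 : ℂ) (ht p.1))
        (ih p.2 (by omega))
      rwa [hp'] at this

lemma Sp_mem (r : ℕ) : Sp r ∈ wtFiltration.I r :=
  schur_mem _ (fun n => add_mem (x_mem n) (y_mem n)) r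

lemma Sm_mem (r : ℕ) : Sm r ∈ wtFiltration.I r :=
  schur_mem _ (fun n => sub_mem (neg_mem (x_mem n)) (y_mem n)) r

lemma coeff_Sp_mul_eq_zero {a : ℕ} {d : Var →₀ ℕ} (h : wt d < a) (g : V) :
    MvPowerSeries.coeff d (Sp a * g) = 0 :=
  wtFiltration.mul_mem (Sp_mem a) (wtFiltration.mem_zero g) d h

lemma coeff_Sm_mul_eq_zero {a : ℕ} {d : Var →₀ ℕ} (h : wt d < a) (g : V) :
    MvPowerSeries.coeff d (Sm a * g) = 0 :=
  wtFiltration.mul_mem (Sm_mem a) (wtFiltration.mem_zero g) d h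

lemma A_mem (s t : ℕ) : A s t ∈ wtFiltration.I (s + t) := by
  refine sum_mem fun m hm => ?_
  have := wtFiltration.mul_mem (Sp_mem m) (Sm_mem (s + t - m))
  rwa [Nat.add_sub_cancel' (by have := mem_range.1 hm; omega)] at this

/-! ### The affine functions describing the modes of `φ` -/

section Affine

variable (κ : Fin 2 → ℕ)

/-- `S_{i-1}(-x-y) - ∑_t A_{i, κ t} w_t`. -/
def affine (i : ℕ) : W :=
  MvPowerSeries.C (Smz ((i : ℤ) - 1)) - ∑ t, MvPowerSeries.C (A i (κ t)) * MvPowerSeries.X t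

lemma affine_mem (i : ℕ) : affine κ i ∈ invariantsW :=
  sub_mem (C_mem_invariantsW (Smz_mem_invariants _)) (sum_mem fun t _ =>
    mul_mem (C_mem_invariantsW (A_mem_invariants _ _)) (X_mem_invariantsW t))

lemma pw_affine (s : Fin 2) (i : ℕ) : pw s (affine κ i) = -MvPowerSeries.C (A i (κ s)) := by
  rw [affine, map_sub, pw_C, map_sum, zero_sub]
  congr 1
  rw [sum_eq_single s]
  · rw [pw_mul, pw_C, pw_X, if_pos rfl]; ring
  · intro t _ ht
    rw [pw_mul, pw_C, pw_X, if_neg ht]; ring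
  · intro hs
    exact absurd (mem_univ s) hs

/-- Both sides sum h over the integers from -n to a - 1, cut at different places. -/
lemma sum_range_shift (a n : ℕ) (h : ℤ → V) :
    ∑ m ∈ range a, h (m - n) + ∑ r ∈ range n, h (a - 1 - r)
      = ∑ r ∈ range n, h (r - n) + ∑ m ∈ range a, h m := by
  have h1 : ∑ m ∈ range (a + n), h (m - n)
      = ∑ m ∈ range a, h (m - n) + ∑ r ∈ range n, h (a - 1 - r) := by
    rw [sum_range_add, ← sum_range_reflect (fun r : ℕ => h (a - 1 - r)) n]
    refine congrArg _ (sum_congr rfl fun r hr => ?_)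
    have := mem_range.1 hr
    congr 1
    omega
  have h2 : ∑ m ∈ range (n + a), h (m - n)
      = ∑ r ∈ range n, h (r - n) + ∑ m ∈ range a, h m := by
    rw [sum_range_add]
    refine congrArg _ (sum_congr rfl fun r _ => ?_)
    congr 1
    push_cast
    ring
  rw [← h1, ← h2, add_comm a n]

lemma A_eq (i l : ℕ) : A i l = ∑ m ∈ range (l + 1), Spz m * Smz (i + l - m) := by
  refine sum_congr rfl fun m hm => ?_
  have := mem_range.1 hm
  rw [Spz_natCast, ← Smz_natCast]
  congr 2
  omega

/-- The Leibniz rule gives the difference of one sum and its translate by n, so only boundary terms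
survive. Those at the lower end vanish, having a factor S of negative index. -/
lemma dx_A {n : ℕ} (hn : n ≠ 0) (i l : ℕ) : dx n (A i l)
    = -∑ r ∈ range n, Smz ((i : ℤ) - 1 - (n - (r + 1))) * Spz (l + 1 - (r + 1)) := by
  have h := sum_range_shift (l + 1) n fun j => Spz j * Smz (i + l - n - j)
  rw [sum_eq_zero (s := range n) (f := fun r : ℕ => Spz ((r : ℤ) - n)
    * Smz (i + l - n - ((r : ℤ) - n))) fun r hr => by
      have := mem_range.1 hr
      rw [Spz_of_neg (by omega), zero_mul], zero_add] at h
  rw [A_eq, map_sum]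
  have h1 : ∀ m : ℕ, dx n (Spz m * Smz (i + l - m))
      = Spz (m - n) * Smz (i + l - n - (m - n)) - Spz m * Smz (i + l - n - m) := by
    intro m
    rw [dx_mul, dx_Spz hn, dx_Smz hn, mul_neg, ← sub_eq_add_neg]
    congr 3 <;> ring
  simp only [h1]
  rw [sum_sub_distrib, ← h, sub_add_cancel_left]
  congr 1
  refine sum_congr rfl fun r _ => ?_
  rw [mul_comm]
  congr 2 <;> push_cast <;> ring

/-- Commutator of a Heisenberg mode with multiplication by α_i. The subtraction at n = 0 reflects
that φ_{-i}, which produces the factor α_i, lowers the charge by one. -/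
lemma DD_affine (n i : ℕ) : DD n (affine κ i) - (if n = 0 then affine κ i else 0)
    = -∑ p ∈ antidiagonal n, MvPowerSeries.C (Smz ((i : ℤ) - 1 - p.1))
        * PowerSeries.coeff p.2 (1 - genSeries κ) := by
  by_cases hn : n = 0
  · subst hn
    rw [if_pos rfl, DD_zero, affine, map_sub, euler_C, map_sum]
    simp only [euler_mul, euler_C, euler_X, zero_mul, zero_add]
    simp [coeff_genSeries, genCoeff_zero]
    ring
  obtain ⟨n, rfl⟩ := Nat.exists_eq_succ_of_ne_zero hn
  rw [if_neg hn, sub_zero, Finset.Nat.sum_antidiagonal_succ', coeff_one_sub_genSeries, if_pos rfl,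
    genCoeff_zero, sub_zero, mul_one, affine, map_sub, map_sum, DD_of_ne hn, cw_C, dx_Smz hn,
    map_neg, neg_add, sub_eq_add_neg]
  congr 1
  have h1 : ∀ p ∈ antidiagonal n, MvPowerSeries.C (Smz ((i : ℤ) - 1 - (p.1, p.2 + 1).1))
      * PowerSeries.coeff (p.1, p.2 + 1).2 (1 - genSeries κ)
      = -∑ t, MvPowerSeries.C (Smz ((i : ℤ) - 1 - p.1) * Spz (κ t + 1 - (p.2 + 1)))
        * MvPowerSeries.X t := by
    intro p _
    rw [coeff_one_sub_genSeries, if_neg (Nat.succ_ne_zero _), zero_sub,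
      genCoeff_of_ne κ (Nat.succ_ne_zero _), mul_neg, mul_sum]
    refine congrArg _ (sum_congr rfl fun t _ => ?_)
    rw [map_mul, mul_assoc]
    push_cast
    rfl
  rw [sum_congr rfl h1, sum_neg_distrib, sum_comm]
  congr 2
  rw [← sum_neg_distrib]
  refine sum_congr rfl fun t _ => ?_
  rw [← sum_mul, cw_mul _ (dx_mul _), cw_C, cw_X (MulFiltration.leibniz_one _ (dx_mul _)), mul_zero,
    add_zero, dx_A hn, ← map_sum, map_neg, neg_mul]
  congr 3
  rw [← Finset.Nat.sum_antidiagonal_swap, Finset.Nat.sum_antidiagonal_eq_sum_range_succ_mk]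
  refine sum_congr rfl fun r hr => ?_
  have := mem_range.1 hr
  simp only [Prod.fst_swap, Prod.snd_swap]
  congr 2
  push_cast [Nat.cast_sub (by omega : r ≤ n)]
  ring

/-! ### The Heisenberg field on invariant multiples of the tau function -/

/-- The negative modes of the Heisenberg field `α(z) exp (-∑ (∂x_n - ∂y_n) z⁻ⁿ / n)` applied to
`h * tauTrunc κ N`, with charge shifted by `-j`. -/
def heisenberg (N : ℕ) (h : W) (j M : ℕ) : W :=
  ∑ p ∈ antidiagonal M,
    (DD p.1 (PowerSeries.coeff p.2 (geomSeries κ) * (h * tauTrunc κ N))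
      - if p.1 = 0 then (j : ℂ) • (PowerSeries.coeff p.2 (geomSeries κ) * (h * tauTrunc κ N))
        else 0)
  + xSum N fun r => PowerSeries.coeff (M + r) (geomSeries κ) * (h * tauTrunc κ N)

/-- Derivatives of Q cancel the terms lam · Q by `sum_DD_geomSeries`. Derivatives of the L_r in the
exponent cancel the multiplications by r x_r, by `sum_geomSeries_mul_DD_logSeries`. -/
lemma heisenberg_one {N M : ℕ} (hM : M ≤ N) : heisenberg κ N 1 0 M = 0 := by
  have h1 : ∀ p ∈ antidiagonal M,
      (DD p.1 (PowerSeries.coeff p.2 (geomSeries κ) * (1 * tauTrunc κ N))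
      - if p.1 = 0 then ((0 : ℕ) : ℂ) • (PowerSeries.coeff p.2 (geomSeries κ) *
        (1 * tauTrunc κ N)) else 0)
      = DD p.1 (PowerSeries.coeff p.2 (geomSeries κ)) * tauTrunc κ N
        - lam κ p.1 * PowerSeries.coeff p.2 (geomSeries κ) * tauTrunc κ N
        - (xSum N fun r => PowerSeries.coeff p.2 (geomSeries κ) *
          DD p.1 (PowerSeries.coeff r (logSeries κ))) * tauTrunc κ N := by
    intro p hp
    have := HasAntidiagonal.mem_antidiagonal.1 hp
    rw [Nat.cast_zero, zero_smul, ite_self, sub_zero, one_mul, DD_mul,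
      DD_tauTrunc κ (by omega : p.1 ≤ N), ← mul_xSum]
    ring
  rw [heisenberg, sum_congr rfl h1, sum_sub_distrib, sum_sub_distrib, ← sum_mul, ← sum_mul,
    sum_DD_geomSeries, sub_self, zero_sub, ← sum_mul, neg_add_eq_sub, sub_eq_zero, one_mul]
  simp only [xSum]
  rw [sum_comm, sum_mul]
  refine sum_congr rfl fun r _ => ?_
  cases r with
  | zero => simp
  | succ r =>
    rw [← mul_sum, sum_geomSeries_mul_DD_logSeries]
    ring

/-- The commutator from `DD_affine` is a convolution with 1 - G. The field carries a factor Q, so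
the two cancel and a single series S_{i-1-M}(-x-y) remains. -/
lemma heisenberg_affine_mul (i N : ℕ) (h : W) (j M : ℕ) :
    heisenberg κ N (affine κ i * h) (j + 1) M = affine κ i * heisenberg κ N h j M
      - MvPowerSeries.C (Smz ((i : ℤ) - 1 - M)) * (h * tauTrunc κ N) := by
  set t := h * tauTrunc κ N with ht
  have h1 : ∀ p ∈ antidiagonal M,
      (DD p.1 (PowerSeries.coeff p.2 (geomSeries κ) * (affine κ i * h * tauTrunc κ N))
      - if p.1 = 0 then ((j + 1 : ℕ) : ℂ) • (PowerSeries.coeff p.2 (geomSeries κ) *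
        (affine κ i * h * tauTrunc κ N)) else 0)
      = affine κ i * (DD p.1 (PowerSeries.coeff p.2 (geomSeries κ) * t)
          - if p.1 = 0 then (j : ℂ) • (PowerSeries.coeff p.2 (geomSeries κ) * t) else 0)
        + (DD p.1 (affine κ i) - if p.1 = 0 then affine κ i else 0) *
          PowerSeries.coeff p.2 (geomSeries κ) * t := by
    intro p _
    rw [show PowerSeries.coeff p.2 (geomSeries κ) * (affine κ i * h * tauTrunc κ N)
      = affine κ i * (PowerSeries.coeff p.2 (geomSeries κ) * t) by rw [ht]; ring, DD_mul]
    split_ifs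
    · push_cast
      rw [add_smul, one_smul, mul_sub, mul_smul_comm]
      ring
    · ring
  have h2 : (PowerSeries.mk (fun n : ℕ => (MvPowerSeries.C (Smz ((i : ℤ) - 1 - n)) : W)))
      * (1 - genSeries κ) * geomSeries κ
      = PowerSeries.mk (fun n : ℕ => (MvPowerSeries.C (Smz ((i : ℤ) - 1 - n)) : W)) := by
    rw [mul_assoc, mul_comm (1 - genSeries κ), geomSeries_mul, mul_one]
  have h3 := congrArg (PowerSeries.coeff M) h2
  rw [PowerSeries.coeff_mul, PowerSeries.coeff_mk] at h3
  rw [heisenberg, sum_congr rfl h1, sum_add_distrib, ← mul_sum, ← sum_mul]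
  have h4 : ∑ p ∈ antidiagonal M, (DD p.1 (affine κ i) - if p.1 = 0 then affine κ i else 0) *
      PowerSeries.coeff p.2 (geomSeries κ) = -MvPowerSeries.C (Smz ((i : ℤ) - 1 - M)) := by
    rw [← h3, ← sum_neg_distrib]
    refine sum_congr rfl fun p _ => ?_
    rw [DD_affine, PowerSeries.coeff_mul, neg_mul]
    simp only [PowerSeries.coeff_mk]
  have h5 : (xSum N fun r => PowerSeries.coeff (M + r) (geomSeries κ) *
      (affine κ i * h * tauTrunc κ N))
      = affine κ i * xSum N fun r => PowerSeries.coeff (M + r) (geomSeries κ) * t := by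
    rw [mul_xSum]
    congr 1
    funext r
    rw [ht]; ring
  rw [h4, h5, heisenberg]
  ring

/-- The mode `φ*_{-κ s}` applied to `h * tauTrunc κ N`, with charge shifted by `-j`. -/
def phiStarTrunc (s : Fin 2) (N : ℕ) (h : W) (j : ℕ) : W :=
  (∑ a ∈ range (κ s + 1), MvPowerSeries.C (Sp a) * xSum N fun r =>
    (if κ s + 1 - a ≤ r then PowerSeries.coeff (r - (κ s + 1 - a)) (geomSeries κ) else 0)
      * (h * tauTrunc κ N))
  + ∑ M ∈ range (N + 1), MvPowerSeries.C (Sp (κ s + 1 + M)) * heisenberg κ N h j M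

/-- Recognizes the part of φ* with only multiplication modes as a convolution with the Laurent
polynomial ∂G/∂w_s. -/
lemma sum_Sp_reindex (k r : ℕ) (q : ℕ → W) :
    ∑ a ∈ range (k + 1), MvPowerSeries.C (Sp a) * (if k + 1 - a ≤ r then q (r - (k + 1 - a)) else 0)
      = ∑ p ∈ antidiagonal r, q p.1 *
        (if p.2 = 0 then 0 else MvPowerSeries.C (Spz (k + 1 - p.2))) := by
  have h1 : ∑ a ∈ range (k + 1), MvPowerSeries.C (Sp a) *
      (if k + 1 - a ≤ r then q (r - (k + 1 - a)) else 0)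
      = ∑ t ∈ range (k + 1 + r), (if t + 1 ≤ r then q (r - (t + 1)) else 0) *
        (MvPowerSeries.C (Spz ((k : ℤ) - t)) : W) := by
    rw [← sum_range_reflect]
    rw [← sum_subset (range_subset_range.2 (by omega : k + 1 ≤ k + 1 + r))]
    · refine sum_congr rfl fun t ht => ?_
      have := mem_range.1 ht
      rw [show k + 1 - (k + 1 - 1 - t) = t + 1 by omega, mul_comm,
        show ((k : ℤ) - t) = ((k + 1 - 1 - t : ℕ) : ℤ) by omega, Spz_natCast]
    · intro t _ ht
      simp only [mem_range] at ht
      rw [Spz_of_neg (by omega), map_zero, mul_zero]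
  rw [h1]
  cases r with
  | zero => simp
  | succ r =>
    rw [Finset.Nat.sum_antidiagonal_succ', if_pos rfl, mul_zero, zero_add,
      ← Finset.Nat.sum_antidiagonal_swap, Finset.Nat.sum_antidiagonal_eq_sum_range_succ_mk,
      ← sum_subset (range_subset_range.2 (by omega : r + 1 ≤ k + 1 + (r + 1)))]
    · refine sum_congr rfl fun t ht => ?_
      have := mem_range.1 ht
      simp only [Prod.fst_swap, Prod.snd_swap]
      rw [if_pos (by omega), if_neg (by omega), show r + 1 - (t + 1) = r - t by omega]
      congr 3
      push_cast
      ring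
    · intro t _ ht
      simp only [mem_range] at ht
      rw [if_neg (by omega), zero_mul]

lemma pw_genCoeff (s : Fin 2) (r : ℕ) :
    pw s (genCoeff κ r) = if r = 0 then 0 else MvPowerSeries.C (Spz (κ s + 1 - r)) := by
  split_ifs with hr
  · rw [hr, genCoeff_zero, map_zero]
  rw [genCoeff_of_ne κ hr, map_sum, sum_eq_single s]
  · rw [pw_mul, pw_C, pw_X, if_pos rfl]; ring
  · intro t _ ht
    rw [pw_mul, pw_C, pw_X, if_neg ht]; ring
  · intro hs
    exact absurd (mem_univ s) hs

/-- The modes collected in `heisenberg` vanish. The others give ∑ r x_r [Q ∂G/∂w_s]_r τ, and Q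
∂G/∂w_s = ∂L/∂w_s. -/
lemma phiStarTrunc_one (s : Fin 2) (N : ℕ) :
    phiStarTrunc κ s N 1 0 = -pw s (1 * tauTrunc κ N) := by
  rw [phiStarTrunc, sum_eq_zero (s := range (N + 1)) fun M hM => by
    rw [heisenberg_one κ (by have := mem_range.1 hM; omega), mul_zero], add_zero, one_mul,
    pw_tauTrunc, neg_mul, neg_neg, mul_comm]
  simp only [mul_xSum]
  simp only [xSum]
  rw [sum_comm]
  refine sum_congr rfl fun r _ => ?_
  rw [coeff_logSeries_leibniz κ _ (pw_mul s) (pw_mem s)]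
  simp only [pw_genCoeff]
  rw [← sum_Sp_reindex (κ s) r fun b => PowerSeries.coeff b (geomSeries κ), mul_sum, mul_sum]
  exact sum_congr rfl fun a _ => by ring

/-- The generating series of S(x+y) and S(-x-y) are inverse, so their convolution in degree i + l >
0 is zero. A_{i,l} is its part m ≤ l and the left side is its part m > l; i ≤ N ensures that nothing
is cut off. -/
lemma sum_Sp_mul_Smz {i N : ℕ} (hi : 1 ≤ i) (hN : i ≤ N) (l : ℕ) :
    ∑ M ∈ range (N + 1), Sp (l + 1 + M) * Smz ((i : ℤ) - 1 - M) = -A i l := by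
  have h := sum_Sp_mul_Sm (i + l)
  rw [if_neg (by omega), Finset.Nat.sum_antidiagonal_eq_sum_range_succ_mk] at h
  have h1 : ∑ m ∈ range (l + 1 + (N + 1)), Spz m * Smz (i + l - m) = 0 := by
    rw [← h, ← sum_subset (range_subset_range.2 (by omega : (i + l).succ ≤ l + 1 + (N + 1)))]
    · refine sum_congr rfl fun m hm => ?_
      have := mem_range.1 hm
      rw [Spz_natCast, ← Smz_natCast]
      congr 2
      omega
    · intro m _ hm
      simp only [mem_range] at hm
      rw [Smz_of_neg (by omega), mul_zero]
  rw [sum_range_add, ← A_eq] at h1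
  rw [eq_neg_iff_add_eq_zero, add_comm, ← h1]
  refine congrArg _ (sum_congr rfl fun M _ => ?_)
  rw [Spz_natCast]
  congr 2
  push_cast
  ring

lemma mul_mul_xSum (a b : W) (N : ℕ) (H : ℕ → W) (t : W) :
    b * xSum N (fun r => H r * (a * t)) = a * (b * xSum N fun r => H r * t) := by
  have h : (fun r => H r * (a * t)) = fun r => a * (H r * t) :=
    funext fun r => mul_left_comm (H r) a t
  rw [h, ← mul_xSum, mul_left_comm]

lemma phiStarTrunc_affine_mul_eq (s : Fin 2) (i N : ℕ) (h : W) (j : ℕ) :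
    phiStarTrunc κ s N (affine κ i * h) (j + 1) = affine κ i * phiStarTrunc κ s N h j
      - MvPowerSeries.C (∑ M ∈ range (N + 1), Sp (κ s + 1 + M) * Smz ((i : ℤ) - 1 - M))
        * (h * tauTrunc κ N) := by
  have h2 : ∀ M : ℕ, MvPowerSeries.C (Sp (κ s + 1 + M)) *
      heisenberg κ N (affine κ i * h) (j + 1) M
      = affine κ i * (MvPowerSeries.C (Sp (κ s + 1 + M)) * heisenberg κ N h j M)
        - MvPowerSeries.C (Sp (κ s + 1 + M) * Smz ((i : ℤ) - 1 - M)) * (h * tauTrunc κ N) := by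
    intro M
    rw [heisenberg_affine_mul, map_mul]
    ring
  rw [phiStarTrunc, phiStarTrunc, mul_add, mul_sum, mul_sum, add_sub_assoc, map_sum, sum_mul,
    ← sum_sub_distrib, mul_assoc (affine κ i)]
  exact congrArg₂ _ (sum_congr rfl fun a _ => mul_mul_xSum _ _ _ _ _)
    (sum_congr rfl fun M _ => h2 M)

/-- The correction A_{i,κ_s} is minus the derivative of α_i with respect to w_s, so φ* obeys the
product rule of -∂/∂w_s. -/
lemma phiStarTrunc_affine_mul (s : Fin 2) {i N : ℕ} (hi : 1 ≤ i) (hN : i ≤ N) (h : W) (j : ℕ)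
    (hj : phiStarTrunc κ s N h j = -pw s (h * tauTrunc κ N)) :
    phiStarTrunc κ s N (affine κ i * h) (j + 1) = -pw s (affine κ i * h * tauTrunc κ N) := by
  rw [phiStarTrunc_affine_mul_eq, sum_Sp_mul_Smz hi hN, hj, mul_assoc, pw_mul s (affine κ i),
    pw_affine, map_neg, neg_mul, sub_neg_eq_add, mul_neg, neg_add, neg_neg, add_comm]

lemma phiStarTrunc_eq (s : Fin 2) {i j N : ℕ} (hi : 1 ≤ i) (hj : 1 ≤ j) (hiN : i ≤ N)
    (hjN : j ≤ N) (m n : ℕ) :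
    phiStarTrunc κ s N (affine κ i ^ m * affine κ j ^ n) (m + n)
      = -pw s (affine κ i ^ m * affine κ j ^ n * tauTrunc κ N) := by
  induction m with
  | succ m ih =>
    rw [pow_succ', mul_assoc (affine κ i), show m + 1 + n = m + n + 1 by ring]
    exact phiStarTrunc_affine_mul κ s hi hiN _ _ ih
  | zero =>
    rw [pow_zero, one_mul, zero_add]
    induction n with
    | zero => exact phiStarTrunc_one κ s N
    | succ n ih =>
      rw [pow_succ']
      exact phiStarTrunc_affine_mul κ s hj hjN _ _ ih

end Affine

/-! ### Modes of φ and φ* on the coefficients of the tau function -/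

lemma coeff_formalSum {ι σ R : Type*} [Semiring R] (u : ι → MvPowerSeries σ R) (d : σ →₀ ℕ)
    (s : Finset ι) (hs : ∀ i, i ∉ s → MvPowerSeries.coeff d (u i) = 0) :
    MvPowerSeries.coeff d (formalSum u) = ∑ i ∈ s, MvPowerSeries.coeff d (u i) := by
  refine finsum_eq_sum_of_support_subset (f := fun n => MvPowerSeries.coeff d (u n)) ?_
  intro i hi
  by_contra h
  exact hi (hs i h)

section Modes

variable (l k : ℕ)

lemma coeff_mul_f {N : ℕ} {e : Fin 2 →₀ ℕ} (he : e.degree * genDeg ![l, k] ≤ N) (h : W) :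
    MvPowerSeries.coeff e (h * f l k) = MvPowerSeries.coeff e (h * tauTrunc ![l, k] N) := by
  classical
  rw [MvPowerSeries.coeff_mul, MvPowerSeries.coeff_mul]
  refine sum_congr rfl fun p hp => ?_
  have hd : p.1.degree + p.2.degree = e.degree := by
    rw [← HasAntidiagonal.mem_antidiagonal.1 hp, map_add]
  rw [coeff_f l k N p.2 (le_trans (Nat.mul_le_mul_right _ (by omega)) he)]

lemma cw_Dp_f {h : W} (hh : h ∈ invariantsW) (r : ℕ) :
    cw (Dp r) (h * f l k) = PowerSeries.coeff r (1 - genSeries ![l, k]) * (h * f l k) := by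
  ext e : 1
  rw [coeff_cw, coeff_mul_f l k (le_max_right r _), ← coeff_cw, cw_Dp_invariant_mul hh,
    cw_Dp_tauTrunc _ (le_max_left _ _), mul_left_comm h, ← mul_assoc, ← mul_assoc,
    coeff_mul_f l k (le_max_right r _)]

lemma cw_Dm_f {h : W} (hh : h ∈ invariantsW) (r : ℕ) :
    cw (Dm r) (h * f l k) = PowerSeries.coeff r (geomSeries ![l, k]) * (h * f l k) := by
  ext e : 1
  rw [coeff_cw, coeff_mul_f l k (le_max_right r _), ← coeff_cw, cw_Dm_invariant_mul hh,
    cw_Dm_tauTrunc _ (le_max_left _ _), mul_left_comm h, ← mul_assoc, ← mul_assoc,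
    coeff_mul_f l k (le_max_right r _)]

/-- Coefficient of z^{i-1} in exp(-∑ (x_n + y_n) zⁿ)(1 - G): the constant 1 yields S_{i-1}(-x-y),
and reversing the order of summation in the part linear in w_t yields A_{i,κ_t}. -/
lemma sum_Sm_mul_one_sub_genSeries (κ : Fin 2 → ℕ) (i : ℕ) (hi : 1 ≤ i) :
    ∑ b ∈ range (genDeg κ + 1), MvPowerSeries.C (Sm (b + (i - 1))) *
      PowerSeries.coeff b (1 - genSeries κ) = affine κ i := by
  rw [sum_range_succ', coeff_one_sub_genSeries, if_pos rfl, genCoeff_zero, sub_zero, mul_one,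
    affine, zero_add]
  have hi' : ((i : ℤ) - 1) = ((i - 1 : ℕ) : ℤ) := by omega
  rw [hi', Smz_natCast, sub_eq_add_neg (MvPowerSeries.C (Sm (i - 1)) : W), ← sum_neg_distrib,
    add_comm]
  congr 1
  have h1 : ∀ b : ℕ, MvPowerSeries.C (Sm (b + 1 + (i - 1))) *
      PowerSeries.coeff (b + 1) (1 - genSeries κ)
      = ∑ t, -(MvPowerSeries.C (Spz ((κ t : ℤ) - b) * Sm (b + i)) * MvPowerSeries.X t) := by
    intro b
    rw [coeff_one_sub_genSeries, if_neg (Nat.succ_ne_zero _), zero_sub,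
      genCoeff_of_ne κ (Nat.succ_ne_zero _), mul_neg, mul_sum, sum_neg_distrib]
    refine congrArg _ (sum_congr rfl fun t _ => ?_)
    rw [map_mul, show b + 1 + (i - 1) = b + i by omega,
      show ((κ t : ℤ) + 1 - ((b + 1 : ℕ) : ℤ)) = (κ t : ℤ) - b by push_cast; ring]
    ring
  simp only [h1]
  rw [sum_comm]
  refine sum_congr rfl fun t _ => ?_
  rw [sum_neg_distrib, ← sum_mul, ← map_sum]
  congr 3
  have hle : κ t + 1 ≤ genDeg κ := by
    have : κ t ≤ κ 0 + κ 1 := by fin_cases t <;> simp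
    unfold genDeg
    omega
  rw [← sum_subset (range_subset_range.2 hle)]
  · rw [← sum_range_reflect]
    refine sum_congr rfl fun m hm => ?_
    have := mem_range.1 hm
    rw [show ((κ t : ℤ) - ((κ t + 1 - 1 - m : ℕ) : ℤ)) = (m : ℤ) by omega, Spz_natCast]
    congr 2
    omega
  · intro b _ hb
    simp only [mem_range] at hb
    rw [Spz_of_neg (by omega), zero_mul]

/-- The action of `φ_{-i}` on the coefficients of an invariant multiple of the tau function. -/
lemma phi_coeff {h : W} (hh : h ∈ invariantsW) {i : ℕ} (hi : 1 ≤ i) (e : Fin 2 →₀ ℕ) :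
    formalSum (fun ab : ℕ × ℕ => if (ab.1 : ℤ) - ab.2 = -(-(i : ℤ)) - 1 then
      Sm ab.1 * Dp ab.2 (MvPowerSeries.coeff e (h * f l k)) else 0)
      = MvPowerSeries.coeff e (affine ![l, k] i * (h * f l k)) := by
  refine HasFormalSum.formalSum_eq ?_
  have hinj : Function.Injective fun b : ℕ => (b + (i - 1), b) := fun a b hab => by
    simpa using (Prod.ext_iff.1 hab).2
  refine HasFormalSum.of_injective hinj ?_ ?_
  · rintro ⟨a, b⟩ hab
    rw [if_neg]
    intro h0
    refine hab ⟨b, ?_⟩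
    ext
    · simp only at h0 ⊢; omega
    · rfl
  · have h1 : ∀ b : ℕ, (if (((b + (i - 1), b) : ℕ × ℕ).1 : ℤ) - ((b + (i - 1), b) : ℕ × ℕ).2
        = -(-(i : ℤ)) - 1 then Sm ((b + (i - 1), b) : ℕ × ℕ).1 *
          Dp ((b + (i - 1), b) : ℕ × ℕ).2 (MvPowerSeries.coeff e (h * f l k)) else 0)
        = MvPowerSeries.coeff e (MvPowerSeries.C (Sm (b + (i - 1))) *
          PowerSeries.coeff b (1 - genSeries ![l, k]) * (h * f l k)) := by
      intro b
      rw [if_pos (by simp only; push_cast; omega), mul_assoc, MvPowerSeries.coeff_C_mul,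
        ← cw_Dp_f l k hh, coeff_cw]
    simp only [h1]
    rw [← sum_Sm_mul_one_sub_genSeries _ i hi, sum_mul, map_sum]
    refine hasFormalSum_of_finset _ fun b hb => ?_
    have : PowerSeries.coeff b (1 - genSeries ![l, k]) = 0 := by
      rw [coeff_one_sub_genSeries, if_neg (by simp at hb; omega), zero_sub, neg_eq_zero]
      ext e : 1
      rw [coeff_genCoeff_eq_zero _ (by simp at hb; omega), map_zero]
    rw [this, mul_zero, zero_mul, map_zero]

lemma alphaMode_neg (c : ℤ) (t : ℕ) (ht : 1 ≤ t) (g : V) :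
    alphaMode c (-(t : ℤ)) g = (t • x t) * g := by
  have h1 : (-(-(t : ℤ))).toNat = t := by omega
  rw [alphaMode, if_neg (by omega), if_pos (by omega), h1]
  rfl

lemma alphaMode_natCast (c : ℤ) (n : ℕ) (hn : n ≠ 0) (g : V) :
    alphaMode c n g = dx n g := by
  rw [alphaMode, if_pos (by omega), Int.toNat_natCast]

lemma alphaMode_zero (c : ℤ) (g : V) : alphaMode c 0 g = (c : ℂ) • g := by
  rw [alphaMode, if_neg (by omega), if_neg (by omega)]
  rfl

lemma coeff_xSum (N : ℕ) (H : ℕ → W) (e : Fin 2 →₀ ℕ) : MvPowerSeries.coeff e (xSum N H)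
    = ∑ r ∈ range (N + 1), (r • x r) * MvPowerSeries.coeff e (H r) := by
  rw [xSum, map_sum]
  exact sum_congr rfl fun r _ => MvPowerSeries.coeff_C_mul _ _ _

lemma sum_range_alphaMode_neg {e : Fin 2 →₀ ℕ} (c : ℤ) {D N t : ℕ} (ht : 1 ≤ t) (hN : D + t ≤ N)
    (F : ℕ → W) (hF : ∀ b, D < b → MvPowerSeries.coeff e (F b) = 0) :
    ∑ b ∈ range (D + 1), alphaMode c (-(t : ℤ) - b) (MvPowerSeries.coeff e (F b))
      = MvPowerSeries.coeff e (xSum N fun r => if t ≤ r then F (r - t) else 0) := by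
  rw [coeff_xSum, ← sum_subset (range_subset_range.2 (by omega : t + (D + 1) ≤ N + 1)),
    sum_range_add _ t (D + 1), sum_eq_zero (s := range t), zero_add]
  · refine sum_congr rfl fun b _ => ?_
    rw [if_pos (by omega), Nat.add_sub_cancel_left,
      show (-(t : ℤ) - b) = -((t + b : ℕ) : ℤ) by push_cast; ring, alphaMode_neg _ _ (by omega)]
  · intro r hr
    have := mem_range.1 hr
    rw [if_neg (by omega), map_zero, mul_zero]
  · intro r _ hr
    simp only [mem_range] at hr
    rw [if_pos (by omega), hF _ (by omega), mul_zero]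

/-- At the exponent e the Euler operator is multiplication by |e|, so α_0 on charge |e| - j is the
Euler operator minus j. -/
lemma sum_range_alphaMode_nonneg (κ : Fin 2 → ℕ) {e : Fin 2 →₀ ℕ} {D N : ℕ} (hN : D ≤ N)
    (M : ℕ) (h : W) (j : ℕ)
    (hF : ∀ b, D < b → MvPowerSeries.coeff e
      (PowerSeries.coeff b (geomSeries κ) * (h * tauTrunc κ N)) = 0) :
    ∑ b ∈ range (D + 1), alphaMode ((e.degree : ℤ) - j) ((M : ℤ) - b) (MvPowerSeries.coeff e
      (PowerSeries.coeff b (geomSeries κ) * (h * tauTrunc κ N)))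
      = MvPowerSeries.coeff e (heisenberg κ N h j M) := by
  set F : ℕ → W := fun b => PowerSeries.coeff b (geomSeries κ) * (h * tauTrunc κ N) with hFdef
  have h1 : ∑ b ∈ range (D + 1), alphaMode ((e.degree : ℤ) - j) ((M : ℤ) - b)
      (MvPowerSeries.coeff e (F b))
      = ∑ b ∈ range (M + 1 + N), alphaMode ((e.degree : ℤ) - j) ((M : ℤ) - b)
      (MvPowerSeries.coeff e (F b)) := by
    refine sum_subset (range_subset_range.2 (by omega)) fun b _ hb => ?_
    simp only [mem_range] at hb
    rw [hF b (by omega), map_zero]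
  change ∑ b ∈ range (D + 1), alphaMode ((e.degree : ℤ) - j) ((M : ℤ) - b)
    (MvPowerSeries.coeff e (F b)) = _
  rw [h1, sum_range_add, heisenberg, map_add]
  congr 1
  · rw [map_sum, ← Finset.Nat.sum_antidiagonal_swap,
      Finset.Nat.sum_antidiagonal_eq_sum_range_succ_mk]
    refine sum_congr rfl fun b hb => ?_
    have := mem_range.1 hb
    simp only [Prod.fst_swap, Prod.snd_swap]
    by_cases hbM : M - b = 0
    · rw [hbM, if_pos rfl, DD_zero, map_sub, coeff_euler, coeff_smul', ← sub_smul,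
        show ((M : ℤ) - b) = 0 by omega, alphaMode_zero]
      push_cast
      rfl
    · rw [if_neg hbM, sub_zero, DD_of_ne hbM, coeff_cw,
        show ((M : ℤ) - b) = ((M - b : ℕ) : ℤ) by omega, alphaMode_natCast _ _ hbM]
  · rw [coeff_xSum, sum_range_succ', zero_smul, zero_mul, add_zero]
    refine sum_congr rfl fun r _ => ?_
    rw [show ((M : ℤ) - ((M + 1 + r : ℕ) : ℤ)) = -((r + 1 : ℕ) : ℤ) by push_cast; ring,
      alphaMode_neg _ _ (by omega), show M + (r + 1) = M + 1 + r by ring]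

lemma coeff_geomSeries_mul_eq_zero (κ : Fin 2 → ℕ) {b : ℕ} {e : Fin 2 →₀ ℕ}
    (hb : e.degree * genDeg κ < b) (h : W) :
    MvPowerSeries.coeff e (PowerSeries.coeff b (geomSeries κ) * h) = 0 := by
  classical
  rw [MvPowerSeries.coeff_mul]
  refine sum_eq_zero fun p hp => ?_
  have hd : p.1.degree + p.2.degree = e.degree := by
    rw [← HasAntidiagonal.mem_antidiagonal.1 hp, map_add]
  rw [coeff_geomSeries_eq_zero κ (lt_of_le_of_lt (Nat.mul_le_mul_right _ (by omega)) hb), zero_mul]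

/-- The action of `φ*_{-κ s}`, `κ = (l, k)`, on the coefficients of products of affine functions
with the tau function. -/
lemma phiStar_coeff (s : Fin 2) {i j : ℕ} (hi : 1 ≤ i) (hj : 1 ≤ j) (m n : ℕ)
    (e : Fin 2 →₀ ℕ) :
    formalSum (fun ab : ℕ × ℕ => Sp ab.1 * alphaMode ((e.degree : ℤ) - (m + n : ℕ))
      ((ab.1 : ℤ) - ab.2 - 1 + -((![l, k] s : ℕ) : ℤ)) (Dm ab.2 (MvPowerSeries.coeff e
        (affine ![l, k] i ^ m * affine ![l, k] j ^ n * f l k))))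
      = -MvPowerSeries.coeff e
        (pw s (affine ![l, k] i ^ m * affine ![l, k] j ^ n * f l k)) := by
  set κ : Fin 2 → ℕ := ![l, k] with hκ
  set h : W := affine κ i ^ m * affine κ j ^ n with hh
  have hinv : h ∈ invariantsW :=
    mul_mem (pow_mem (affine_mem κ i) m) (pow_mem (affine_mem κ j) n)
  ext d
  set D := e.degree * genDeg κ with hD
  -- D bounds the indices b for which Q_b contributes at e. In N, the summand `genDeg κ` pays for
  -- ∂/∂w_s, which reads f one degree higher; `wt d` ensures that every S_a contributing at d is
  -- included; i and j are needed for `phiStarTrunc_eq`.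
  set N := D + genDeg κ + κ s + 1 + wt d + i + j with hN
  have hDm : ∀ b, Dm b (MvPowerSeries.coeff e (h * f l k)) = MvPowerSeries.coeff e
      (PowerSeries.coeff b (geomSeries κ) * (h * tauTrunc κ N)) := by
    intro b
    rw [← coeff_cw, cw_Dm_f l k hinv]
    have := coeff_mul_f l k (show D ≤ N by omega) (PowerSeries.coeff b (geomSeries κ) * h)
    rw [mul_assoc _ h, mul_assoc _ h] at this
    exact this
  have hz : ∀ b, D < b → MvPowerSeries.coeff e
      (PowerSeries.coeff b (geomSeries κ) * (h * tauTrunc κ N)) = 0 :=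
    fun b hb => coeff_geomSeries_mul_eq_zero κ hb _
  rw [coeff_formalSum _ d (range (κ s + 1 + (N + 1)) ×ˢ range (D + 1)), sum_product]
  swap
  · rintro ⟨a, b⟩ hab
    simp only [mem_product, mem_range, not_and_or, not_lt] at hab
    rcases hab with hab | hab
    · exact coeff_Sp_mul_eq_zero (by omega) _
    · simp only
      rw [hDm, hz b (by omega), map_zero, mul_zero, map_zero]
  have hpw : MvPowerSeries.coeff e (pw s (h * f l k))
      = MvPowerSeries.coeff e (pw s (h * tauTrunc κ N)) := by
    rw [pw_apply, pw_apply, MvPowerSeries.coeff_pderiv, MvPowerSeries.coeff_pderiv,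
      coeff_mul_f l k (N := N)]
    rw [map_add, Finsupp.degree_single, add_mul, one_mul, ← hκ]
    omega
  rw [hpw, ← map_neg, ← phiStarTrunc_eq κ s hi hj (by omega) (by omega), phiStarTrunc, map_add,
    sum_range_add, ← hh, map_add, map_sum, map_sum, map_sum, map_sum]
  congr 1
  · refine sum_congr rfl fun a ha => ?_
    have := mem_range.1 ha
    rw [MvPowerSeries.coeff_C_mul, ← map_sum]
    dsimp only
    rw [← mul_sum]
    congr 2
    have hF : (fun r => (if κ s + 1 - a ≤ r then
        PowerSeries.coeff (r - (κ s + 1 - a)) (geomSeries κ) else 0) * (h * tauTrunc κ N))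
        = fun r => if κ s + 1 - a ≤ r then
        PowerSeries.coeff (r - (κ s + 1 - a)) (geomSeries κ) * (h * tauTrunc κ N) else 0 := by
      funext r
      split_ifs <;> simp
    rw [hF, ← sum_range_alphaMode_neg ((e.degree : ℤ) - (m + n : ℕ)) (D := D) (by omega)
      (by omega) (fun b => PowerSeries.coeff b (geomSeries κ) * (h * tauTrunc κ N)) hz]
    refine sum_congr rfl fun b _ => ?_
    rw [hDm]
    congr 1
    congr 1
    omega
  · refine sum_congr rfl fun M _ => ?_
    rw [MvPowerSeries.coeff_C_mul, ← map_sum]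
    dsimp only
    rw [← mul_sum]
    congr 2
    rw [← sum_range_alphaMode_nonneg κ (by omega : D ≤ N) M h (m + n) hz]
    refine sum_congr rfl fun b _ => ?_
    rw [hDm]
    congr 1
    congr 1
    push_cast
    ring

end Modes

/-! ### Continuous operators -/

/-- The algebra of operators each of whose output coefficients depends on finitely many input
coefficients. -/
def continuousOps : Subalgebra ℂ (Module.End ℂ V) where
  carrier := {T | CoeffContinuous T.toAddMonoidHom}
  mul_mem' ha hb := CoeffContinuous.comp ha hb
  add_mem' {a b} ha hb := by
    classical
    intro d
    obtain ⟨S, hS⟩ := ha d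
    obtain ⟨S', hS'⟩ := hb d
    refine ⟨S ∪ S', fun g hg => ?_⟩
    change MvPowerSeries.coeff d (a g + b g) = 0
    have h1 := hS g fun e he => hg e (mem_union_left _ he)
    have h2 := hS' g fun e he => hg e (mem_union_right _ he)
    rw [map_add]
    exact (congrArg₂ _ h1 h2).trans (add_zero _)
  algebraMap_mem' c d := by
    refine ⟨{d}, fun g hg => ?_⟩
    change MvPowerSeries.coeff d (c • g) = 0
    rw [coeff_smul', hg d (mem_singleton_self _), smul_zero]

lemma mulLeft_mem (g : V) : LinearMap.mulLeft ℂ g ∈ continuousOps :=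
  coeffContinuous_mulLeft g

lemma pderiv_mem (v : Var) :
    ((MvPowerSeries.pderiv ℂ v).toLinearMap : Module.End ℂ V) ∈ continuousOps := by
  intro d
  refine ⟨{d + Finsupp.single v 1}, fun g hg => ?_⟩
  change MvPowerSeries.coeff d (MvPowerSeries.pderiv ℂ v g) = 0
  rw [MvPowerSeries.coeff_pderiv, hg _ (mem_singleton_self _), zero_mul]

lemma dx_mem (n : ℕ) : dx n ∈ continuousOps := by
  cases n with
  | zero => exact zero_mem _
  | succ n => exact pderiv_mem _

lemma dy_mem (n : ℕ) : dy n ∈ continuousOps := by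
  cases n with
  | zero => exact zero_mem _
  | succ n => exact pderiv_mem _

lemma dd_mem (n : ℕ) : dd n ∈ continuousOps := sub_mem (dx_mem n) (dy_mem n)

lemma Dp_mem (r : ℕ) : Dp r ∈ continuousOps := by
  induction r using Nat.strong_induction_on with
  | _ r ih =>
    by_cases hr : r = 0
    · subst hr; rw [Dp_zero]; exact one_mem _
    have hr' : (r : ℂ) ≠ 0 := by exact_mod_cast hr
    have h : Dp r = (r : ℂ)⁻¹ • ((r : ℂ) • Dp r) := by
      rw [smul_smul, inv_mul_cancel₀ hr', one_smul]
    rw [h, Dp_newton]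
    refine Subalgebra.smul_mem _ (sum_mem fun p hp => ?_) _
    have hp' := HasAntidiagonal.mem_antidiagonal.1 hp
    by_cases h0 : p.1 = 0
    · have : dd p.1 = 0 := by rw [h0]; simp [dd, dx, dy]
      rw [this, zero_mul]; exact zero_mem _
    · exact mul_mem (dd_mem _) (ih _ (by omega))

lemma Dm_mem (r : ℕ) : Dm r ∈ continuousOps := by
  induction r using Nat.strong_induction_on with
  | _ r ih =>
    by_cases hr : r = 0
    · subst hr; rw [Dm_zero]; exact one_mem _
    have hr' : (r : ℂ) ≠ 0 := by exact_mod_cast hr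
    have h : Dm r = (r : ℂ)⁻¹ • ((r : ℂ) • Dm r) := by
      rw [smul_smul, inv_mul_cancel₀ hr', one_smul]
    rw [h, Dm_newton]
    refine Subalgebra.smul_mem _ (neg_mem (sum_mem fun p hp => ?_)) _
    have hp' := HasAntidiagonal.mem_antidiagonal.1 hp
    by_cases h0 : p.1 = 0
    · have : dd p.1 = 0 := by rw [h0]; simp [dd, dx, dy]
      rw [this, zero_mul]; exact zero_mem _
    · exact mul_mem (dd_mem _) (ih _ (by omega))

lemma alphaMode_mem (c n : ℤ) : alphaMode c n ∈ continuousOps := by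
  unfold alphaMode
  split_ifs
  · exact dx_mem _
  · exact mulLeft_mem _
  · exact Subalgebra.smul_mem _ (one_mem _) _

/-- A family of operators is locally finite if each output coefficient is nonzero for finitely
many of them only. -/
def LocallyFiniteOps {ι : Type*} (T : ι → Module.End ℂ V) : Prop :=
  ∀ d : Var →₀ ℕ, ∃ s : Finset ι, ∀ i, i ∉ s → ∀ g, MvPowerSeries.coeff d (T i g) = 0

lemma LocallyFiniteOps.hasFormalSum {ι : Type*} {T : ι → Module.End ℂ V}
    (hT : LocallyFiniteOps T) (g : V) :
    HasFormalSum (fun i => T i g) (formalSum fun i => T i g) := by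
  refine hasFormalSum_formalSum fun d => ?_
  obtain ⟨s, hs⟩ := hT d
  refine s.finite_toSet.subset fun i hi => ?_
  by_contra h
  exact hi (hs i h g)

/-- The sum of a locally finite family of operators. -/
def sumOps {ι : Type*} (T : ι → Module.End ℂ V) (hT : LocallyFiniteOps T) : Module.End ℂ V where
  toFun g := formalSum fun i => T i g
  map_add' a b := by
    have := (hT.hasFormalSum a).add (hT.hasFormalSum b)
    simp only [← map_add] at this
    exact this.formalSum_eq
  map_smul' c a := by
    have := (hT.hasFormalSum a).mul_left (MvPowerSeries.C c)
    simp only [← MvPowerSeries.smul_eq_C_mul, ← map_smul] at this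
    exact this.formalSum_eq

lemma sumOps_mem {ι : Type*} {T : ι → Module.End ℂ V} (hT : LocallyFiniteOps T)
    (h : ∀ i, T i ∈ continuousOps) : sumOps T hT ∈ continuousOps := by
  classical
  intro d
  obtain ⟨s, hs⟩ := hT d
  choose S hS using fun i => (h i : CoeffContinuous (T i).toAddMonoidHom) d
  refine ⟨s.biUnion S, fun g hg => ?_⟩
  change MvPowerSeries.coeff d (formalSum fun i => T i g) = 0
  rw [coeff_formalSum _ d s fun i hi => hs i hi g]
  exact sum_eq_zero fun i hi => hS i g fun e he => hg e (mem_biUnion.2 ⟨i, hi, he⟩)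

/-- The summands of `phi i`. -/
def phiTerm (i : ℤ) (ab : ℕ × ℕ) : Module.End ℂ V :=
  if (ab.1 : ℤ) - ab.2 = -i - 1 then LinearMap.mulLeft ℂ (Sm ab.1) * Dp ab.2 else 0

/-- The summands of `phiStar i` on the component of charge `c`. -/
def phiStarTerm (i c : ℤ) (ab : ℕ × ℕ) : Module.End ℂ V :=
  LinearMap.mulLeft ℂ (Sp ab.1) * alphaMode c ((ab.1 : ℤ) - ab.2 - 1 + i) * Dm ab.2

lemma phiTerm_apply (i : ℤ) (ab : ℕ × ℕ) (g : V) : phiTerm i ab g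
    = if (ab.1 : ℤ) - ab.2 = -i - 1 then Sm ab.1 * Dp ab.2 g else 0 := by
  unfold phiTerm
  split_ifs <;> rfl

lemma phiTerm_locallyFinite (i : ℤ) : LocallyFiniteOps (phiTerm i) := by
  intro d
  refine ⟨range (wt d + 1) ×ˢ range (wt d + i.natAbs + 2), ?_⟩
  rintro ⟨a, b⟩ hab g
  simp only [mem_product, mem_range, not_and_or, not_lt] at hab
  rw [phiTerm_apply]
  split_ifs with h
  · simp only at h
    exact coeff_Sm_mul_eq_zero (by omega) _
  · exact map_zero _

/-- S_a has weight a, which bounds a. For such a and large b the Heisenberg index is some -t with t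
large, and the mode is multiplication by t x_t, of weight t. -/
lemma phiStarTerm_locallyFinite (i c : ℤ) : LocallyFiniteOps (phiStarTerm i c) := by
  intro d
  refine ⟨range (wt d + 1) ×ˢ range (2 * wt d + i.natAbs + 2), ?_⟩
  rintro ⟨a, b⟩ hab g
  simp only [mem_product, mem_range, not_and_or, not_lt] at hab
  change MvPowerSeries.coeff d (Sp a * alphaMode c ((a : ℤ) - b - 1 + i) (Dm b g)) = 0
  by_cases ha : wt d < a
  · exact coeff_Sp_mul_eq_zero ha _
  · obtain ⟨t, ht⟩ : ∃ t : ℕ, ((a : ℤ) - b - 1 + i) = -(t : ℤ) := ⟨(-((a : ℤ) - b - 1 + i)).toNat,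
      by omega⟩
    rw [ht, alphaMode_neg c t (by omega), mul_left_comm]
    have hx : t • x t ∈ wtFiltration.I t := by
      rw [← Nat.cast_smul_eq_nsmul ℂ]
      exact Submodule.smul_mem _ _ (x_mem t)
    exact wtFiltration.mul_mem hx (wtFiltration.mem_zero _) d (by omega)

/-- The operator `φ_i` on each component of fixed charge. -/
def phiOp (i : ℤ) : Module.End ℂ V := sumOps _ (phiTerm_locallyFinite i)

/-- The operator `φ*_i` on the component of charge `c`. -/
def phiStarOp (i c : ℤ) : Module.End ℂ V := sumOps _ (phiStarTerm_locallyFinite i c)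

lemma phiOp_mem (i : ℤ) : phiOp i ∈ continuousOps := by
  refine sumOps_mem _ fun ab => ?_
  unfold phiTerm
  split_ifs
  · exact mul_mem (mulLeft_mem _) (Dp_mem _)
  · exact zero_mem _

lemma phiStarOp_mem (i c : ℤ) : phiStarOp i c ∈ continuousOps :=
  sumOps_mem _ fun _ => mul_mem (mul_mem (mulLeft_mem _) (alphaMode_mem _ _)) (Dm_mem _)

lemma phi_apply (i : ℤ) (v : B) (m : ℤ) : phi i v m = phiOp i (v (m + 1)) := by
  change _ = formalSum fun ab => phiTerm i ab (v (m + 1))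
  simp only [phiTerm_apply]
  rfl

lemma phiStar_apply (i : ℤ) (v : B) (m : ℤ) :
    phiStar i v m = phiStarOp i (m - 1) (v (m - 1)) := rfl

/-! ### Action on the coefficients of the tau function -/

/-- The exponent `(r, s)`. -/
def expo (r s : ℕ) : Fin 2 →₀ ℕ := Finsupp.single 0 r + Finsupp.single 1 s

lemma expo_zero_apply (r s : ℕ) : expo r s 0 = r := by simp [expo]

lemma expo_one_apply (r s : ℕ) : expo r s 1 = s := by simp [expo]

lemma degree_expo (r s : ℕ) : (expo r s).degree = r + s := by
  rw [expo, map_add, Finsupp.degree_single, Finsupp.degree_single]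

lemma expo_add_zero (r s : ℕ) : expo r s + Finsupp.single 0 1 = expo (r + 1) s := by
  rw [expo, expo, Finsupp.single_add]; abel

lemma expo_add_one (r s : ℕ) : expo r s + Finsupp.single 1 1 = expo r (s + 1) := by
  rw [expo, expo, Finsupp.single_add]; abel

/-- Pairs of natural numbers as exponents. -/
def expoEquiv : ℕ × ℕ ≃ (Fin 2 →₀ ℕ) where
  toFun p := expo p.1 p.2
  invFun e := (e 0, e 1)
  left_inv p := by
    ext
    · exact expo_zero_apply _ _
    · exact expo_one_apply _ _
  right_inv e := by
    ext t
    fin_cases t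
    · exact expo_zero_apply _ _
    · exact expo_one_apply _ _

section Modes

variable (l k i j : ℕ)

/-- The coefficient at `w₁ ^ r w₂ ^ s` of `α_i ^ m α_j ^ n f`, where `α_i` and `α_j` are the affine
functions describing `φ_{-i}` and `φ_{-j}`. -/
def tauCoeff (m n r s : ℕ) : V :=
  MvPowerSeries.coeff (expo r s) (affine ![l, k] i ^ m * affine ![l, k] j ^ n * f l k)

variable {i j}

lemma phiOp_tauCoeff_left (hi : 1 ≤ i) (m n r s : ℕ) :
    phiOp (-(i : ℤ)) (tauCoeff l k i j m n r s) = tauCoeff l k i j (m + 1) n r s := by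
  change formalSum (fun ab => phiTerm _ ab _) = _
  simp only [phiTerm_apply]
  rw [tauCoeff, phi_coeff l k (mul_mem (pow_mem (affine_mem _ i) m) (pow_mem (affine_mem _ j) n)) hi,
    tauCoeff, pow_succ', mul_assoc, mul_assoc, mul_assoc]

lemma phiOp_tauCoeff_right (hj : 1 ≤ j) (m n r s : ℕ) :
    phiOp (-(j : ℤ)) (tauCoeff l k i j m n r s) = tauCoeff l k i j m (n + 1) r s := by
  change formalSum (fun ab => phiTerm _ ab _) = _
  simp only [phiTerm_apply]
  rw [tauCoeff, phi_coeff l k (mul_mem (pow_mem (affine_mem _ i) m) (pow_mem (affine_mem _ j) n)) hj,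
    tauCoeff, pow_succ', ← mul_assoc, mul_left_comm]

lemma phiStarOp_tauCoeff_zero (hi : 1 ≤ i) (hj : 1 ≤ j) {c : ℤ} (m n r s : ℕ)
    (hc : c = (r + s : ℕ) - (m + n : ℕ)) :
    phiStarOp (-(l : ℤ)) c (tauCoeff l k i j m n r s)
      = -((r : ℂ) + 1) • tauCoeff l k i j m n (r + 1) s := by
  have := phiStar_coeff l k 0 hi hj m n (expo r s)
  rw [degree_expo, ← hc] at this
  refine this.trans ?_
  rw [pw_apply, MvPowerSeries.coeff_pderiv, expo_zero_apply, expo_add_zero, neg_smul, tauCoeff,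
    MvPowerSeries.smul_eq_C_mul, mul_comm]
  simp

lemma phiStarOp_tauCoeff_one (hi : 1 ≤ i) (hj : 1 ≤ j) {c : ℤ} (m n r s : ℕ)
    (hc : c = (r + s : ℕ) - (m + n : ℕ)) :
    phiStarOp (-(k : ℤ)) c (tauCoeff l k i j m n r s)
      = -((s : ℂ) + 1) • tauCoeff l k i j m n r (s + 1) := by
  have := phiStar_coeff l k 1 hi hj m n (expo r s)
  rw [degree_expo, ← hc] at this
  refine this.trans ?_
  rw [pw_apply, MvPowerSeries.coeff_pderiv, expo_one_apply, expo_add_one, neg_smul, tauCoeff,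
    MvPowerSeries.smul_eq_C_mul, mul_comm]
  simp

lemma tauCoeff_zero : tauCoeff l k i j 0 0 0 0 = 1 := by
  have h : expo 0 0 = 0 := by simp [expo]
  rw [tauCoeff, h, pow_zero, pow_zero, one_mul, one_mul]
  change ∑ j ∈ range ((0 : Fin 2 →₀ ℕ).degree + 1), _ = _
  simp

end Modes

/-! ### Weights of the coefficients -/

/-- The series in `w₁, w₂` whose coefficient at `e` has weight at least the degree of `e`. -/
def weighted : Subalgebra ℂ W where
  carrier := {F | ∀ e, MvPowerSeries.coeff e F ∈ wtFiltration.I e.degree}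
  mul_mem' {a b} ha hb e := by
    classical
    rw [MvPowerSeries.coeff_mul]
    refine sum_mem fun p hp => ?_
    have h := wtFiltration.mul_mem (ha p.1) (hb p.2)
    rwa [← map_add, HasAntidiagonal.mem_antidiagonal.1 hp] at h
  add_mem' ha hb e := by rw [map_add]; exact add_mem (ha e) (hb e)
  algebraMap_mem' c e := by
    classical
    rw [Algebra.algebraMap_eq_smul_one, coeff_smul', MvPowerSeries.coeff_one]
    split_ifs with h
    · rw [h, map_zero]; exact wtFiltration.mem_zero _
    · rw [smul_zero]; exact zero_mem _

lemma affine_weighted (κ : Fin 2 → ℕ) {i : ℕ} (hi : 1 ≤ i) : affine κ i ∈ weighted := by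
  classical
  refine sub_mem (fun e => ?_) (sum_mem fun t _ e => ?_)
  · rw [MvPowerSeries.coeff_C]
    split_ifs with h
    · rw [h, map_zero]; exact wtFiltration.mem_zero _
    · exact zero_mem _
  · rw [MvPowerSeries.coeff_C_mul, MvPowerSeries.coeff_X]
    split_ifs with h
    · rw [h, Finsupp.degree_single, mul_one]
      exact wtFiltration.anti (by omega) (A_mem i (κ t))
    · rw [mul_zero]; exact zero_mem _

/-- G starts at z⁻¹, so L_r has degree at most r in w, while x_r has weight r. -/
lemma xSum_weighted (κ : Fin 2 → ℕ) (N : ℕ) :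
    (xSum N fun r => PowerSeries.coeff r (logSeries κ)) ∈ weighted := by
  refine sum_mem fun r _ e => ?_
  rw [MvPowerSeries.coeff_C_mul]
  by_cases h : r < e.degree
  · rw [coeff_logSeries_eq_zero κ (Or.inl h), mul_zero]
    exact zero_mem _
  · have hx : r • x r ∈ wtFiltration.I r := by
      rw [← Nat.cast_smul_eq_nsmul ℂ]
      exact Submodule.smul_mem _ _ (x_mem r)
    have := wtFiltration.mul_mem hx (wtFiltration.mem_zero
      (MvPowerSeries.coeff e (PowerSeries.coeff r (logSeries κ))))
    exact wtFiltration.anti (by omega) this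

lemma f_weighted (l k : ℕ) : f l k ∈ weighted := by
  intro e
  rw [coeff_f l k _ e le_rfl]
  change ∑ j ∈ range (e.degree + 1), _ ∈ _
  exact sum_mem fun j _ => Submodule.smul_mem _ _
    (pow_mem (neg_mem (xSum_weighted ![l, k] _)) j e)

/-! ### Polynomials of bounded degree in `w₁, w₂` -/

lemma coeff_affine_pow_mul_eq_zero (κ : Fin 2 → ℕ) (i j m n : ℕ) {e : Fin 2 →₀ ℕ}
    (he : m + n < e.degree) :
    MvPowerSeries.coeff e (affine κ i ^ m * affine κ j ^ n) = 0 := by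
  classical
  have step : ∀ (i' : ℕ) (F : W) (d : ℕ),
      (∀ e : Fin 2 →₀ ℕ, d < e.degree → MvPowerSeries.coeff e F = 0) →
      ∀ e : Fin 2 →₀ ℕ, d + 1 < e.degree → MvPowerSeries.coeff e (affine κ i' * F) = 0 := by
    intro i' F d hF e he
    rw [MvPowerSeries.coeff_mul]
    refine sum_eq_zero fun p hp => ?_
    have hd : p.1.degree + p.2.degree = e.degree := by
      rw [← HasAntidiagonal.mem_antidiagonal.1 hp, map_add]
    by_cases h : d < p.2.degree
    · rw [hF _ h, mul_zero]
    · have h0 : MvPowerSeries.coeff p.1 (affine κ i') = 0 := by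
        rw [affine, map_sub, map_sum, MvPowerSeries.coeff_C, if_neg, zero_sub, neg_eq_zero]
        · refine sum_eq_zero fun t _ => ?_
          rw [MvPowerSeries.coeff_C_mul, MvPowerSeries.coeff_X, if_neg, mul_zero]
          intro h1
          rw [h1, Finsupp.degree_single] at hd
          omega
        · intro h1
          rw [h1, map_zero] at hd
          omega
      rw [h0, zero_mul]
  have h1 : ∀ n : ℕ, ∀ e : Fin 2 →₀ ℕ, n < e.degree →
      MvPowerSeries.coeff e (affine κ j ^ n) = 0 := by
    intro n
    induction n with
    | zero =>
      intro e he
      rw [pow_zero, MvPowerSeries.coeff_one, if_neg]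
      rintro rfl
      simp at he
    | succ n ih =>
      rw [pow_succ']
      exact step j _ n ih
  have h2 : ∀ m : ℕ, ∀ e : Fin 2 →₀ ℕ, m + n < e.degree →
      MvPowerSeries.coeff e (affine κ i ^ m * affine κ j ^ n) = 0 := by
    intro m
    induction m with
    | zero =>
      intro e he
      rw [pow_zero, one_mul]
      exact h1 n e (by omega)
    | succ m ih =>
      intro e he
      rw [pow_succ', mul_assoc]
      exact step i _ (m + n) ih e (by omega)
  exact h2 m e he

/-! ### The two-variable Lagrange inversion formula for affine functions -/

section Lagrange

variable (κ : Fin 2 → ℕ) (c d : ℂ) (i j : ℕ)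

/-- `(-c) ^ m (-d) ^ n` times the coefficient of `w₁ ^ m w₂ ^ n` in
`w₁ ^ r w₂ ^ s α_i ^ m α_j ^ n`. -/
def lagrangeTerm (r s : ℕ) (p : ℕ × ℕ) : V :=
  ((-c) ^ p.1 * (-d) ^ p.2) • MvPowerSeries.coeff (expo p.1 p.2)
    (MvPowerSeries.X 0 ^ r * MvPowerSeries.X 1 ^ s *
      (affine κ i ^ p.1 * affine κ j ^ p.2))

lemma coeff_expo_succ_X_zero (r s : ℕ) (F : W) :
    MvPowerSeries.coeff (expo (r + 1) s) (MvPowerSeries.X 0 * F)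
      = MvPowerSeries.coeff (expo r s) F := by
  rw [← expo_add_zero, add_comm, MvPowerSeries.X, MvPowerSeries.coeff_add_monomial_mul, one_mul]

lemma coeff_expo_succ_X_one (r s : ℕ) (F : W) :
    MvPowerSeries.coeff (expo r (s + 1)) (MvPowerSeries.X 1 * F)
      = MvPowerSeries.coeff (expo r s) F := by
  rw [← expo_add_one, add_comm, MvPowerSeries.X, MvPowerSeries.coeff_add_monomial_mul, one_mul]

lemma coeff_expo_zero_X_zero (s : ℕ) (F : W) :
    MvPowerSeries.coeff (expo 0 s) (MvPowerSeries.X 0 * F) = 0 := by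
  classical
  rw [MvPowerSeries.X, MvPowerSeries.coeff_monomial_mul, if_neg]
  intro h
  have := h 0
  rw [expo_zero_apply] at this
  simp at this

lemma coeff_expo_zero_X_one (r : ℕ) (F : W) :
    MvPowerSeries.coeff (expo r 0) (MvPowerSeries.X 1 * F) = 0 := by
  classical
  rw [MvPowerSeries.X, MvPowerSeries.coeff_monomial_mul, if_neg]
  intro h
  have := h 1
  rw [expo_one_apply] at this
  simp at this

lemma coeff_X_pow_mul (r s m n : ℕ) (F : W) :
    MvPowerSeries.coeff (expo m n) (MvPowerSeries.X 0 ^ r * MvPowerSeries.X 1 ^ s * F)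
      = if r ≤ m ∧ s ≤ n then MvPowerSeries.coeff (expo (m - r) (n - s)) F else 0 := by
  induction r generalizing m with
  | zero =>
    rw [pow_zero, one_mul]
    induction s generalizing n with
    | zero => simp
    | succ s ih =>
      rw [pow_succ', mul_assoc]
      cases n with
      | zero => rw [coeff_expo_zero_X_one]; simp
      | succ n => rw [coeff_expo_succ_X_one, ih]; simp
  | succ r ih =>
    rw [pow_succ', mul_assoc, mul_assoc, ← mul_assoc (MvPowerSeries.X 0 ^ r)]
    cases m with
    | zero => rw [coeff_expo_zero_X_zero]; simp
    | succ m => rw [coeff_expo_succ_X_zero, ih]; simp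

lemma lagrangeTerm_eq_zero {r s : ℕ} {p : ℕ × ℕ} (h : ¬ (r ≤ p.1 ∧ s ≤ p.2)) :
    lagrangeTerm κ c d i j r s p = 0 := by
  rw [lagrangeTerm, coeff_X_pow_mul, if_neg h, smul_zero]

variable {i j}

lemma lagrangeTerm_weight (hi : 1 ≤ i) (hj : 1 ≤ j) (r s : ℕ) (p : ℕ × ℕ) :
    lagrangeTerm κ c d i j r s p ∈ wtFiltration.I (p.1 + p.2 - (r + s)) := by
  rw [lagrangeTerm, coeff_X_pow_mul]
  refine Submodule.smul_mem _ _ ?_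
  split_ifs
  · have h : affine κ i ^ p.1 * affine κ j ^ p.2 ∈ weighted :=
      mul_mem (pow_mem (affine_weighted κ hi) _) (pow_mem (affine_weighted κ hj) _)
    have := h (expo (p.1 - r) (p.2 - s))
    rw [degree_expo] at this
    exact wtFiltration.anti (by omega) this
  · exact zero_mem _

lemma lagrangeTerm_hasFormalSum (hi : 1 ≤ i) (hj : 1 ≤ j) (r s : ℕ) :
    HasFormalSum (lagrangeTerm κ c d i j r s) (formalSum (lagrangeTerm κ c d i j r s)) := by
  refine hasFormalSum_formalSum fun e => ?_
  refine (range (wt e + r + s + 1) ×ˢ range (wt e + r + s + 1)).finite_toSet.subset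
    fun p hp => ?_
  by_contra h
  rw [mem_coe, mem_product, mem_range, mem_range] at h
  exact hp (lagrangeTerm_weight κ c d hi hj r s p e (by omega))

/-- Shift of a double sequence in its first index. -/
def shiftLeft (u : ℕ × ℕ → V) : ℕ × ℕ → V
  | (0, _) => 0
  | (m + 1, n) => u (m, n)

/-- Shift of a double sequence in its second index. -/
def shiftRight (u : ℕ × ℕ → V) : ℕ × ℕ → V
  | (_, 0) => 0
  | (m, n + 1) => u (m, n)

lemma HasFormalSum.shiftLeft {u : ℕ × ℕ → V} {s : V} (h : HasFormalSum u s) :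
    HasFormalSum (shiftLeft u) s := by
  refine HasFormalSum.of_injective (f := fun p : ℕ × ℕ => (p.1 + 1, p.2)) ?_ ?_ h
  · rintro ⟨a, b⟩ ⟨a', b'⟩ hab
    simpa using hab
  · rintro ⟨a, b⟩ hab
    cases a with
    | zero => rfl
    | succ a => exact absurd ⟨(a, b), rfl⟩ hab

lemma HasFormalSum.shiftRight {u : ℕ × ℕ → V} {s : V} (h : HasFormalSum u s) :
    HasFormalSum (shiftRight u) s := by
  refine HasFormalSum.of_injective (f := fun p : ℕ × ℕ => (p.1, p.2 + 1)) ?_ ?_ h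
  · rintro ⟨a, b⟩ ⟨a', b'⟩ hab
    simpa using hab
  · rintro ⟨a, b⟩ hab
    cases b with
    | zero => rfl
    | succ b => exact absurd ⟨(a, b), rfl⟩ hab

lemma affine_eq (κ : Fin 2 → ℕ) {i : ℕ} (hi : 1 ≤ i) : affine κ i = MvPowerSeries.C (Sm (i - 1))
    - MvPowerSeries.C (A i (κ 0)) * MvPowerSeries.X 0
    - MvPowerSeries.C (A i (κ 1)) * MvPowerSeries.X 1 := by
  rw [affine, Fin.sum_univ_two, show ((i : ℤ) - 1) = ((i - 1 : ℕ) : ℤ) by omega, Smz_natCast]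
  ring

/-- One factor α_i is peeled off and expanded, while one w₁ is absorbed by lowering m. After
summation this is the equation w₁ = -c α_i(w). -/
lemma lagrangeTerm_succ_left (hi : 1 ≤ i) (r s : ℕ) (p : ℕ × ℕ) :
    lagrangeTerm κ c d i j (r + 1) s p = shiftLeft (fun p =>
      -((c • Sm (i - 1)) * lagrangeTerm κ c d i j r s p)
      + (c • A i (κ 0)) * lagrangeTerm κ c d i j (r + 1) s p
      + (c • A i (κ 1)) * lagrangeTerm κ c d i j r (s + 1) p) p := by
  rcases p with ⟨_ | m, n⟩
  · exact lagrangeTerm_eq_zero κ c d i j (by simp)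
  · change _ = -((c • Sm (i - 1)) * lagrangeTerm κ c d i j r s (m, n))
      + (c • A i (κ 0)) * lagrangeTerm κ c d i j (r + 1) s (m, n)
      + (c • A i (κ 1)) * lagrangeTerm κ c d i j r (s + 1) (m, n)
    simp only [lagrangeTerm]
    have h1 : (MvPowerSeries.X 0 ^ (r + 1) * MvPowerSeries.X 1 ^ s *
        (affine κ i ^ (m + 1) * affine κ j ^ n) : W)
        = MvPowerSeries.X 0 * (
          MvPowerSeries.C (Sm (i - 1)) * (MvPowerSeries.X 0 ^ r * MvPowerSeries.X 1 ^ s *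
            (affine κ i ^ m * affine κ j ^ n))
          - MvPowerSeries.C (A i (κ 0)) * (MvPowerSeries.X 0 ^ (r + 1) * MvPowerSeries.X 1 ^ s *
            (affine κ i ^ m * affine κ j ^ n))
          - MvPowerSeries.C (A i (κ 1)) * (MvPowerSeries.X 0 ^ r * MvPowerSeries.X 1 ^ (s + 1) *
            (affine κ i ^ m * affine κ j ^ n))) := by
      rw [pow_succ' (affine κ i) m]
      nth_rewrite 1 [affine_eq κ hi]
      ring
    rw [h1, coeff_expo_succ_X_zero, map_sub, map_sub, MvPowerSeries.coeff_C_mul,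
      MvPowerSeries.coeff_C_mul, MvPowerSeries.coeff_C_mul]
    simp only [smul_mul_smul_comm]
    rw [pow_succ (-c) m]
    module

lemma lagrangeTerm_succ_right (hj : 1 ≤ j) (r s : ℕ) (p : ℕ × ℕ) :
    lagrangeTerm κ c d i j r (s + 1) p = shiftRight (fun p =>
      -((d • Sm (j - 1)) * lagrangeTerm κ c d i j r s p)
      + (d • A j (κ 0)) * lagrangeTerm κ c d i j (r + 1) s p
      + (d • A j (κ 1)) * lagrangeTerm κ c d i j r (s + 1) p) p := by
  rcases p with ⟨m, _ | n⟩
  · exact lagrangeTerm_eq_zero κ c d i j (by simp)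
  · change _ = -((d • Sm (j - 1)) * lagrangeTerm κ c d i j r s (m, n))
      + (d • A j (κ 0)) * lagrangeTerm κ c d i j (r + 1) s (m, n)
      + (d • A j (κ 1)) * lagrangeTerm κ c d i j r (s + 1) (m, n)
    simp only [lagrangeTerm]
    have h1 : (MvPowerSeries.X 0 ^ r * MvPowerSeries.X 1 ^ (s + 1) *
        (affine κ i ^ m * affine κ j ^ (n + 1)) : W)
        = MvPowerSeries.X 1 * (
          MvPowerSeries.C (Sm (j - 1)) * (MvPowerSeries.X 0 ^ r * MvPowerSeries.X 1 ^ s *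
            (affine κ i ^ m * affine κ j ^ n))
          - MvPowerSeries.C (A j (κ 0)) * (MvPowerSeries.X 0 ^ (r + 1) * MvPowerSeries.X 1 ^ s *
            (affine κ i ^ m * affine κ j ^ n))
          - MvPowerSeries.C (A j (κ 1)) * (MvPowerSeries.X 0 ^ r * MvPowerSeries.X 1 ^ (s + 1) *
            (affine κ i ^ m * affine κ j ^ n))) := by
      rw [pow_succ' (affine κ j) n]
      nth_rewrite 1 [affine_eq κ hj]
      ring
    rw [h1, coeff_expo_succ_X_one, map_sub, map_sub, MvPowerSeries.coeff_C_mul,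
      MvPowerSeries.coeff_C_mul, MvPowerSeries.coeff_C_mul]
    simp only [smul_mul_smul_comm]
    rw [pow_succ (-d) n]
    module

end Lagrange

/-! ### Closed form of the Lagrange sums -/

section LagrangeSum

variable (κ : Fin 2 → ℕ) (c d : ℂ) {i j : ℕ}

/-- The sum over `m, n` of `(-c) ^ m (-d) ^ n` times the coefficient of `w₁ ^ m w₂ ^ n` in
`w₁ ^ r w₂ ^ s α_i ^ m α_j ^ n`. -/
def lagrangeSum (i j r s : ℕ) : V := formalSum (lagrangeTerm κ c d i j r s)

lemma lagrangeSum_succ_left (hi : 1 ≤ i) (hj : 1 ≤ j) (r s : ℕ) :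
    lagrangeSum κ c d i j (r + 1) s = -((c • Sm (i - 1)) * lagrangeSum κ c d i j r s)
      + (c • A i (κ 0)) * lagrangeSum κ c d i j (r + 1) s
      + (c • A i (κ 1)) * lagrangeSum κ c d i j r (s + 1) := by
  have h := fun r s => lagrangeTerm_hasFormalSum κ c d hi hj r s
  have h1 := ((((h r s).mul_left (c • Sm (i - 1))).neg.add
    ((h (r + 1) s).mul_left (c • A i (κ 0)))).add
    ((h r (s + 1)).mul_left (c • A i (κ 1)))).shiftLeft
  refine (h (r + 1) s).unique ?_
  rwa [← funext (lagrangeTerm_succ_left κ c d hi r s)] at h1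

lemma lagrangeSum_succ_right (hi : 1 ≤ i) (hj : 1 ≤ j) (r s : ℕ) :
    lagrangeSum κ c d i j r (s + 1) = -((d • Sm (j - 1)) * lagrangeSum κ c d i j r s)
      + (d • A j (κ 0)) * lagrangeSum κ c d i j (r + 1) s
      + (d • A j (κ 1)) * lagrangeSum κ c d i j r (s + 1) := by
  have h := fun r s => lagrangeTerm_hasFormalSum κ c d hi hj r s
  have h1 := ((((h r s).mul_left (d • Sm (j - 1))).neg.add
    ((h (r + 1) s).mul_left (d • A j (κ 0)))).add
    ((h r (s + 1)).mul_left (d • A j (κ 1)))).shiftRight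
  refine (h r (s + 1)).unique ?_
  rwa [← funext (lagrangeTerm_succ_right κ c d hj r s)] at h1

lemma coeff_affine_pow_eq_zero (κ : Fin 2 → ℕ) (i m : ℕ) {e : Fin 2 →₀ ℕ} (he : m < e.degree) :
    MvPowerSeries.coeff e (affine κ i ^ m) = 0 := by
  simpa using coeff_affine_pow_mul_eq_zero κ i i m 0 (by simpa using he)

/-- With β the part of α linear in w, (β_i + A_{i,κ 0} w₁)(β_j + A_{j,κ 1} w₂) = A_{i,κ 1} A_{j,κ 0}
w₁ w₂. The exponents extracted here have the maximal possible degree, so all terms with a constant S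
drop out. -/
lemma coeff_affine_pow_mul_affine_pow_succ (hi : 1 ≤ i) (hj : 1 ≤ j) (m n : ℕ) :
    MvPowerSeries.coeff (expo (m + 1) (n + 1)) (affine κ i ^ (m + 1) * affine κ j ^ (n + 1))
      = - (A i (κ 0) * MvPowerSeries.coeff (expo m (n + 1)) (affine κ i ^ m * affine κ j ^ (n + 1)))
        - A j (κ 1) * MvPowerSeries.coeff (expo (m + 1) n) (affine κ i ^ (m + 1) * affine κ j ^ n)
        - (A i (κ 0) * A j (κ 1) - A i (κ 1) * A j (κ 0))
          * MvPowerSeries.coeff (expo m n) (affine κ i ^ m * affine κ j ^ n) := by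
  have h : affine κ i ^ (m + 1) * affine κ j ^ (n + 1)
      = MvPowerSeries.C (Sm (j - 1)) * (affine κ i ^ (m + 1) * affine κ j ^ n)
      + MvPowerSeries.C (Sm (i - 1)) * (affine κ i ^ m * affine κ j ^ (n + 1))
      - MvPowerSeries.C (Sm (i - 1)) * (MvPowerSeries.C (Sm (j - 1)) *
          (affine κ i ^ m * affine κ j ^ n))
      + MvPowerSeries.X 0 * (MvPowerSeries.C (A i (κ 0)) *
          (MvPowerSeries.C (Sm (j - 1)) * (affine κ i ^ m * affine κ j ^ n)
            - affine κ i ^ m * affine κ j ^ (n + 1)))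
      + MvPowerSeries.X 1 * (MvPowerSeries.C (A j (κ 1)) *
          (MvPowerSeries.C (Sm (i - 1)) * (affine κ i ^ m * affine κ j ^ n)
            - affine κ i ^ (m + 1) * affine κ j ^ n))
      + MvPowerSeries.X 0 * (MvPowerSeries.X 1 * (
          MvPowerSeries.C (A i (κ 1)) * (MvPowerSeries.C (A j (κ 0)) *
            (affine κ i ^ m * affine κ j ^ n))
          - MvPowerSeries.C (A i (κ 0)) * (MvPowerSeries.C (A j (κ 1)) *
            (affine κ i ^ m * affine κ j ^ n)))) := by
    linear_combination (affine κ i ^ m * affine κ j ^ n) *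
      ((affine κ j - MvPowerSeries.C (Sm (j - 1)) + MvPowerSeries.C (A j (κ 1)) * MvPowerSeries.X 1)
        * affine_eq κ hi - MvPowerSeries.C (A i (κ 1)) * MvPowerSeries.X 1 * affine_eq κ hj)
  have h0 : ∀ m' n' r s, m' + n' < r + s →
      MvPowerSeries.coeff (expo r s) (affine κ i ^ m' * affine κ j ^ n') = 0 := fun m' n' r s h =>
    coeff_affine_pow_mul_eq_zero κ i j m' n' (by rwa [degree_expo])
  rw [h]
  simp only [map_add, map_sub, MvPowerSeries.coeff_C_mul, coeff_expo_succ_X_zero,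
    coeff_expo_succ_X_one]
  rw [h0 (m + 1) n (m + 1) (n + 1) (by omega), h0 m (n + 1) (m + 1) (n + 1) (by omega),
    h0 m n (m + 1) (n + 1) (by omega), h0 m n m (n + 1) (by omega), h0 m n (m + 1) n (by omega)]
  ring

lemma coeff_affine_pow_succ_zero (hi : 1 ≤ i) (m : ℕ) :
    MvPowerSeries.coeff (expo (m + 1) 0) (affine κ i ^ (m + 1))
      = -(A i (κ 0) * MvPowerSeries.coeff (expo m 0) (affine κ i ^ m)) := by
  have h : affine κ i ^ (m + 1) = MvPowerSeries.C (Sm (i - 1)) * affine κ i ^ m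
      - MvPowerSeries.X 0 * (MvPowerSeries.C (A i (κ 0)) * affine κ i ^ m)
      - MvPowerSeries.X 1 * (MvPowerSeries.C (A i (κ 1)) * affine κ i ^ m) := by
    linear_combination affine κ i ^ m * affine_eq κ hi
  rw [h, map_sub, map_sub, coeff_expo_succ_X_zero, coeff_expo_zero_X_one, MvPowerSeries.coeff_C_mul,
    MvPowerSeries.coeff_C_mul, coeff_affine_pow_eq_zero κ i m (by rw [degree_expo]; omega)]
  ring

lemma coeff_affine_pow_zero_succ (hj : 1 ≤ j) (n : ℕ) :
    MvPowerSeries.coeff (expo 0 (n + 1)) (affine κ j ^ (n + 1))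
      = -(A j (κ 1) * MvPowerSeries.coeff (expo 0 n) (affine κ j ^ n)) := by
  have h : affine κ j ^ (n + 1) = MvPowerSeries.C (Sm (j - 1)) * affine κ j ^ n
      - MvPowerSeries.X 0 * (MvPowerSeries.C (A j (κ 0)) * affine κ j ^ n)
      - MvPowerSeries.X 1 * (MvPowerSeries.C (A j (κ 1)) * affine κ j ^ n) := by
    linear_combination affine κ j ^ n * affine_eq κ hj
  rw [h, map_sub, map_sub, coeff_expo_succ_X_one, coeff_expo_zero_X_zero, MvPowerSeries.coeff_C_mul,
    MvPowerSeries.coeff_C_mul, coeff_affine_pow_eq_zero κ j n (by rw [degree_expo]; omega)]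
  ring

lemma lagrangeTerm_zero_zero (p : ℕ × ℕ) : lagrangeTerm κ c d i j 0 0 p
    = ((-c) ^ p.1 * (-d) ^ p.2) • MvPowerSeries.coeff (expo p.1 p.2)
      (affine κ i ^ p.1 * affine κ j ^ p.2) := by
  rw [lagrangeTerm, pow_zero, pow_zero, one_mul, one_mul]

/-- The 2 × 2 case of MacMahon's master theorem in the form of a recurrence: the coefficients on the
left are those of Δ, and the exceptional value at (0, 0) makes the sum Δ⁻¹. -/
lemma lagrangeTerm_recurrence (hi : 1 ≤ i) (hj : 1 ≤ j) (p : ℕ × ℕ) :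
    lagrangeTerm κ c d i j 0 0 p
      - (c • A i (κ 0)) * shiftLeft (lagrangeTerm κ c d i j 0 0) p
      - (d • A j (κ 1)) * shiftRight (lagrangeTerm κ c d i j 0 0) p
      + ((c • A i (κ 0)) * (d • A j (κ 1)) - (c • A i (κ 1)) * (d • A j (κ 0)))
        * shiftLeft (shiftRight (lagrangeTerm κ c d i j 0 0)) p
      = if p = (0, 0) then 1 else 0 := by
  rcases p with ⟨_ | m, _ | n⟩
  · simp [shiftLeft, shiftRight, lagrangeTerm, expo]
  · simp only [shiftLeft, shiftRight, lagrangeTerm_zero_zero, pow_zero, one_mul,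
      coeff_affine_pow_zero_succ κ hj]
    rw [if_neg (by simp)]
    simp only [pow_succ, MvPowerSeries.smul_eq_C_mul, map_mul, map_neg]
    ring
  · simp only [shiftLeft, shiftRight, lagrangeTerm_zero_zero, pow_zero, mul_one,
      coeff_affine_pow_succ_zero κ hi]
    rw [if_neg (by simp)]
    simp only [pow_succ, MvPowerSeries.smul_eq_C_mul, map_mul, map_neg]
    ring
  · simp only [shiftLeft, shiftRight, lagrangeTerm_zero_zero]
    rw [coeff_affine_pow_mul_affine_pow_succ κ hi hj m n, if_neg (by simp)]
    simp only [pow_succ (-c), pow_succ (-d), MvPowerSeries.smul_eq_C_mul, map_mul, map_neg]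
    ring

variable (l k : ℕ)

lemma den_mul_lagrangeSum_zero (hi : 1 ≤ i) (hj : 1 ≤ j) :
    den c d i j k l * lagrangeSum ![l, k] c d i j 0 0 = 1 := by
  have h := lagrangeTerm_hasFormalSum ![l, k] c d hi hj 0 0
  have h1 := ((h.sub (h.shiftLeft.mul_left (c • A i l))).sub
    (h.shiftRight.mul_left (d • A j k))).add
    (h.shiftRight.shiftLeft.mul_left ((c • A i l) * (d • A j k) - (c • A i k) * (d • A j l)))
  have h2 := hasFormalSum_of_finset (u := fun p : ℕ × ℕ => if p = (0, 0) then (1 : V) else 0)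
    {(0, 0)} (fun p hp => if_neg (by simpa using hp))
  rw [sum_singleton, if_pos rfl] at h2
  rw [← funext (lagrangeTerm_recurrence ![l, k] c d hi hj)] at h2
  refine Eq.trans ?_ (h1.unique h2)
  rw [den, lagrangeSum]
  ring

/-- Cramer's rule for the linear system formed by the two recurrences, whose determinant is Δ. -/
lemma den_mul_lagrangeSum_succ_left (hi : 1 ≤ i) (hj : 1 ≤ j) (r s : ℕ) :
    den c d i j k l * lagrangeSum ![l, k] c d i j (r + 1) s =
      (-(c • Sm (i - 1)) + (c • Sm (i - 1)) * (d • A j k) - (d • Sm (j - 1)) * (c • A i k))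
        * lagrangeSum ![l, k] c d i j r s := by
  have h1 := lagrangeSum_succ_left ![l, k] c d hi hj r s
  have h2 := lagrangeSum_succ_right ![l, k] c d hi hj r s
  simp only [Matrix.cons_val_zero, Matrix.cons_val_one] at h1 h2
  rw [den]
  linear_combination (1 - d • A j k) * h1 + (c • A i k) * h2

lemma den_mul_lagrangeSum_succ_right (hi : 1 ≤ i) (hj : 1 ≤ j) (r s : ℕ) :
    den c d i j k l * lagrangeSum ![l, k] c d i j r (s + 1) =
      (-(d • Sm (j - 1)) + (d • Sm (j - 1)) * (c • A i l) - (c • Sm (i - 1)) * (d • A j l))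
        * lagrangeSum ![l, k] c d i j r s := by
  have h1 := lagrangeSum_succ_left ![l, k] c d hi hj r s
  have h2 := lagrangeSum_succ_right ![l, k] c d hi hj r s
  simp only [Matrix.cons_val_zero, Matrix.cons_val_one] at h1 h2
  rw [den]
  linear_combination (1 - c • A i l) * h2 + (d • A j l) * h1

lemma constantCoeff_A {s : ℕ} (t : ℕ) (hs : 1 ≤ s) : MvPowerSeries.constantCoeff (A s t) = 0 := by
  rw [← MvPowerSeries.coeff_zero_eq_constantCoeff_apply]
  exact A_mem s t 0 (by simp [wt]; omega)

lemma constantCoeff_den (hi : 1 ≤ i) (hj : 1 ≤ j) :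
    MvPowerSeries.constantCoeff (den c d i j k l) = 1 := by
  have h : ∀ (c : ℂ) (g : V), MvPowerSeries.constantCoeff (c • g)
      = c * MvPowerSeries.constantCoeff g := fun c g => by
    rw [MvPowerSeries.smul_eq_C_mul, map_mul, MvPowerSeries.constantCoeff_C]
  simp only [den, map_add, map_sub, map_mul, map_one, h, constantCoeff_A _ hi, constantCoeff_A _ hj]
  ring

lemma lagrangeSum_eq (hi : 1 ≤ i) (hj : 1 ≤ j) (r s : ℕ) :
    lagrangeSum ![l, k] c d i j r s = (den c d i j k l)⁻¹ *
      (((den c d i j k l)⁻¹ * (-(c • Sm (i - 1)) + (c • Sm (i - 1)) * (d • A j k)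
          - (d • Sm (j - 1)) * (c • A i k))) ^ r *
        ((den c d i j k l)⁻¹ * (-(d • Sm (j - 1)) + (d • Sm (j - 1)) * (c • A i l)
          - (c • Sm (i - 1)) * (d • A j l))) ^ s) := by
  have hd : (den c d i j k l)⁻¹ * den c d i j k l = 1 :=
    MvPowerSeries.inv_mul_cancel _ (by rw [constantCoeff_den c d l k hi hj]; exact one_ne_zero)
  have h0 := den_mul_lagrangeSum_zero c d l k hi hj
  have hl := den_mul_lagrangeSum_succ_left c d l k hi hj
  have hr := den_mul_lagrangeSum_succ_right c d l k hi hj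
  induction r with
  | zero =>
    induction s with
    | zero => linear_combination (den c d i j k l)⁻¹ * h0 - lagrangeSum ![l, k] c d i j 0 0 * hd
    | succ s ih =>
      rw [pow_succ]
      linear_combination (den c d i j k l)⁻¹ * hr 0 s - lagrangeSum ![l, k] c d i j 0 (s + 1) * hd
        + (den c d i j k l)⁻¹ * (-(d • Sm (j - 1)) + (d • Sm (j - 1)) * (c • A i l)
          - (c • Sm (i - 1)) * (d • A j l)) * ih
  | succ r ih =>
    rw [pow_succ]
    linear_combination (den c d i j k l)⁻¹ * hl r s - lagrangeSum ![l, k] c d i j (r + 1) s * hd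
      + (den c d i j k l)⁻¹ * (-(c • Sm (i - 1)) + (c • Sm (i - 1)) * (d • A j k)
          - (d • Sm (j - 1)) * (c • A i k)) * ih

end LagrangeSum

lemma HasFormalSum.congr_sum {ι σ R : Type*} [Ring R] {u : ι → MvPowerSeries σ R}
    {s t : MvPowerSeries σ R} (h : HasFormalSum u s) (hst : s = t) : HasFormalSum u t :=
  hst ▸ h

lemma HasFormalSum.congr {ι σ R : Type*} [Ring R] {u v : ι → MvPowerSeries σ R}
    {s : MvPowerSeries σ R} (h : HasFormalSum u s) (huv : ∀ i, u i = v i) : HasFormalSum v s :=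
  funext huv ▸ h

/-! ### Exponentials of operators -/

lemma inv_factorial_smul_iterate {E : Type*} [AddCommGroup E] [Module ℂ E] {T : E → E}
    (hT : ∀ (c : ℂ) v, T (c • v) = c • T v) {w : ℕ → E}
    (h : ∀ n, T (w n) = ((n : ℂ) + 1) • w (n + 1)) (n : ℕ) :
    ((n.factorial : ℂ)⁻¹) • T^[n] (w 0) = w n := by
  have key : T^[n] (w 0) = (n.factorial : ℂ) • w n := by
    induction n with
    | zero => simp
    | succ n ih =>
      rw [Function.iterate_succ_apply', ih, hT, h, smul_smul, Nat.factorial_succ]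
      congr 1
      push_cast
      ring
  rw [key, smul_smul, inv_mul_cancel₀ (by exact_mod_cast n.factorial_ne_zero), one_smul]

lemma isExpApply_single {T : B → B} {τ : V → V}
    (hT : ∀ g, T (Pi.single 0 g) = Pi.single 0 (τ g)) {g h : V}
    (hs : HasFormalSum (fun n : ℕ => ((n.factorial : ℂ)⁻¹) • τ^[n] g) h) :
    IsExpApply T (Pi.single 0 g) (Pi.single 0 h) := by
  have hT' : ∀ n : ℕ, T^[n] (Pi.single 0 g) = Pi.single 0 (τ^[n] g) := by
    intro n
    induction n with
    | zero => rfl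
    | succ n ih => rw [Function.iterate_succ_apply', ih, hT, Function.iterate_succ_apply']
  intro m
  simp only [hT', Pi.smul_apply]
  by_cases hm : m = 0
  · subst hm
    simpa only [Pi.single_eq_same] using hs
  · simp only [Pi.single_eq_of_ne hm, smul_zero]
    simpa using hasFormalSum_of_finset (u := fun _ : ℕ => (0 : V)) ∅ fun _ _ => rfl

/-! ### The first tau function -/

section Charged

variable (l k : ℕ) (a b : ℂ)

/-- `(b φ*_{-k}) ^ n / n!` applied to `exp (a φ*_{-l}) 1`. -/
def chargedVec (n : ℕ) : B := fun m =>
  if (n : ℤ) ≤ m then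
    -- The indices 1, 1 are placeholders: the affine factors occur with exponent zero.
    ((-a) ^ (m - n).toNat * (-b) ^ n) • tauCoeff l k 1 1 0 0 (m - n).toNat n
  else 0

lemma phiStar_smul (i : ℤ) (c : ℂ) (v : B) : phiStar i (c • v) = c • phiStar i v := by
  funext m
  rw [phiStar_apply, Pi.smul_apply, map_smul, Pi.smul_apply, phiStar_apply]

lemma smul_phiStar_chargedVec (n : ℕ) :
    b • phiStar (-(k : ℤ)) (chargedVec l k a b n) = ((n : ℂ) + 1) • chargedVec l k a b (n + 1) := by
  funext m
  rw [Pi.smul_apply, Pi.smul_apply, phiStar_apply, chargedVec, chargedVec]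
  by_cases h : (n : ℤ) ≤ m - 1
  · rw [if_pos h, if_pos (by push_cast; omega), map_smul,
      phiStarOp_tauCoeff_one l k le_rfl le_rfl 0 0 _ n (by push_cast; omega),
      show (m - 1 - n).toNat = (m - (n + 1 : ℕ)).toNat by congr 1; push_cast; ring]
    rw [smul_smul, smul_smul, smul_smul]
    congr 1
    ring
  · rw [if_neg h, if_neg (by push_cast; omega), map_zero, smul_zero, smul_zero]

lemma smul_phiStar_vacuum (n : ℕ) :
    a • phiStar (-(l : ℤ)) ((-a) ^ n • Pi.single (n : ℤ) (tauCoeff l k 1 1 0 0 n 0))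
      = ((n : ℂ) + 1) • ((-a) ^ (n + 1) •
        Pi.single ((n + 1 : ℕ) : ℤ) (tauCoeff l k 1 1 0 0 (n + 1) 0) : B) := by
  funext m
  rw [phiStar_smul, Pi.smul_apply, Pi.smul_apply, Pi.smul_apply, Pi.smul_apply, phiStar_apply]
  by_cases h : m = ((n + 1 : ℕ) : ℤ)
  · have h' : m - 1 = (n : ℤ) := by rw [h]; push_cast; ring
    rw [h', h, Pi.single_eq_same, Pi.single_eq_same,
      phiStarOp_tauCoeff_zero l k le_rfl le_rfl 0 0 n 0 (by push_cast; omega), smul_smul, smul_smul,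
      smul_smul]
    congr 1
    ring
  · rw [Pi.single_eq_of_ne h, Pi.single_eq_of_ne (by push_cast at h; omega), map_zero]
    simp only [smul_zero]

lemma isExpApply_vac : IsExpApply (fun t => a • phiStar (-(l : ℤ)) t) vac (chargedVec l k a b 0) := by
  have h := inv_factorial_smul_iterate (T := fun t : B => a • phiStar (-(l : ℤ)) t)
    (fun c v => by rw [phiStar_smul, smul_comm]) (smul_phiStar_vacuum l k a)
  rw [pow_zero, one_smul, tauCoeff_zero] at h
  intro m
  change HasFormalSum (fun n : ℕ => ((n.factorial : ℂ)⁻¹ •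
    (fun t : B => a • phiStar (-(l : ℤ)) t)^[n] (Pi.single ((0 : ℕ) : ℤ) 1)) m) _
  simp only [h]
  refine (hasFormalSum_of_finset {m.toNat} fun n hn => ?_).congr_sum ?_
  · rw [mem_singleton] at hn
    rw [Pi.smul_apply, Pi.single_eq_of_ne (by omega), smul_zero]
  · rw [sum_singleton, chargedVec, Pi.smul_apply]
    by_cases hm : 0 ≤ m
    · rw [if_pos (by simpa using hm)]
      have h1 : ((m.toNat : ℕ) : ℤ) = m := Int.toNat_of_nonneg hm
      rw [h1, Pi.single_eq_same]
      simp
    · rw [if_neg (by simpa using hm), Pi.single_eq_of_ne (by omega), smul_zero]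

lemma isExpApply_chargedVec : IsExpApply (fun t => b • phiStar (-(k : ℤ)) t) (chargedVec l k a b 0)
    (fun m => ∑ n ∈ range (m.toNat + 1), chargedVec l k a b n m) := by
  have h := inv_factorial_smul_iterate (T := fun t : B => b • phiStar (-(k : ℤ)) t)
    (fun c v => by rw [phiStar_smul, smul_comm]) (smul_phiStar_chargedVec l k a b)
  intro m
  simp only [h]
  refine hasFormalSum_of_finset _ fun n hn => if_neg ?_
  rw [mem_range] at hn
  omega

lemma laurent_coeff_eval (F : V) (r s : ℕ) (m : ℤ) :
    (LaurentPolynomial.C F * (-(a • LaurentPolynomial.T 1)) ^ r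
        * (-(b • LaurentPolynomial.T 1)) ^ s : LaurentPolynomial V).coeff m
      = if (r : ℤ) + s = m then ((-a) ^ r * (-b) ^ s) • F else 0 := by
  have h : (LaurentPolynomial.C F * (-(a • LaurentPolynomial.T 1)) ^ r
        * (-(b • LaurentPolynomial.T 1)) ^ s : LaurentPolynomial V)
      = ((-a) ^ r * (-b) ^ s) •
        (LaurentPolynomial.C F * LaurentPolynomial.T ((r : ℤ) + s)) := by
    rw [← neg_smul, ← neg_smul, smul_pow, smul_pow, LaurentPolynomial.T_pow,
      LaurentPolynomial.T_pow, mul_one, mul_one, LaurentPolynomial.T_add]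
    simp only [mul_smul_comm, smul_mul_assoc, smul_smul, mul_assoc]
    rw [mul_comm ((-b) ^ s)]
  rw [h, AddMonoidAlgebra.coeff_smul, Finsupp.smul_apply, laurent_coeff_C_mul_T]
  split_ifs <;> simp

lemma isEval_charged : IsEval (f l k) (-(a • LaurentPolynomial.T 1)) (-(b • LaurentPolynomial.T 1))
    (fun m => ∑ n ∈ range (m.toNat + 1), chargedVec l k a b n m) := by
  classical
  intro m
  simp only [laurent_coeff_eval]
  have h := hasFormalSum_of_finset (u := fun e : Fin 2 →₀ ℕ => if (e 0 : ℤ) + e 1 = m then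
      ((-a) ^ e 0 * (-b) ^ e 1) • MvPowerSeries.coeff e (f l k) else 0)
    ((range (m.toNat + 1)).image fun n => expo (m.toNat - n) n) fun e he => if_neg fun hm => he <| by
      rw [mem_image]
      refine ⟨e 1, mem_range.2 (by omega), ?_⟩
      rw [show m.toNat - e 1 = e 0 by omega]
      exact expoEquiv.apply_symm_apply e
  refine h.congr_sum ?_
  rw [sum_image fun n _ n' _ hn => by
    simpa [expo_one_apply] using DFunLike.congr_fun hn 1]
  refine sum_congr rfl fun n hn => ?_
  rw [mem_range] at hn
  rw [expo_zero_apply, expo_one_apply, chargedVec]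
  by_cases hm : 0 ≤ m
  · rw [if_pos (by omega), if_pos (by omega), show (m - n).toNat = m.toNat - n by omega, tauCoeff,
      pow_zero, one_mul, one_mul]
  · rw [if_neg (by omega), if_neg (by omega)]

end Charged

/-! ### The shift operator -/

lemma one_sub_gen_mul_C_f_coeff (l k : ℕ) (s : ℤ) :
    ((1 - gen l k) * LaurentPolynomial.C (f l k)).coeff s
      = if s ≤ 0 then cw (Dp (-s).toNat) (f l k) else 0 := by
  have h := cw_Dp_f l k (one_mem invariantsW) (-s).toNat
  rw [one_mul, map_sub] at h
  have h1 := gen_pow_coeff l k 1 s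
  have h0 := gen_pow_coeff l k 0 s
  rw [pow_one, pow_one] at h1
  rw [pow_zero, pow_zero] at h0
  rw [mul_comm, ← LaurentPolynomial.smul_eq_C_mul, AddMonoidAlgebra.coeff_smul, Finsupp.smul_apply,
    AddMonoidAlgebra.coeff_sub, Finsupp.sub_apply, h1, h0]
  split_ifs
  · rw [h, smul_eq_mul, mul_comm]
  · simp

/-! ### The second tau function -/

section Neutral

variable (l k : ℕ) (c d : ℂ) {i j : ℕ}

/-- The summand of the double sum which gives both the second tau function and the evaluation
of `f`. -/
def doubleTerm (i j : ℕ) (q : (ℕ × ℕ) × (ℕ × ℕ)) : V :=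
  MvPowerSeries.coeff (expo q.2.1 q.2.2) (f l k) * lagrangeTerm ![l, k] c d i j q.2.1 q.2.2 q.1

/-- `(d φ_{-j} φ*_{-k}) ^ n / n!` applied to `(c φ_{-i} φ*_{-l}) ^ m / m!` applied to `1`. -/
def neutralTerm (i j : ℕ) (p : ℕ × ℕ) : V :=
  ((-c) ^ p.1 * (-d) ^ p.2) • tauCoeff l k i j p.1 p.2 p.1 p.2

/-- The coefficient of f has weight at least r + s, and the Lagrange term at least m + n - (r + s).
A nonzero term also needs r ≤ m and s ≤ n, so the total weight m + n bounds all four indices. -/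
lemma doubleTerm_hasFormalSum (hi : 1 ≤ i) (hj : 1 ≤ j) :
    HasFormalSum (doubleTerm l k c d i j) (formalSum (doubleTerm l k c d i j)) := by
  refine hasFormalSum_formalSum fun e => ?_
  let N := range (wt e + 1)
  refine ((N ×ˢ N) ×ˢ (N ×ˢ N)).finite_toSet.subset fun q hq => ?_
  obtain ⟨⟨m, n⟩, r, s⟩ := q
  by_cases h : r ≤ m ∧ s ≤ n
  · by_contra hN
    simp only [N, mem_coe, mem_product, mem_range] at hN
    have h1 := f_weighted l k (expo r s)
    rw [degree_expo] at h1
    have h2 := wtFiltration.mul_mem h1 (lagrangeTerm_weight ![l, k] c d hi hj r s (m, n))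
    exact hq (h2 e (by simp only; omega))
  · refine absurd ?_ hq
    change MvPowerSeries.coeff e (_ * _) = 0
    rw [lagrangeTerm_eq_zero _ _ _ _ _ h, mul_zero, map_zero]

/-- For fixed (m, n), summing over (r, s) reassembles f from its monomials inside the coefficient
extraction. -/
lemma doubleTerm_row (p : ℕ × ℕ) :
    HasFormalSum (fun q => doubleTerm l k c d i j (p, q)) (neutralTerm l k c d i j p) := by
  classical
  obtain ⟨m, n⟩ := p
  have h := hasFormalSum_of_finset (u := fun q => doubleTerm l k c d i j ((m, n), q))
    (range (m + 1) ×ˢ range (n + 1)) fun q hq => by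
      change _ * lagrangeTerm ![l, k] c d i j q.1 q.2 (m, n) = 0
      rw [lagrangeTerm_eq_zero, mul_zero]
      simp only [mem_product, mem_range] at hq
      omega
  refine h.congr_sum ?_
  rw [neutralTerm, tauCoeff, mul_comm _ (f l k), MvPowerSeries.coeff_mul, smul_sum]
  refine sum_nbij' (fun q => (expo q.1 q.2, expo (m - q.1) (n - q.2))) (fun p => (p.1 0, p.1 1))
    ?_ ?_ ?_ ?_ ?_
  · rintro ⟨r, s⟩ hq
    simp only [mem_product, mem_range] at hq
    rw [HasAntidiagonal.mem_antidiagonal]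
    ext t
    fin_cases t
    · change expo r s 0 + expo (m - r) (n - s) 0 = expo m n 0
      simp only [expo_zero_apply]
      omega
    · change expo r s 1 + expo (m - r) (n - s) 1 = expo m n 1
      simp only [expo_one_apply]
      omega
  · rintro p hp
    have hp' := HasAntidiagonal.mem_antidiagonal.1 hp
    have h0 := DFunLike.congr_fun hp' 0
    have h1 := DFunLike.congr_fun hp' 1
    rw [Finsupp.add_apply, expo_zero_apply] at h0
    rw [Finsupp.add_apply, expo_one_apply] at h1
    simp only [mem_product, mem_range]
    omega
  · rintro ⟨r, s⟩ _
    exact Prod.ext (expo_zero_apply r s) (expo_one_apply r s)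
  · rintro ⟨p, p'⟩ hp
    have hp' := HasAntidiagonal.mem_antidiagonal.1 hp
    have h0 := DFunLike.congr_fun hp' 0
    have h1 := DFunLike.congr_fun hp' 1
    rw [Finsupp.add_apply, expo_zero_apply] at h0
    rw [Finsupp.add_apply, expo_one_apply] at h1
    simp only at h0 h1
    refine Prod.ext (expoEquiv.apply_symm_apply p) ?_
    simp only
    rw [show m - p 0 = p' 0 by omega, show n - p 1 = p' 1 by omega]
    exact expoEquiv.apply_symm_apply p'
  · rintro ⟨r, s⟩ hq
    simp only [mem_product, mem_range] at hq
    change _ * lagrangeTerm ![l, k] c d i j r s (m, n) = _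
    rw [lagrangeTerm, coeff_X_pow_mul, if_pos (by simp only; omega), mul_smul_comm]

/-- `exp (d φ_{-j} φ*_{-k}) exp (c φ_{-i} φ*_{-l}) 1`. -/
def neutralTau (i j : ℕ) : V := formalSum (doubleTerm l k c d i j)

lemma neutralTerm_hasFormalSum (hi : 1 ≤ i) (hj : 1 ≤ j) :
    HasFormalSum (neutralTerm l k c d i j) (neutralTau l k c d i j) :=
  (doubleTerm_hasFormalSum l k c d hi hj).curry (doubleTerm_row l k c d)

/-- The same double sum in the other order: for fixed (r, s) the sum over (m, n) is a Lagrange sum.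
This exchange is what equates the tau function with an evaluation of f. -/
lemma eval_hasFormalSum (hi : 1 ≤ i) (hj : 1 ≤ j) :
    HasFormalSum (fun q : ℕ × ℕ =>
      MvPowerSeries.coeff (expo q.1 q.2) (f l k) * lagrangeSum ![l, k] c d i j q.1 q.2)
      (neutralTau l k c d i j) := by
  have h := (doubleTerm_hasFormalSum l k c d hi hj).equiv (Equiv.prodComm (ℕ × ℕ) (ℕ × ℕ))
  refine h.curry fun q => ?_
  have h1 := (lagrangeTerm_hasFormalSum ![l, k] c d hi hj q.1 q.2).mul_left
    (MvPowerSeries.coeff (expo q.1 q.2) (f l k))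
  exact h1.congr fun p => rfl

lemma isEval_C {F : W} {u v g : V} (h : HasFormalSum (fun q : ℕ × ℕ =>
    MvPowerSeries.coeff (expo q.1 q.2) F * (u ^ q.1 * v ^ q.2)) g) :
    IsEval F (LaurentPolynomial.C u) (LaurentPolynomial.C v) (Pi.single 0 g) := by
  have hc : ∀ (e : Fin 2 →₀ ℕ) (m : ℤ), (LaurentPolynomial.C (MvPowerSeries.coeff e F) *
      LaurentPolynomial.C u ^ e 0 * LaurentPolynomial.C v ^ e 1).coeff m
      = if 0 = m then MvPowerSeries.coeff e F * (u ^ e 0 * v ^ e 1) else 0 := by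
    intro e m
    rw [← laurent_coeff_C_mul_T, LaurentPolynomial.T_zero, mul_one, map_mul, map_mul, map_pow,
      map_pow, mul_assoc]
  intro m
  simp only [hc]
  by_cases hm : 0 = m
  · subst hm
    have h' := h.equiv expoEquiv.symm
    simp only [if_true, Pi.single_eq_same]
    refine h'.congr fun e => ?_
    exact congrArg (fun e' => MvPowerSeries.coeff e' F * (u ^ e 0 * v ^ e 1))
      (expoEquiv.apply_symm_apply e)
  · simp only [if_neg hm, Pi.single_eq_of_ne (Ne.symm hm)]
    simpa using hasFormalSum_of_finset (u := fun _ : Fin 2 →₀ ℕ => (0 : V)) ∅ fun _ _ => rfl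

/-- Every Lagrange sum carries one factor Δ⁻¹ besides the powers of N₁/Δ and N₂/Δ; multiplying by Δ
leaves exactly the evaluation of f. -/
lemma isEval_neutral (hi : 1 ≤ i) (hj : 1 ≤ j) : IsEval (f l k)
    (LaurentPolynomial.C ((den c d i j k l)⁻¹ * (-(c • Sm (i - 1)) + (c • Sm (i - 1)) * (d • A j k)
      - (d • Sm (j - 1)) * (c • A i k))))
    (LaurentPolynomial.C ((den c d i j k l)⁻¹ * (-(d • Sm (j - 1)) + (d • Sm (j - 1)) * (c • A i l)
      - (c • Sm (i - 1)) * (d • A j l))))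
    (Pi.single 0 (den c d i j k l * neutralTau l k c d i j)) := by
  refine isEval_C ?_
  have hd : den c d i j k l * (den c d i j k l)⁻¹ = 1 :=
    MvPowerSeries.mul_inv_cancel _ (by rw [constantCoeff_den c d l k hi hj]; exact one_ne_zero)
  have h := (eval_hasFormalSum l k c d hi hj).mul_left (den c d i j k l)
  simp only [lagrangeSum_eq c d l k hi hj] at h
  refine h.congr fun q => ?_
  rw [mul_left_comm, ← mul_assoc (den c d i j k l), hd, one_mul]

/-- The operator `c φ_{-i} φ*_{-l}` on the component of charge zero. -/
def bilinearOp (c : ℂ) (i l : ℕ) : Module.End ℂ V :=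
  c • (phiOp (-(i : ℤ)) * phiStarOp (-(l : ℤ)) 0)

lemma bilinearOp_mem (c : ℂ) (i l : ℕ) : bilinearOp c i l ∈ continuousOps :=
  Subalgebra.smul_mem _ (mul_mem (phiOp_mem _) (phiStarOp_mem _ _)) _

lemma phi_phiStar_single (c : ℂ) (i l : ℕ) (g : V) :
    c • phi (-(i : ℤ)) (phiStar (-(l : ℤ)) (Pi.single 0 g)) = Pi.single 0 (bilinearOp c i l g) := by
  funext m
  rw [Pi.smul_apply, phi_apply, phiStar_apply, add_sub_cancel_right]
  by_cases hm : m = 0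
  · subst hm
    rw [Pi.single_eq_same, Pi.single_eq_same]
    rfl
  · rw [Pi.single_eq_of_ne hm, Pi.single_eq_of_ne hm, map_zero, map_zero, smul_zero]

/-- φ* differentiates in w₁, raising the extracted exponent, and φ adds a factor α_i. Degree and
number of affine factors stay equal, so the charge stays zero. -/
lemma bilinearOp_left (hi : 1 ≤ i) (hj : 1 ≤ j) (m : ℕ) :
    bilinearOp c i l (neutralTerm l k c d i j (m, 0))
      = ((m : ℂ) + 1) • neutralTerm l k c d i j (m + 1, 0) := by
  change c • phiOp _ (phiStarOp _ _ _) = _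
  rw [neutralTerm, neutralTerm, map_smul, map_smul,
    phiStarOp_tauCoeff_zero l k hi hj m 0 m 0 (by simp), map_smul, phiOp_tauCoeff_left l k hi]
  simp only [smul_smul, pow_succ]
  congr 1
  ring

lemma bilinearOp_right (hi : 1 ≤ i) (hj : 1 ≤ j) (m n : ℕ) :
    bilinearOp d j k (neutralTerm l k c d i j (m, n))
      = ((n : ℂ) + 1) • neutralTerm l k c d i j (m, n + 1) := by
  change d • phiOp _ (phiStarOp _ _ _) = _
  rw [neutralTerm, neutralTerm, map_smul, map_smul,
    phiStarOp_tauCoeff_one l k hi hj m n m n (by simp), map_smul, phiOp_tauCoeff_right l k hj]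
  simp only [smul_smul, pow_succ]
  congr 1
  ring

lemma neutralTerm_zero : neutralTerm l k c d i j (0, 0) = 1 := by
  rw [neutralTerm, tauCoeff_zero, pow_zero, pow_zero, one_mul, one_smul]

/-- `exp (c φ_{-i} φ*_{-l}) 1`. -/
def neutralTauLeft (i j : ℕ) : V := formalSum fun m : ℕ => neutralTerm l k c d i j (m, 0)

lemma neutralTauLeft_hasFormalSum (hi : 1 ≤ i) (hj : 1 ≤ j) :
    HasFormalSum (fun m : ℕ => neutralTerm l k c d i j (m, 0)) (neutralTauLeft l k c d i j) :=
  hasFormalSum_formalSum fun e =>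
    ((neutralTerm_hasFormalSum l k c d hi hj) e).1.preimage
      (f := fun m : ℕ => (m, 0)) fun _ _ _ _ h => (Prod.ext_iff.1 h).1

lemma isExpApply_neutralTauLeft (hi : 1 ≤ i) (hj : 1 ≤ j) :
    IsExpApply (fun t => c • phi (-(i : ℤ)) (phiStar (-(l : ℤ)) t)) vac
      (Pi.single 0 (neutralTauLeft l k c d i j)) := by
  refine isExpApply_single (phi_phiStar_single c i l) ?_
  have h := inv_factorial_smul_iterate (T := bilinearOp c i l) (fun c v => map_smul _ c v)
    (bilinearOp_left l k c d hi hj)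
  rw [neutralTerm_zero] at h
  simp only [h]
  exact neutralTauLeft_hasFormalSum l k c d hi hj

/-- Powers of the bilinear operator are continuous and can be applied termwise to the first
exponential. The resulting iterated sum is then the row-wise evaluation of the double sum, already
known to be coefficientwise finite. -/
lemma isExpApply_neutralTau (hi : 1 ≤ i) (hj : 1 ≤ j) :
    IsExpApply (fun t => d • phi (-(j : ℤ)) (phiStar (-(k : ℤ)) t))
      (Pi.single 0 (neutralTauLeft l k c d i j)) (Pi.single 0 (neutralTau l k c d i j)) := by
  refine isExpApply_single (phi_phiStar_single d j k) ?_
  refine ((neutralTerm_hasFormalSum l k c d hi hj).equiv (Equiv.prodComm ℕ ℕ)).curry fun n => ?_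
  have hmem : ((n.factorial : ℂ)⁻¹) • bilinearOp d j k ^ n ∈ continuousOps :=
    Subalgebra.smul_mem _ (pow_mem (bilinearOp_mem d j k) n) _
  have h := (neutralTauLeft_hasFormalSum l k c d hi hj).map hmem
  have h1 : ∀ g : V, (((n.factorial : ℂ)⁻¹) • bilinearOp d j k ^ n) g
      = ((n.factorial : ℂ)⁻¹) • (bilinearOp d j k)^[n] g := fun g => by
    rw [LinearMap.smul_apply, Module.End.pow_apply]
  have h2 : ∀ m : ℕ, (((n.factorial : ℂ)⁻¹) • bilinearOp d j k ^ n)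
      (neutralTerm l k c d i j (m, 0)) = neutralTerm l k c d i j (m, n) := fun m => by
    rw [h1]
    exact inv_factorial_smul_iterate (T := bilinearOp d j k) (fun c v => map_smul _ c v)
      (bilinearOp_right l k c d hi hj m) n
  rw [← h1]
  exact h.congr h2

end Neutral

end FMS

end

theorem corollary3p8 (k l : ℕ) :
    -- `exp (∑ (∂x_n - ∂y_n) z⁻ⁿ / n) f = (1 - gen l k) f`, coefficient of `z ^ s` for each `s`
    (∀ s : ℤ,
      ((1 - FMS.gen l k) * LaurentPolynomial.C (FMS.f l k)).coeff s =
        if s ≤ 0 then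
          (fun e => FMS.Dp (-s).toNat (MvPowerSeries.coeff e (FMS.f l k)) : FMS.W)
        else 0) ∧
    (l ≤ k →
      -- `exp (b φ*_{-k}) exp (a φ*_{-l}) 1 = f(-a p, -b p)`
      (∀ a b : ℂ, ∃ v u : FMS.B,
        FMS.IsExpApply (fun t => a • FMS.phiStar (-(l : ℤ)) t) FMS.vac v ∧
        FMS.IsExpApply (fun t => b • FMS.phiStar (-(k : ℤ)) t) v u ∧
        FMS.IsEval (FMS.f l k)
          (-(a • LaurentPolynomial.T 1)) (-(b • LaurentPolynomial.T 1)) u) ∧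
      -- `exp (d φ_{-j} φ*_{-k}) exp (c φ_{-i} φ*_{-l}) 1 = f(w₁, w₂) / den`
      (∀ (c d : ℂ) (i j : ℕ), 1 ≤ i → 1 ≤ j →
        MvPowerSeries.constantCoeff (FMS.den c d i j k l) = 1 ∧
        ∃ v u : FMS.B,
          FMS.IsExpApply (fun t => c • FMS.phi (-(i : ℤ)) (FMS.phiStar (-(l : ℤ)) t))
            FMS.vac v ∧
          FMS.IsEval (FMS.f l k)
            (LaurentPolynomial.C ((FMS.den c d i j k l)⁻¹ *
              (-(c • FMS.Sm (i - 1)) + (c • FMS.Sm (i - 1)) * (d • FMS.A j k)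
                - (d • FMS.Sm (j - 1)) * (c • FMS.A i k))))
            (LaurentPolynomial.C ((FMS.den c d i j k l)⁻¹ *
              (-(d • FMS.Sm (j - 1)) + (d • FMS.Sm (j - 1)) * (c • FMS.A i l)
                - (c • FMS.Sm (i - 1)) * (d • FMS.A j l)))) u ∧
          FMS.IsExpApply (fun t => d • FMS.phi (-(j : ℤ)) (FMS.phiStar (-(k : ℤ)) t))
            v ((FMS.den c d i j k l)⁻¹ • u))) := by
  refine ⟨fun s => FMS.one_sub_gen_mul_C_f_coeff l k s, fun _ => ⟨fun a b => ?_,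
    fun c d i j hi hj => ?_⟩⟩
  · exact ⟨_, _, FMS.isExpApply_vac l k a b, FMS.isExpApply_chargedVec l k a b,
      FMS.isEval_charged l k a b⟩
  · have hd : MvPowerSeries.constantCoeff (FMS.den c d i j k l) = 1 :=
      FMS.constantCoeff_den c d l k hi hj
    refine ⟨hd, _, _, FMS.isExpApply_neutralTauLeft l k c d hi hj,
      FMS.isEval_neutral l k c d hi hj, ?_⟩
    convert FMS.isExpApply_neutralTau l k c d hi hj using 1
    rw [← Pi.single_smul, smul_eq_mul, ← mul_assoc,
      MvPowerSeries.inv_mul_cancel _ (by rw [hd]; exact one_ne_zero), one_mul]
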